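/- Let $\Omega\subset\mathbb R^3$ be an exterior domain with $C^\infty$ boundary, i.e. a connected open set with bounded complement which near each of its boundary points $p$ has the form $\{\varphi<0\}$ with $\varphi$ smooth and $\nabla\varphi(p)\neq0$. Let $\omega(x)=(1+|x|^2)^{1/2}$ and let $$\mathcal H^1(\Omega)=\{g:\ \omega^{-1}g\in L^2(\Omega),\ \nabla g\in L^2(\Omega)\},\qquad \|g\|_{\mathcal H^1(\Omega)}^2=\|\omega^{-1}g\|_{L^2(\Omega)}^2+\|\nabla g\|_{L^2(\Omega)}^2 ,$$ where functions are real valued and $\nabla g$ is the weak gradient. Let $a:\mathbb R^3\to\mathbb R$ satisfy $a\in C^1(\mathbb R^3)\cap C^2(\overline\Omega)$, $0<C_1<a(x)<C_2$ for all $x\in\Omega$ with some constants $C_1,C_2$, $\omega\nabla a\in L^\infty(\mathbb R^3)$, and $\omega(x)\nabla a(x)\to0$ as $|x|\to\infty$. Put $P_\Delta(x-y)=-\frac1{4\pi|x-y|}$ and $$R(x,y)=-\sum_{i=1}^3\frac{\partial}{\partial x_i}\Big(\frac1{a(x)}\frac{\partial a(x)}{\partial x_i}P_\Delta(x-y)\Big),\qquad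 \mathcal R g(y)=\int_\Omega R(x,y)g(x)\,dx .$$ If $g\in\mathcal H^1(\Omega)$ has bounded support, then for almost every $y\in\Omega$ this integral converges absolutely, and there is exactly one bounded linear operator $\mathcal R:\mathcal H^1(\Omega)\to\mathcal H^1(\Omega)$ which is given almost everywhere on $\Omega$ by this integral for every $g\in\mathcal H^1(\Omega)$ for which the integral converges absolutely for almost every $y\in\Omega$. For every $\varepsilon>0$ there are bounded linear operators $\mathcal R_s,\mathcal R_c$ on $\mathcal H^1(\Omega)$ such that $\mathcal R=\mathcal R_s+\mathcal R_c$, the operator norm of $\mathcal R_s$ on $\mathcal H^1(\Omega)$ is less than $\varepsilon$, and $\mathcal R_c$ is compact on $\mathcal H^1(\Omega)$. Moreover, $I+\mathcal R:\mathcal H^1(\Omega)\to\mathcal H^1(\Omega)$ is a Fredholm operator of index zero. -/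

import Mathlib

open MeasureTheory Filter Topology
open scoped ENNReal ContDiff

noncomputable section

namespace BDIE

/-- Three-dimensional Euclidean space. -/
abbrev E3 : Type := EuclideanSpace ℝ (Fin 3)

/-- An exterior domain with infinitely smooth boundary: a connected open set with bounded
complement which, near each boundary point `p`, is the sublevel set `{φ < 0}` of a smooth function
`φ` with `∇φ(p) ≠ 0`. -/
structure IsSmoothExteriorDomain (Ω : Set E3) : Prop where
  isOpen : IsOpen Ω
  isConnected : IsConnected Ω
  isBounded_compl : Bornology.IsBounded Ωᶜ
  smooth_boundary : ∀ p ∈ frontier Ω, ∃ U : Set E3, IsOpen U ∧ p ∈ U ∧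
    ∃ φ : E3 → ℝ, ContDiffOn ℝ ∞ φ U ∧ fderiv ℝ φ p ≠ 0 ∧ ∀ x ∈ U, (x ∈ Ω ↔ φ x < 0)

/-- The weight `ω(x) = (1 + |x|²)^{1/2}`. -/
def weight (x : E3) : ℝ := Real.sqrt (1 + ‖x‖ ^ 2)

/-- The measure `ω(x)⁻² dx` on `Ω`, so that `L²(ω⁻¹; Ω)`, the space of `g` with `ω⁻¹ g ∈ L²(Ω)`
and norm `‖ω⁻¹ g‖_{L²(Ω)}`, is the `L²` space of this measure. -/
def weightedVolume (Ω : Set E3) : Measure E3 :=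
  (volume.restrict Ω).withDensity (fun x => ENNReal.ofReal ((weight x)⁻¹ ^ 2))

/-- `G` is the weak (distributional) gradient of `g` in `Ω`. -/
def IsWeakGradient (Ω : Set E3) (g : E3 → ℝ) (G : E3 → E3) : Prop :=
  ∀ φ : E3 → ℝ, ContDiff ℝ ∞ φ → HasCompactSupport φ → tsupport φ ⊆ Ω → ∀ v : E3,
    ∫ x in Ω, fderiv ℝ φ x v * g x = - ∫ x in Ω, φ x * inner ℝ (G x) v

lemma weight_pos (x : E3) : 0 < weight x := Real.sqrt_pos.2 (by positivity)

lemma continuous_weight : Continuous weight := by unfold weight; fun_prop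

lemma measurable_weightedVolume_density :
    Measurable (fun x => ENNReal.ofReal ((weight x)⁻¹ ^ 2)) :=
  ENNReal.measurable_ofReal.comp ((continuous_weight.measurable.inv).pow_const 2)

lemma absolutelyContinuous_weightedVolume (Ω : Set E3) :
    volume.restrict Ω ≪ weightedVolume Ω :=
  withDensity_absolutelyContinuous' measurable_weightedVolume_density.aemeasurable
    (Eventually.of_forall fun x => by
      have := weight_pos x
      have h2 : 0 < (weight x)⁻¹ ^ 2 := by positivity
      exact (ENNReal.ofReal_pos.2 h2).ne')

lemma integrable_mul_of_memLp_weightedVolume {Ω : Set E3} {g ψ : E3 → ℝ}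
    (hg : MemLp g 2 (weightedVolume Ω)) (hψ : Continuous ψ) (hs : HasCompactSupport ψ) :
    Integrable (fun x => ψ x * g x) (volume.restrict Ω) := by
  have hle : weightedVolume Ω ≤ volume.restrict Ω := by
    calc weightedVolume Ω ≤ (volume.restrict Ω).withDensity 1 := by
          refine withDensity_mono (Eventually.of_forall fun x => ?_)
          have h1 : 1 ≤ weight x := by
            unfold weight
            rw [Real.one_le_sqrt]
            nlinarith [sq_nonneg ‖x‖]
          have h2 : (weight x)⁻¹ ^ 2 ≤ 1 :=
            pow_le_one₀ (inv_nonneg.2 (weight_pos x).le) (inv_le_one_of_one_le₀ h1)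
          simpa using h2
      _ = volume.restrict Ω := withDensity_one
  have : IsLocallyFiniteMeasure (weightedVolume Ω) := Measure.isLocallyFiniteMeasure_of_le hle
  have hloc := hg.locallyIntegrable (by norm_num)
  have hint : Integrable (fun x => (weight x ^ 2 * ψ x) • g x) (weightedVolume Ω) :=
    hloc.integrable_smul_left_of_hasCompactSupport
      ((continuous_weight.pow 2).mul hψ) hs.mul_left
  unfold weightedVolume at hint
  rw [integrable_withDensity_iff_integrable_smul' measurable_weightedVolume_density
    (Eventually.of_forall fun x => ENNReal.ofReal_lt_top)] at hint
  refine hint.congr (Eventually.of_forall fun x => ?_)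
  have hw := (weight_pos x).ne'
  simp only [smul_eq_mul]
  rw [ENNReal.toReal_ofReal (by positivity)]
  field_simp

lemma integrable_mul_inner_of_memLp {Ω : Set E3} {G : E3 → E3} {ψ : E3 → ℝ}
    (hG : MemLp G 2 (volume.restrict Ω)) (hψ : Continuous ψ) (hs : HasCompactSupport ψ) (v : E3) :
    Integrable (fun x => ψ x * inner ℝ (G x) v) (volume.restrict Ω) :=
  ((hG.inner_const v).locallyIntegrable (by norm_num)).integrable_smul_left_of_hasCompactSupport
    hψ hs

lemma continuous_fderiv_apply_of_contDiff {φ : E3 → ℝ} (hφ : ContDiff ℝ ∞ φ) (v : E3) :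
    Continuous (fun x => fderiv ℝ φ x v) :=
  (hφ.continuous_fderiv (by simp)).clm_apply continuous_const

/-- The weighted Sobolev (Beppo Levi) space `𝓗¹(Ω)`, each `g` being recorded together with its weak
gradient `G`, as a subspace of the Hilbert sum `L²(ω⁻¹; Ω) ⊕ L²(Ω)³`. The norm is
`‖g‖² = ‖ω⁻¹ g‖²_{L²(Ω)} + ‖∇g‖²_{L²(Ω)}`. -/
def weightedSobolev (Ω : Set E3) :
    Submodule ℝ (WithLp 2 (Lp ℝ 2 (weightedVolume Ω) × Lp E3 2 (volume.restrict Ω))) where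
  carrier := {p | IsWeakGradient Ω p.fst p.snd}
  zero_mem' := by
    intro φ _ _ _ v
    have hac := absolutelyContinuous_weightedVolume Ω
    have h1 := hac.ae_le (Lp.coeFn_zero ℝ 2 (weightedVolume Ω))
    have h2 := Lp.coeFn_zero E3 2 (volume.restrict Ω)
    have e1 : ∫ x in Ω, fderiv ℝ φ x v * (0 : Lp ℝ 2 (weightedVolume Ω)) x = 0 := by
      refine integral_eq_zero_of_ae ?_
      filter_upwards [h1] with x hx
      simp only [hx, Pi.zero_apply, mul_zero]
    have e2 : ∫ x in Ω, φ x * inner ℝ ((0 : Lp E3 2 (volume.restrict Ω)) x) v = 0 := by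
      refine integral_eq_zero_of_ae ?_
      filter_upwards [h2] with x hx
      simp only [hx, Pi.zero_apply, inner_zero_left, mul_zero]
    rw [WithLp.zero_fst, WithLp.zero_snd, e1, e2, neg_zero]
  add_mem' := by
    intro p q hp hq φ hφ hs ht v
    have hac := absolutelyContinuous_weightedVolume Ω
    have hd := continuous_fderiv_apply_of_contDiff hφ v
    have hds : HasCompactSupport (fun x => fderiv ℝ φ x v) := hs.fderiv_apply ℝ v
    have e1 : ∫ x in Ω, fderiv ℝ φ x v * (p + q).fst x
        = ∫ x in Ω, (fderiv ℝ φ x v * p.fst x + fderiv ℝ φ x v * q.fst x) := by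
      refine integral_congr_ae ?_
      filter_upwards [hac.ae_le (Lp.coeFn_add p.fst q.fst)] with x hx
      rw [WithLp.add_fst, hx, Pi.add_apply, mul_add]
    have e2 : ∫ x in Ω, φ x * inner ℝ ((p + q).snd x) v
        = ∫ x in Ω, (φ x * inner ℝ (p.snd x) v + φ x * inner ℝ (q.snd x) v) := by
      refine integral_congr_ae ?_
      filter_upwards [Lp.coeFn_add p.snd q.snd] with x hx
      rw [WithLp.add_snd, hx, Pi.add_apply, inner_add_left, mul_add]
    rw [e1, e2,
      integral_add (integrable_mul_of_memLp_weightedVolume (Lp.memLp p.fst) hd hds)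
        (integrable_mul_of_memLp_weightedVolume (Lp.memLp q.fst) hd hds),
      integral_add (integrable_mul_inner_of_memLp (Lp.memLp p.snd) hφ.continuous hs v)
        (integrable_mul_inner_of_memLp (Lp.memLp q.snd) hφ.continuous hs v),
      hp φ hφ hs ht v, hq φ hφ hs ht v, neg_add]
  smul_mem' := by
    intro c p hp φ hφ hs ht v
    have hac := absolutelyContinuous_weightedVolume Ω
    have e1 : ∫ x in Ω, fderiv ℝ φ x v * (c • p).fst x
        = ∫ x in Ω, c * (fderiv ℝ φ x v * p.fst x) := by
      refine integral_congr_ae ?_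
      filter_upwards [hac.ae_le (Lp.coeFn_smul c p.fst)] with x hx
      rw [WithLp.smul_fst, hx, Pi.smul_apply, smul_eq_mul]
      ring
    have e2 : ∫ x in Ω, φ x * inner ℝ ((c • p).snd x) v
        = ∫ x in Ω, c * (φ x * inner ℝ (p.snd x) v) := by
      refine integral_congr_ae ?_
      filter_upwards [Lp.coeFn_smul c p.snd] with x hx
      rw [WithLp.smul_snd, hx, Pi.smul_apply, real_inner_smul_left]
      ring
    rw [e1, e2, integral_const_mul, integral_const_mul, hp φ hφ hs ht v, mul_neg]

/-- The function on `Ω` underlying an element of `𝓗¹(Ω)` (defined up to null sets). -/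
def sobolevFun {Ω : Set E3} (g : weightedSobolev Ω) : E3 → ℝ :=
  (g : WithLp 2 (Lp ℝ 2 (weightedVolume Ω) × Lp E3 2 (volume.restrict Ω))).fst

/-- The fundamental solution of the Laplace operator, `P_Δ(x - y) = -1 / (4π|x - y|)`. -/
def laplaceFundamental (x y : E3) : ℝ := -1 / (4 * Real.pi * ‖x - y‖)

/-- The partial derivative `∂f/∂xᵢ`. -/
def partialDeriv (i : Fin 3) (f : E3 → ℝ) (x : E3) : ℝ :=
  fderiv ℝ f x (EuclideanSpace.single i 1)

/-- The remainder of the parametrix `P(x,y) = P_Δ(x - y) / a(x)`: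
`R(x,y) = - ∑ᵢ ∂/∂xᵢ ( (1/a(x)) (∂a(x)/∂xᵢ) P_Δ(x - y) )`. -/
def remainderKernel (a : E3 → ℝ) (x y : E3) : ℝ :=
  - ∑ i : Fin 3,
      partialDeriv i (fun z => 1 / a z * partialDeriv i a z * laplaceFundamental z y) x

/-- The integral `∫_Ω R(x,y) g(x) dx` converges absolutely for almost every `y ∈ Ω`. -/
def RemainderConverges (Ω : Set E3) (a g : E3 → ℝ) : Prop :=
  ∀ᵐ y ∂(volume.restrict Ω), IntegrableOn (fun x => remainderKernel a x y * g x) Ω volume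

/-- `T` is the remainder potential `𝓡g(y) = ∫_Ω R(x,y) g(x) dx` on `𝓗¹(Ω)`. The integral converges
absolutely for the elements of bounded support, which form a dense subspace, and `T` is the
continuous operator given by the integral whenever the latter converges absolutely. -/
structure IsRemainderPotential (Ω : Set E3) (a : E3 → ℝ)
    (T : weightedSobolev Ω →L[ℝ] weightedSobolev Ω) : Prop where
  converges : ∀ g : weightedSobolev Ω,
    (∃ r : ℝ, ∀ᵐ x ∂(volume.restrict Ω), r < ‖x‖ → sobolevFun g x = 0) →
      RemainderConverges Ω a (sobolevFun g)
  eq_integral : ∀ g : weightedSobolev Ω, RemainderConverges Ω a (sobolevFun g) →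
    ∀ᵐ y ∂(volume.restrict Ω), sobolevFun (T g) y = ∫ x in Ω, remainderKernel a x y * sobolevFun g x

/-- A bounded operator is Fredholm of index zero. -/
def IsFredholmOfIndexZero {X Y : Type*} [NormedAddCommGroup X] [NormedSpace ℝ X]
    [NormedAddCommGroup Y] [NormedSpace ℝ Y] (T : X →L[ℝ] Y) : Prop :=
  T.IsFredholm ∧
    (Module.finrank ℝ T.ker : ℤ) - (Module.finrank ℝ (Y ⧸ T.range) : ℤ) = 0

end BDIE

end

/-! Write b = a⁻¹∇a, so that R(x,y) = -div_x(b(x) P_Δ(x-y)). As P_Δ is a fundamental solution of the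
Laplace operator, u = 𝓡g is formally the decaying solution on ℝ³ of the weak problem ∫ ∇u·∇k = ∫_Ω g
div(bk) for all k. This problem is well posed in the closure `beppoLevi` of the test functions:
Hardy's inequality (`hardy_inequality`) makes the Dirichlet form coercive for the full weighted norm
(`isCoercive_dirichletForm`). The operator is therefore built variationally, without singular
integral estimates.

The right-hand side is split by a cutoff χ_n equal to 1 near the complement of Ω. The field (1-χ_n)b
vanishes near the boundary, so integration by parts leaves no boundary term and turns the far part
into -∫ (1-χ_n) (b·∇g) k. It is bounded by sup((1-χ_n) ω|b|) ‖∇g‖ ‖ω⁻¹k‖, which is small for large n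
because ω∇a → 0 (`IsCoefficient.exists_tail`, `IsCoefficient.exists_cutoff_small`). The near part ∫
g (div(χ_n b) k + χ_n b·∇k) sees g only in L² of a bounded piece of Ω, so its solution operator
(`IsCoefficient.exists_core`) factors through a restriction map which is compact by Rellich's
theorem (`isCompactOperator_sobolevToTruncated`).

The variational solution is identified with the integral by taking for k the Newtonian potential Φ
of a test function ψ. The left side becomes -∫ ψu (`inner_snd_potentialElement`), and for g of
bounded support Fubini turns the right side into -∫ ψ 𝓡g (`IsCoefficient.integral_mul_remainder`);
this gives `IsCoefficient.solution_ae_eq`. Cutoffs are dense in 𝓗¹(Ω), so the operator is unique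
(`IsRemainderPotential.unique`), and the operators constructed for different ε coincide.

Rellich's theorem needs no extension operator here. The smooth boundary gives a local cone
condition, along which a function may be compared with its translates inside Ω. Translates differ
from the function by at most the gradient norm times the shift, so the function is close to its
averages over finitely many balls.

For the Fredholm property, a compact operator on a Hilbert space is nearly of finite rank, so I + 𝓡
is an isomorphism plus a finite rank operator, whose index vanishes by linear algebra. -/

noncomputable section

namespace BDIE

/-! ### Fredholm operators of index zero: identity plus small plus compact -/

section FredholmIndex

/-- A finite rank perturbation of the identity has kernel and cokernel of the same dimension. -/
lemma finrank_ker_eq_finrank_coker_of_finiteRank {X : Type*} [AddCommGroup X] [Module ℝ X]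
    (F : X →ₗ[ℝ] X) [FiniteDimensional ℝ (LinearMap.range F)] :
    Module.finrank ℝ (LinearMap.ker (LinearMap.id + F)) =
      Module.finrank ℝ (X ⧸ LinearMap.range (LinearMap.id + F)) := by
  set T : X →ₗ[ℝ] X := LinearMap.id + F with hT
  set V := LinearMap.range F with hV
  have hTx : ∀ x, T x = x + F x := fun x => rfl
  have hmap : ∀ x ∈ V, T x ∈ V := fun x hx =>
    V.add_mem hx (LinearMap.mem_range_self F x)
  -- Everything reduces to the finite dimensional `V`: the kernel of `T` lies in `V`, and the
  -- cokernel of `T` is that of `TV`, so rank-nullity for `TV` concludes.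
  let TV : V →ₗ[ℝ] V := T.restrict hmap
  let π : V →ₗ[ℝ] X ⧸ LinearMap.range T := (LinearMap.range T).mkQ ∘ₗ V.subtype
  have hπ_surj : Function.Surjective π := by
    intro q
    obtain ⟨x, rfl⟩ := (LinearMap.range T).mkQ_surjective q
    -- Modulo the range of `T`, x is congruent to x - Tx = -Fx, which lies in `V`.
    refine ⟨⟨-F x, V.neg_mem (LinearMap.mem_range_self F x)⟩, ?_⟩
    change (LinearMap.range T).mkQ (-F x) = (LinearMap.range T).mkQ x
    rw [← sub_eq_zero, ← map_sub, Submodule.mkQ_apply, Submodule.Quotient.mk_eq_zero]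
    exact ⟨-x, by simp only [hTx, map_neg]; abel⟩
  have hπ_ker : LinearMap.ker π = LinearMap.range TV := by
    ext v
    constructor
    · intro hv
      have : (v : X) ∈ LinearMap.range T := by
        have hv' : (LinearMap.range T).mkQ (v : X) = 0 := hv
        exact (Submodule.Quotient.mk_eq_zero _).1 hv'
      obtain ⟨x, hx⟩ := this
      have hxV : x ∈ V := by
        have : x = v - F x := by rw [← hx, hTx]; abel
        rw [this]
        exact V.sub_mem v.2 (LinearMap.mem_range_self F x)
      exact ⟨⟨x, hxV⟩, Subtype.ext hx⟩
    · rintro ⟨w, rfl⟩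
      simp [π, TV, Submodule.Quotient.mk_eq_zero]
  have hker : Module.finrank ℝ (LinearMap.ker T) = Module.finrank ℝ (LinearMap.ker TV) := by
    have hsub : ∀ x : LinearMap.ker T, (x : X) ∈ V := by
      intro x
      have h0 : (x : X) + F x = 0 := x.2
      have : (x : X) = -F x := eq_neg_of_add_eq_zero_left h0
      rw [this]
      exact V.neg_mem (LinearMap.mem_range_self F _)
    refine LinearEquiv.finrank_eq (LinearEquiv.ofBijective
      (LinearMap.codRestrict (LinearMap.ker TV)
        (LinearMap.codRestrict V (LinearMap.ker T).subtype hsub) ?_) ⟨?_, ?_⟩)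
    · intro x
      exact Subtype.ext x.2
    · intro x y hxy
      have := congrArg (fun z : LinearMap.ker TV => ((z : V) : X)) hxy
      exact Subtype.ext this
    · intro y
      exact ⟨⟨((y : V) : X), congrArg Subtype.val y.2⟩, rfl⟩
  have h1 := LinearMap.finrank_range_add_finrank_ker π
  have h2 := LinearMap.finrank_range_add_finrank_ker TV
  rw [LinearMap.range_eq_top.2 hπ_surj, finrank_top, hπ_ker] at h1
  omega

open scoped LinearMap.FiniteRangeSetoid in
/-- An isomorphism plus a finite rank operator is Fredholm of index zero. -/
lemma isFredholmOfIndexZero_equiv_add_finiteRank {X : Type*} [NormedAddCommGroup X]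
    [NormedSpace ℝ X] (e : X ≃L[ℝ] X) (F : X →L[ℝ] X)
    (hF : FiniteDimensional ℝ (LinearMap.range (F : X →ₗ[ℝ] X))) :
    IsFredholmOfIndexZero ((e : X →L[ℝ] X) + F) := by
  constructor
  · refine ContinuousLinearMap.IsFredholm.of_isQuasiInverse (v := (e.symm : X →L[ℝ] X)) ?_
    refine LinearMap.IsQuasiInverse.congr e.toLinearEquiv.isQuasiInverse (by rfl) ?_
    rw [LinearMap.FiniteRangeSetoid.equiv_iff_hasNoetherianRange,
      LinearMap.hasNoetherianRange_iff_range]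
    have : ((((e : X →L[ℝ] X) + F : X →L[ℝ] X) : X →ₗ[ℝ] X) - (e.toLinearEquiv : X →ₗ[ℝ] X))
        = (F : X →ₗ[ℝ] X) := by
      ext x; simp
    rw [this]
    infer_instance
  · let G : X →ₗ[ℝ] X := (e.symm.toLinearEquiv : X →ₗ[ℝ] X) ∘ₗ (F : X →ₗ[ℝ] X)
    have hG : FiniteDimensional ℝ (LinearMap.range G) := by
      rw [LinearMap.range_comp (F : X →ₗ[ℝ] X)]
      infer_instance
    -- The factorisation e + F = e ∘ (1 + e⁻¹F) transfers kernel and cokernel to a finite rank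
    -- perturbation of the identity.
    have hfac : (((e : X →L[ℝ] X) + F : X →L[ℝ] X) : X →ₗ[ℝ] X)
        = (e.toLinearEquiv : X →ₗ[ℝ] X) ∘ₗ (LinearMap.id + G) := by
      ext x; simp [G]
    have key := finrank_ker_eq_finrank_coker_of_finiteRank G
    have hk : LinearMap.ker (((e : X →L[ℝ] X) + F : X →L[ℝ] X) : X →ₗ[ℝ] X)
        = LinearMap.ker (LinearMap.id + G) := by
      rw [hfac, LinearEquiv.ker_comp]
    have hr : LinearMap.range (((e : X →L[ℝ] X) + F : X →L[ℝ] X) : X →ₗ[ℝ] X)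
        = (LinearMap.range (LinearMap.id + G)).map (e.toLinearEquiv : X →ₗ[ℝ] X) := by
      rw [hfac, LinearMap.range_comp]
    have hq := (Submodule.Quotient.equiv (LinearMap.range (LinearMap.id + G))
      ((LinearMap.range (LinearMap.id + G)).map (e.toLinearEquiv : X →ₗ[ℝ] X))
      e.toLinearEquiv rfl).finrank_eq
    rw [hk, hr, ← hq, key, sub_self]

/-- A compact operator into a Hilbert space is a norm limit of finite rank operators. -/
lemma exists_finiteRank_norm_sub_lt {X Y : Type*} [NormedAddCommGroup X] [NormedSpace ℝ X]
    [NormedAddCommGroup Y] [InnerProductSpace ℝ Y]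
    (C : X →L[ℝ] Y) (hC : IsCompactOperator C) {ε : ℝ} (hε : 0 < ε) :
    ∃ F : X →L[ℝ] Y, FiniteDimensional ℝ (LinearMap.range (F : X →ₗ[ℝ] Y)) ∧ ‖C - F‖ ≤ ε := by
  have hcpt := hC.isCompact_closure_image_closedBall (𝕜₁ := ℝ) (f := (C : X →ₗ[ℝ] Y)) 1
  obtain ⟨t, -, htfin, ht⟩ := hcpt.finite_cover_balls hε
  -- The approximation is the orthogonal projection of `C` onto the span of a finite ε-net for the
  -- image of the unit ball; projecting moves no point farther than its distance to the net.
  let V : Submodule ℝ Y := Submodule.span ℝ t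
  have hVfin : FiniteDimensional ℝ V := FiniteDimensional.span_of_finite ℝ htfin
  let F : X →L[ℝ] Y := V.starProjection ∘L C
  refine ⟨F, ?_, ?_⟩
  · have hle : LinearMap.range (F : X →ₗ[ℝ] Y) ≤ V := by
      rintro _ ⟨x, rfl⟩
      exact Submodule.starProjection_apply_mem V (C x)
    exact Submodule.finiteDimensional_of_le hle
  · refine ContinuousLinearMap.opNorm_le_of_unit_norm hε.le fun x hx => ?_
    have hmem : C x ∈ closure ((C : X →ₗ[ℝ] Y) '' Metric.closedBall 0 1) :=
      subset_closure ⟨x, by simp [hx], rfl⟩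
    obtain ⟨y, hyt, hy⟩ := Set.mem_iUnion₂.1 (ht hmem)
    have hyV : y ∈ V := Submodule.subset_span hyt
    calc ‖(C - F) x‖ = ‖C x - V.starProjection (C x)‖ := rfl
      _ = ⨅ w : V, ‖C x - w‖ := V.starProjection_minimal (C x)
      _ ≤ ‖C x - (⟨y, hyV⟩ : V)‖ := ciInf_le ⟨0, by rintro _ ⟨w, rfl⟩; exact norm_nonneg _⟩ _
      _ ≤ ε := by rw [← dist_eq_norm]; exact (Metric.mem_ball.1 hy).le

/-- The identity plus a small operator plus a compact operator is Fredholm of index zero. -/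
lemma isFredholmOfIndexZero_id_add_small_add_compact {X : Type*} [NormedAddCommGroup X]
    [InnerProductSpace ℝ X] [CompleteSpace X] (S C : X →L[ℝ] X) (hS : ‖S‖ < 1)
    (hC : IsCompactOperator C) :
    IsFredholmOfIndexZero (ContinuousLinearMap.id ℝ X + (S + C)) := by
  -- With half of the gap 1 - ‖S‖ as tolerance, ‖S + (C - F)‖ ≤ (1 + ‖S‖)/2 < 1, and the Neumann
  -- series inverts 1 + S + (C - F).
  obtain ⟨F, hF, hCF⟩ := exists_finiteRank_norm_sub_lt C hC (ε := (1 - ‖S‖) / 2) (by linarith)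
  have hlt : ‖-(S + (C - F))‖ < 1 := by
    rw [norm_neg]
    have := norm_add_le S (C - F)
    linarith
  let u : (X →L[ℝ] X)ˣ := Units.oneSub (-(S + (C - F))) hlt
  let e : X ≃L[ℝ] X := ContinuousLinearEquiv.ofUnit u
  have he : (e : X →L[ℝ] X) = ContinuousLinearMap.id ℝ X + (S + (C - F)) := by
    have h1 : (e : X →L[ℝ] X) = (u : X →L[ℝ] X) := rfl
    rw [h1, Units.val_oneSub, sub_neg_eq_add]
    rfl
  have := isFredholmOfIndexZero_equiv_add_finiteRank e F hF
  rw [he] at this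
  convert this using 1
  abel

end FredholmIndex

/-! ### Multiplication operators between L² spaces of different measures -/

section LpMultiplication

variable {F F' : Type*} [NormedAddCommGroup F] [NormedSpace ℝ F] [NormedAddCommGroup F']
  [NormedSpace ℝ F']

lemma memLp_clm_apply {μ ν : Measure E3} {m : E3 → F →L[ℝ] F'} {C : ℝ}
    (hm : AEStronglyMeasurable m ν) (hac : ν ≪ μ)
    (hb : ∀ f : E3 → F, AEStronglyMeasurable f μ →
      eLpNorm (fun x => m x (f x)) 2 ν ≤ ENNReal.ofReal C * eLpNorm f 2 μ) (f : Lp F 2 μ) :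
    MemLp (fun x => m x (f x)) 2 ν :=
  ⟨(ContinuousLinearMap.id ℝ (F →L[ℝ] F')).aestronglyMeasurable_comp₂ hm
      ((Lp.aestronglyMeasurable f).mono_ac hac),
    (hb f (Lp.aestronglyMeasurable f)).trans_lt
      (ENNReal.mul_lt_top ENNReal.ofReal_lt_top (Lp.eLpNorm_lt_top f))⟩

/-- Multiplication by an operator valued function, as an operator between `L²` spaces. -/
def lpMul (μ ν : Measure E3) (m : E3 → F →L[ℝ] F') (C : ℝ) (hC : 0 ≤ C)
    (hm : AEStronglyMeasurable m ν) (hac : ν ≪ μ)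
    (hb : ∀ f : E3 → F, AEStronglyMeasurable f μ →
      eLpNorm (fun x => m x (f x)) 2 ν ≤ ENNReal.ofReal C * eLpNorm f 2 μ) :
    Lp F 2 μ →L[ℝ] Lp F' 2 ν :=
  LinearMap.mkContinuous
    { toFun := fun f => (memLp_clm_apply hm hac hb f).toLp
      map_add' := by
        intro f g
        rw [← MemLp.toLp_add, MemLp.toLp_eq_toLp_iff]
        filter_upwards [hac.ae_le (Lp.coeFn_add f g)] with x hx
        rw [hx, Pi.add_apply, map_add, Pi.add_apply]
      map_smul' := by
        intro c f
        rw [RingHom.id_apply, ← MemLp.toLp_const_smul, MemLp.toLp_eq_toLp_iff]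
        filter_upwards [hac.ae_le (Lp.coeFn_smul c f)] with x hx
        rw [hx, Pi.smul_apply, map_smul, Pi.smul_apply] } C (by
      intro f
      rw [LinearMap.coe_mk, AddHom.coe_mk, Lp.norm_toLp, Lp.norm_def,
        ← ENNReal.toReal_ofReal hC, ← ENNReal.toReal_mul]
      exact ENNReal.toReal_mono
        (ENNReal.mul_ne_top ENNReal.ofReal_ne_top (Lp.eLpNorm_ne_top f))
        (hb f (Lp.aestronglyMeasurable f)))

lemma coeFn_lpMul {μ ν : Measure E3} {m : E3 → F →L[ℝ] F'} {C : ℝ} (hC : 0 ≤ C)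
    (hm : AEStronglyMeasurable m ν) (hac : ν ≪ μ)
    (hb : ∀ f : E3 → F, AEStronglyMeasurable f μ →
      eLpNorm (fun x => m x (f x)) 2 ν ≤ ENNReal.ofReal C * eLpNorm f 2 μ) (f : Lp F 2 μ) :
    lpMul μ ν m C hC hm hac hb f =ᵐ[ν] fun x => m x (f x) :=
  MemLp.coeFn_toLp (memLp_clm_apply hm hac hb f)

lemma norm_lpMul_le {μ ν : Measure E3} {m : E3 → F →L[ℝ] F'} {C : ℝ} (hC : 0 ≤ C)
    (hm : AEStronglyMeasurable m ν) (hac : ν ≪ μ)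
    (hb : ∀ f : E3 → F, AEStronglyMeasurable f μ →
      eLpNorm (fun x => m x (f x)) 2 ν ≤ ENNReal.ofReal C * eLpNorm f 2 μ) :
    ‖lpMul μ ν m C hC hm hac hb‖ ≤ C :=
  LinearMap.mkContinuous_norm_le _ hC _

/-- Passing to a smaller measure. -/
def lpMono {μ ν : Measure E3} (h : ν ≤ μ) : Lp F 2 μ →L[ℝ] Lp F 2 ν :=
  lpMul μ ν (fun _ => ContinuousLinearMap.id ℝ F) 1 zero_le_one aestronglyMeasurable_const
    (Measure.absolutelyContinuous_of_le h)
    (fun f _ => by simpa using eLpNorm_mono_measure f h)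

lemma coeFn_lpMono {μ ν : Measure E3} (h : ν ≤ μ) (f : Lp F 2 μ) :
    lpMono h f =ᵐ[ν] f :=
  coeFn_lpMul _ _ _ _ f

end LpMultiplication

/-! ### The weight ω, the measure ω⁻² dx, and truncation to balls -/

section WeightedVolume

lemma one_le_weight (x : E3) : 1 ≤ weight x := by
  unfold weight
  rw [Real.one_le_sqrt]
  nlinarith [sq_nonneg ‖x‖]

lemma weight_sq (x : E3) : weight x ^ 2 = 1 + ‖x‖ ^ 2 :=
  Real.sq_sqrt (by positivity)

lemma weight_le (x : E3) : weight x ≤ 1 + ‖x‖ := by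
  refine abs_le_of_sq_le_sq' ?_ (by positivity) |>.2
  rw [weight_sq]
  nlinarith [norm_nonneg x]

lemma norm_le_weight (x : E3) : ‖x‖ ≤ weight x := by
  refine abs_le_of_sq_le_sq' ?_ (weight_pos x).le |>.2
  rw [weight_sq]
  linarith

lemma measurable_weight : Measurable weight := continuous_weight.measurable

lemma weightedVolume_absolutelyContinuous (Ω : Set E3) :
    weightedVolume Ω ≪ volume.restrict Ω :=
  withDensity_absolutelyContinuous _ _

lemma weightedVolume_mono {Ω Ω' : Set E3} (h : Ω ⊆ Ω') :
    weightedVolume Ω ≤ weightedVolume Ω' :=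
  Measure.le_iff.2 fun s hs => by
    rw [weightedVolume, weightedVolume, withDensity_apply _ hs, withDensity_apply _ hs]
    exact lintegral_mono' (Measure.restrict_mono le_rfl (Measure.restrict_mono h le_rfl)) le_rfl

lemma aestronglyMeasurable_weightedVolume_iff {F : Type*} [TopologicalSpace F] {Ω : Set E3}
    {f : E3 → F} :
    AEStronglyMeasurable f (weightedVolume Ω) ↔ AEStronglyMeasurable f (volume.restrict Ω) :=
  ⟨fun h => h.mono_ac (absolutelyContinuous_weightedVolume Ω),
    fun h => h.mono_ac (weightedVolume_absolutelyContinuous Ω)⟩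

variable {F : Type*} [NormedAddCommGroup F] [NormedSpace ℝ F]

omit [NormedSpace ℝ F] in
lemma eLpNorm_two_eq_lintegral {α : Type*} [MeasurableSpace α] {μ : Measure α} (f : α → F) :
    eLpNorm f 2 μ = (∫⁻ x, ‖f x‖ₑ ^ 2 ∂μ) ^ (1 / 2 : ℝ) := by
  rw [eLpNorm_eq_lintegral_rpow_enorm_toReal (by norm_num) (by norm_num)]
  simp

lemma eLpNorm_weightedVolume (Ω : Set E3) (f : E3 → F) :
    eLpNorm f 2 (weightedVolume Ω) =
      eLpNorm (fun x => (weight x)⁻¹ • f x) 2 (volume.restrict Ω) := by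
  rw [eLpNorm_two_eq_lintegral, eLpNorm_two_eq_lintegral, weightedVolume,
    lintegral_withDensity_eq_lintegral_mul_non_measurable _ measurable_weightedVolume_density
      (Eventually.of_forall fun x => ENNReal.ofReal_lt_top)]
  congr 1
  refine lintegral_congr fun x => ?_
  have hw := weight_pos x
  rw [Pi.mul_apply, enorm_smul, mul_pow, Real.enorm_of_nonneg (inv_pos.2 hw).le,
    ENNReal.ofReal_pow (inv_pos.2 hw).le]

lemma memLp_weightedVolume_iff {Ω : Set E3} {f : E3 → F} :
    MemLp f 2 (weightedVolume Ω) ↔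
      MemLp (fun x => (weight x)⁻¹ • f x) 2 (volume.restrict Ω) := by
  unfold MemLp
  rw [eLpNorm_weightedVolume, aestronglyMeasurable_weightedVolume_iff]
  refine and_congr_left fun _ => ⟨fun h => ?_, fun h => ?_⟩
  · exact (measurable_weight.inv.aestronglyMeasurable).smul h
  · have := (measurable_weight.aestronglyMeasurable (μ := volume.restrict Ω)).smul h
    refine this.congr (Eventually.of_forall fun x => ?_)
    simp only [Pi.smul_apply', smul_smul, mul_inv_cancel₀ (weight_pos x).ne', one_smul]

/-- The part of `Ω` in the ball of radius `r` about the origin. -/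
abbrev truncated (Ω : Set E3) (r : ℝ) : Set E3 := Ω ∩ Metric.ball 0 r

lemma eLpNorm_truncated_le (Ω : Set E3) (r : ℝ) (f : E3 → F) :
    eLpNorm f 2 (volume.restrict (truncated Ω r)) ≤
      ENNReal.ofReal (1 + |r|) * eLpNorm f 2 (weightedVolume Ω) := by
  rw [eLpNorm_weightedVolume]
  calc eLpNorm f 2 (volume.restrict (truncated Ω r))
      ≤ ENNReal.ofReal (1 + |r|) *
          eLpNorm (fun x => (weight x)⁻¹ • f x) 2 (volume.restrict (truncated Ω r)) := by
        refine eLpNorm_le_mul_eLpNorm_of_ae_le_mul ?_ 2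
        filter_upwards [ae_restrict_of_ae_restrict_of_subset
          (Set.inter_subset_right : Ω ∩ Metric.ball 0 r ⊆ _)
          (ae_restrict_mem (Metric.isOpen_ball.measurableSet))] with x hx
        have hw := weight_pos x
        have h1 : weight x ≤ 1 + |r| :=
          (weight_le x).trans (by
            have := mem_ball_zero_iff.1 hx
            linarith [le_abs_self r])
        rw [norm_smul, Real.norm_of_nonneg (inv_pos.2 hw).le, ← mul_assoc]
        refine le_mul_of_one_le_left (norm_nonneg _) ?_
        rw [← div_eq_mul_inv, le_div_iff₀ hw]
        linarith
    _ ≤ _ := by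
        gcongr
        exact Set.inter_subset_left

lemma truncated_absolutelyContinuous (Ω : Set E3) (r : ℝ) :
    volume.restrict (truncated Ω r) ≪ weightedVolume Ω :=
  (Measure.absolutelyContinuous_of_le
    (Measure.restrict_mono Set.inter_subset_left le_rfl)).trans
    (absolutelyContinuous_weightedVolume Ω)

/-- Restriction of weighted `L²` functions to a bounded part of the domain. -/
def restrictTruncated (Ω : Set E3) (r : ℝ) :
    Lp F 2 (weightedVolume Ω) →L[ℝ] Lp F 2 (volume.restrict (truncated Ω r)) :=
  lpMul _ _ (fun _ => ContinuousLinearMap.id ℝ F) (1 + |r|) (by positivity)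
    aestronglyMeasurable_const (truncated_absolutelyContinuous Ω r)
    (fun f _ => eLpNorm_truncated_le Ω r f)

lemma coeFn_restrictTruncated (Ω : Set E3) (r : ℝ) (f : Lp F 2 (weightedVolume Ω)) :
    restrictTruncated Ω r f =ᵐ[volume.restrict (truncated Ω r)] f :=
  coeFn_lpMul _ _ _ _ f

lemma memLp_truncated {Ω : Set E3} {f : E3 → F} (hf : MemLp f 2 (weightedVolume Ω)) (r : ℝ) :
    MemLp f 2 (volume.restrict (BDIE.truncated Ω r)) :=
  ⟨hf.1.mono_ac (truncated_absolutelyContinuous Ω r),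
    (eLpNorm_truncated_le Ω r f).trans_lt (ENNReal.mul_lt_top ENNReal.ofReal_lt_top hf.2)⟩

instance isFiniteMeasure_truncated (Ω : Set E3) (r : ℝ) :
    IsFiniteMeasure (volume.restrict (BDIE.truncated Ω r)) :=
  ⟨by
    rw [Measure.restrict_apply_univ]
    exact (measure_mono Set.inter_subset_right).trans_lt Metric.isBounded_ball.measure_lt_top⟩

lemma integrableOn_truncated {Ω : Set E3} {f : E3 → F}
    (hf : MemLp f 2 (weightedVolume Ω)) (r : ℝ) :
    IntegrableOn f (BDIE.truncated Ω r) :=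
  (memLp_truncated hf r).integrable (by norm_num)

end WeightedVolume

/-! ### Hilbert space structure of 𝓗¹(Ω) and uniqueness of weak gradients -/

section SobolevStructure

/-- The Hilbert sum `L²(ω⁻¹; Ω) ⊕ L²(Ω)³` containing `𝓗¹(Ω)`. -/
abbrev SobolevAmbient (Ω : Set E3) : Type :=
  WithLp 2 (Lp ℝ 2 (weightedVolume Ω) × Lp E3 2 (volume.restrict Ω))

/-- The function component. -/
def valueL (Ω : Set E3) : SobolevAmbient Ω →L[ℝ] Lp ℝ 2 (weightedVolume Ω) :=
  WithLp.fstL 2 ℝ _ _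

/-- The gradient component. -/
def gradientL (Ω : Set E3) : SobolevAmbient Ω →L[ℝ] Lp E3 2 (volume.restrict Ω) :=
  WithLp.sndL 2 ℝ _ _

@[simp] lemma valueL_apply {Ω : Set E3} (p : SobolevAmbient Ω) : valueL Ω p = p.fst := rfl

@[simp] lemma gradientL_apply {Ω : Set E3} (p : SobolevAmbient Ω) : gradientL Ω p = p.snd := rfl

lemma norm_sq_sobolevAmbient {Ω : Set E3} (p : SobolevAmbient Ω) :
    ‖p‖ ^ 2 = ‖p.fst‖ ^ 2 + ‖p.snd‖ ^ 2 :=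
  WithLp.prod_norm_sq_eq_of_L2 p

lemma norm_snd_le {Ω : Set E3} (p : SobolevAmbient Ω) : ‖p.snd‖ ≤ ‖p‖ := by
  refine abs_le_of_sq_le_sq' ?_ (norm_nonneg _) |>.2
  rw [norm_sq_sobolevAmbient]
  nlinarith [sq_nonneg ‖p.fst‖]

lemma continuous_integral_inner {α F : Type*} [MeasurableSpace α] [NormedAddCommGroup F]
    [InnerProductSpace ℝ F] {μ : Measure α} {ψ : α → F} (hψ : MemLp ψ 2 μ) :
    Continuous (fun f : Lp F 2 μ => ∫ x, inner ℝ (ψ x) (f x) ∂μ) := by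
  have : (fun f : Lp F 2 μ => ∫ x, inner ℝ (ψ x) (f x) ∂μ)
      = fun f => inner ℝ (hψ.toLp ψ) f := by
    funext f
    rw [L2.inner_def]
    refine integral_congr_ae ?_
    filter_upwards [hψ.coeFn_toLp] with x hx
    rw [hx]
  rw [this]
  fun_prop

lemma exists_tsupport_subset_ball {F : Type*} [Zero F] {f : E3 → F} (hf : HasCompactSupport f) :
    ∃ r : ℝ, 0 < r ∧ tsupport f ⊆ Metric.ball 0 r := by
  obtain ⟨r, hr, h⟩ := hf.isCompact.isBounded.exists_pos_norm_lt
  exact ⟨r, hr, fun x hx => mem_ball_zero_iff.2 (h x hx)⟩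

lemma setIntegral_eq_truncated {Ω : Set E3} (hΩ : MeasurableSet Ω) {f : E3 → ℝ} {r : ℝ}
    (hf : ∀ x, r ≤ ‖x‖ → f x = 0) :
    ∫ x in Ω, f x = ∫ x in truncated Ω r, f x := by
  refine setIntegral_eq_of_subset_of_forall_sdiff_eq_zero hΩ Set.inter_subset_left ?_
  intro x hx
  refine hf x ?_
  by_contra hlt
  exact hx.2 ⟨hx.1, mem_ball_zero_iff.2 (not_le.1 hlt)⟩

lemma continuous_setIntegral_mul_fst {Ω : Set E3} (hΩ : MeasurableSet Ω) {ψ : E3 → ℝ}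
    (hψ : Continuous ψ) (hs : HasCompactSupport ψ) :
    Continuous (fun p : SobolevAmbient Ω => ∫ x in Ω, ψ x * p.fst x) := by
  obtain ⟨r, -, hr⟩ := exists_tsupport_subset_ball hs
  have hmem : MemLp ψ 2 (volume.restrict (truncated Ω r)) :=
    (hψ.memLp_of_hasCompactSupport hs).restrict _
  have := (continuous_integral_inner hmem).comp
    ((restrictTruncated (F := ℝ) Ω r).continuous.comp (valueL Ω).continuous)
  refine this.congr fun p => ?_
  rw [setIntegral_eq_truncated hΩ (r := r)]
  · refine integral_congr_ae ?_
    filter_upwards [coeFn_restrictTruncated Ω r p.fst] with x hx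
    simp only [Function.comp_apply, valueL_apply, hx]
    simp [mul_comm]
  · intro x hx
    have : x ∉ tsupport ψ := fun h => absurd (mem_ball_zero_iff.1 (hr h)) (not_lt.2 hx)
    rw [image_eq_zero_of_notMem_tsupport this, zero_mul]

lemma continuous_setIntegral_mul_inner_snd {Ω : Set E3} {ψ : E3 → ℝ}
    (hψ : Continuous ψ) (hs : HasCompactSupport ψ) (v : E3) :
    Continuous (fun p : SobolevAmbient Ω => ∫ x in Ω, ψ x * inner ℝ (p.snd x) v) := by
  have hmem : MemLp (fun x => ψ x • v) 2 (volume.restrict Ω) :=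
    ((hψ.smul continuous_const).memLp_of_hasCompactSupport hs.smul_right).restrict _
  have := (continuous_integral_inner hmem).comp (gradientL Ω).continuous
  refine this.congr fun p => ?_
  refine integral_congr_ae (Eventually.of_forall fun x => ?_)
  simp only [gradientL_apply, real_inner_smul_left]
  rw [real_inner_comm]

/-- For a fixed test function both sides of the defining identity are continuous in the pair: the
test function has compact support, where weighted and unweighted L² norms are comparable. The space
is an intersection of closed sets, hence complete. -/
lemma isClosed_weightedSobolev {Ω : Set E3} (hΩ : MeasurableSet Ω) :
    IsClosed (weightedSobolev Ω : Set (SobolevAmbient Ω)) := by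
  have : (weightedSobolev Ω : Set (SobolevAmbient Ω)) =
      ⋂ (φ : E3 → ℝ) (_ : ContDiff ℝ ∞ φ) (_ : HasCompactSupport φ) (_ : tsupport φ ⊆ Ω) (v : E3),
        {p | ∫ x in Ω, fderiv ℝ φ x v * p.fst x = - ∫ x in Ω, φ x * inner ℝ (p.snd x) v} := by
    ext p
    simp only [Set.mem_iInter]
    rfl
  rw [this]
  refine isClosed_iInter fun φ => isClosed_iInter fun hφ => isClosed_iInter fun hs =>
    isClosed_iInter fun _ => isClosed_iInter fun v => ?_
  exact isClosed_eq
    (continuous_setIntegral_mul_fst hΩ (continuous_fderiv_apply_of_contDiff hφ v)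
      (hs.fderiv_apply ℝ v))
    (continuous_setIntegral_mul_inner_snd hφ.continuous hs v).neg

lemma completeSpace_weightedSobolev {Ω : Set E3} (hΩ : MeasurableSet Ω) :
    CompleteSpace (weightedSobolev Ω) :=
  (isClosed_weightedSobolev hΩ).completeSpace_coe

lemma IsWeakGradient.congr {Ω : Set E3} {g g' : E3 → ℝ} {G G' : E3 → E3}
    (h : IsWeakGradient Ω g G) (hg : g =ᵐ[volume.restrict Ω] g')
    (hG : G =ᵐ[volume.restrict Ω] G') : IsWeakGradient Ω g' G' := by
  intro φ hφ hs ht v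
  have h0 := h φ hφ hs ht v
  have e1 : ∫ x in Ω, fderiv ℝ φ x v * g x = ∫ x in Ω, fderiv ℝ φ x v * g' x :=
    integral_congr_ae (by filter_upwards [hg] with x hx; rw [hx])
  have e2 : ∫ x in Ω, φ x * inner ℝ (G x) v = ∫ x in Ω, φ x * inner ℝ (G' x) v :=
    integral_congr_ae (by filter_upwards [hG] with x hx; rw [hx])
  rw [← e1, ← e2, h0]

/-- The weak gradient of an element of `𝓗¹(Ω)`. -/
def sobolevGrad {Ω : Set E3} (g : weightedSobolev Ω) : E3 → E3 := (g : SobolevAmbient Ω).snd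

lemma memLp_sobolevFun {Ω : Set E3} (g : weightedSobolev Ω) :
    MemLp (sobolevFun g) 2 (weightedVolume Ω) := Lp.memLp _

lemma memLp_sobolevGrad {Ω : Set E3} (g : weightedSobolev Ω) :
    MemLp (sobolevGrad g) 2 (volume.restrict Ω) := Lp.memLp _

lemma isWeakGradient_sobolev {Ω : Set E3} (g : weightedSobolev Ω) :
    IsWeakGradient Ω (sobolevFun g) (sobolevGrad g) := g.2

/-- The pair of `L²` classes of a function and a vector field. -/
def ambientOf {Ω : Set E3} {g : E3 → ℝ} {G : E3 → E3} (hg : MemLp g 2 (weightedVolume Ω))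
    (hG : MemLp G 2 (volume.restrict Ω)) : SobolevAmbient Ω :=
  WithLp.toLp 2 (hg.toLp, hG.toLp)

lemma ambientOf_fst {Ω : Set E3} {g : E3 → ℝ} {G : E3 → E3} (hg : MemLp g 2 (weightedVolume Ω))
    (hG : MemLp G 2 (volume.restrict Ω)) : (ambientOf hg hG).fst =ᵐ[volume.restrict Ω] g :=
  (absolutelyContinuous_weightedVolume Ω).ae_le hg.coeFn_toLp

lemma ambientOf_snd {Ω : Set E3} {g : E3 → ℝ} {G : E3 → E3} (hg : MemLp g 2 (weightedVolume Ω))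
    (hG : MemLp G 2 (volume.restrict Ω)) : (ambientOf hg hG).snd =ᵐ[volume.restrict Ω] G :=
  hG.coeFn_toLp

/-- The element of `𝓗¹(Ω)` given by a function and its weak gradient. -/
def sobolevOf {Ω : Set E3} {g : E3 → ℝ} {G : E3 → E3} (hg : MemLp g 2 (weightedVolume Ω))
    (hG : MemLp G 2 (volume.restrict Ω)) (h : IsWeakGradient Ω g G) : weightedSobolev Ω :=
  ⟨ambientOf hg hG, h.congr (ambientOf_fst hg hG).symm (ambientOf_snd hg hG).symm⟩

lemma sobolevFun_sobolevOf {Ω : Set E3} {g : E3 → ℝ} {G : E3 → E3}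
    (hg : MemLp g 2 (weightedVolume Ω)) (hG : MemLp G 2 (volume.restrict Ω))
    (h : IsWeakGradient Ω g G) : sobolevFun (sobolevOf hg hG h) =ᵐ[volume.restrict Ω] g :=
  ambientOf_fst hg hG

lemma sobolevGrad_sobolevOf {Ω : Set E3} {g : E3 → ℝ} {G : E3 → E3}
    (hg : MemLp g 2 (weightedVolume Ω)) (hG : MemLp G 2 (volume.restrict Ω))
    (h : IsWeakGradient Ω g G) : sobolevGrad (sobolevOf hg hG h) =ᵐ[volume.restrict Ω] G :=
  ambientOf_snd hg hG

lemma ambient_ext {Ω : Set E3} {p q : SobolevAmbient Ω}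
    (h₁ : p.fst =ᵐ[volume.restrict Ω] q.fst) (h₂ : p.snd =ᵐ[volume.restrict Ω] q.snd) : p = q := by
  have e1 : p.fst = q.fst :=
    Lp.ext ((weightedVolume_absolutelyContinuous Ω).ae_le h₁)
  have e2 : p.snd = q.snd := Lp.ext h₂
  exact (WithLp.equiv 2 _).injective (Prod.ext e1 e2)

/-- Weak gradients are unique; an element of `𝓗¹(Ω)` is determined by its function. -/
lemma eq_of_sobolevFun_ae_eq {Ω : Set E3} (hΩ : IsOpen Ω) {p q : weightedSobolev Ω}
    (h : sobolevFun p =ᵐ[volume.restrict Ω] sobolevFun q) : p = q := by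
  have hG : ∀ v : E3, ∀ᵐ x, x ∈ Ω → inner ℝ (sobolevGrad p x - sobolevGrad q x) v = 0 := by
    intro v
    have hmem := (memLp_sobolevGrad p).sub (memLp_sobolevGrad q)
    refine hΩ.ae_eq_zero_of_integral_contDiff_smul_eq_zero ?_ ?_
    · exact locallyIntegrableOn_of_locallyIntegrable_restrict
        (((hmem.inner_const v)).locallyIntegrable (by norm_num))
    · intro φ hφ hs ht
      have hp := isWeakGradient_sobolev p φ hφ hs ht v
      have hq := isWeakGradient_sobolev q φ hφ hs ht v
      have e : ∫ x in Ω, fderiv ℝ φ x v * sobolevFun p x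
          = ∫ x in Ω, fderiv ℝ φ x v * sobolevFun q x :=
        integral_congr_ae (by filter_upwards [h] with x hx; rw [hx])
      have hzero : ∀ x, x ∉ Ω →
          φ x • inner ℝ (sobolevGrad p x - sobolevGrad q x) v = 0 := by
        intro x hx
        rw [image_eq_zero_of_notMem_tsupport fun h => hx (ht h), zero_smul]
      rw [← setIntegral_eq_integral_of_forall_compl_eq_zero hzero]
      simp only [smul_eq_mul, inner_sub_left, mul_sub]
      rw [integral_sub
        (integrable_mul_inner_of_memLp (memLp_sobolevGrad p) hφ.continuous hs v)
        (integrable_mul_inner_of_memLp (memLp_sobolevGrad q) hφ.continuous hs v)]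
      linarith
  have hall : sobolevGrad p =ᵐ[volume.restrict Ω] sobolevGrad q := by
    -- The exceptional null set in `hG` depends on the direction, so only the three basis directions
    -- are combined.
    have hb : ∀ᵐ x, ∀ i : Fin 3, x ∈ Ω →
        inner ℝ (sobolevGrad p x - sobolevGrad q x) (EuclideanSpace.single i (1 : ℝ)) = 0 :=
      ae_all_iff.2 fun i => hG _
    filter_upwards [ae_restrict_of_ae hb, ae_restrict_mem hΩ.measurableSet] with x hx hxΩ
    ext i
    have := hx i hxΩ
    rw [EuclideanSpace.inner_single_right] at this
    simpa [sub_eq_zero] using this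
  exact Subtype.ext (ambient_ext h hall)

end SobolevStructure

/-! ### Smooth cutoffs, density of bounded supports, uniqueness of the potential -/

section Cutoff

lemma tendsto_eLpNorm_two_zero_of_dominated {α F : Type*} [MeasurableSpace α]
    [NormedAddCommGroup F] {μ : Measure α} {f : ℕ → α → F} {h : α → ℝ}
    (hf : ∀ n, AEStronglyMeasurable (f n) μ) (hh : MemLp h 2 μ)
    (hb : ∀ n, ∀ᵐ x ∂μ, ‖f n x‖ ≤ h x)
    (hlim : ∀ᵐ x ∂μ, Tendsto (fun n => f n x) atTop (𝓝 0)) :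
    Tendsto (fun n => eLpNorm (f n) 2 μ) atTop (𝓝 0) := by
  simp only [eLpNorm_two_eq_lintegral]
  have key : Tendsto (fun n => ∫⁻ x, ‖f n x‖ₑ ^ 2 ∂μ) atTop (𝓝 (∫⁻ _, 0 ∂μ)) := by
    refine tendsto_lintegral_of_dominated_convergence' (fun x => ‖h x‖ₑ ^ 2)
      (fun n => (hf n).enorm.pow_const 2) (fun n => ?_) ?_ ?_
    · filter_upwards [hb n] with x hx
      gcongr
      rw [enorm_le_iff_norm_le]
      exact hx.trans (le_abs_self _)
    · have := hh.2
      rw [eLpNorm_two_eq_lintegral] at this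
      intro htop
      rw [htop] at this
      simp at this
    · filter_upwards [hlim] with x hx
      have := ((continuous_enorm.tendsto (0 : F)).comp hx)
      have h2 := ((ENNReal.continuous_pow 2).tendsto _).comp this
      simpa [Function.comp_def] using h2
  rw [lintegral_zero] at key
  have := (ENNReal.continuous_rpow_const (y := (1 / 2 : ℝ))).tendsto 0 |>.comp key
  simpa [Function.comp_def] using this

/-- A fixed smooth bump function equal to `1` on the unit ball. -/
def unitBump : ContDiffBump (0 : E3) := ⟨1, 2, one_pos, one_lt_two⟩

/-- Smooth cutoff functions: `1` for `|x| ≤ n + 1` and `0` for `|x| ≥ 2 (n + 1)`. -/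
def cutoff (n : ℕ) (x : E3) : ℝ := unitBump (((n : ℝ) + 1)⁻¹ • x)

lemma contDiff_cutoff (n : ℕ) : ContDiff ℝ ∞ (cutoff n) :=
  unitBump.contDiff.comp (contDiff_const_smul _)

lemma cutoff_nonneg (n : ℕ) (x : E3) : 0 ≤ cutoff n x := unitBump.nonneg

lemma cutoff_le_one (n : ℕ) (x : E3) : cutoff n x ≤ 1 := unitBump.le_one

lemma norm_cutoff_le_one (n : ℕ) (x : E3) : ‖cutoff n x‖ ≤ 1 := by
  rw [Real.norm_of_nonneg (cutoff_nonneg n x)]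
  exact cutoff_le_one n x

lemma cutoff_eq_one {n : ℕ} {x : E3} (h : ‖x‖ ≤ n + 1) : cutoff n x = 1 := by
  refine unitBump.one_of_mem_closedBall ?_
  have hn : (0 : ℝ) < n + 1 := by positivity
  rw [mem_closedBall_zero_iff, norm_smul, norm_inv, Real.norm_of_nonneg hn.le]
  change _ ≤ (1 : ℝ)
  rw [inv_mul_le_iff₀ hn]
  linarith

lemma cutoff_eq_zero {n : ℕ} {x : E3} (h : 2 * (n + 1) ≤ ‖x‖) : cutoff n x = 0 := by
  refine unitBump.zero_of_le_dist ?_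
  have hn : (0 : ℝ) < n + 1 := by positivity
  rw [dist_zero_right, norm_smul, norm_inv, Real.norm_of_nonneg hn.le]
  change (2 : ℝ) ≤ _
  rw [le_inv_mul_iff₀ hn]
  linarith

lemma hasCompactSupport_cutoff (n : ℕ) : HasCompactSupport (cutoff n) := by
  refine HasCompactSupport.intro (isCompact_closedBall (0 : E3) (2 * (n + 1))) fun x hx => ?_
  refine cutoff_eq_zero ?_
  rw [mem_closedBall_zero_iff, not_le] at hx
  exact hx.le

lemma fderiv_cutoff (n : ℕ) (x : E3) :
    fderiv ℝ (cutoff n) x = ((n : ℝ) + 1)⁻¹ • fderiv ℝ unitBump (((n : ℝ) + 1)⁻¹ • x) := by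
  have h1 : HasFDerivAt (fun x : E3 => ((n : ℝ) + 1)⁻¹ • x)
      (((n : ℝ) + 1)⁻¹ • ContinuousLinearMap.id ℝ E3) x :=
    (hasFDerivAt_id x).fun_const_smul _
  have h2 : HasFDerivAt unitBump (fderiv ℝ unitBump (((n : ℝ) + 1)⁻¹ • x))
      (((n : ℝ) + 1)⁻¹ • x) :=
    ((unitBump.contDiff (n := 1)).differentiable (by norm_num) _).hasFDerivAt
  have := (h2.comp x h1).fderiv
  rw [show cutoff n = unitBump ∘ (fun x : E3 => ((n : ℝ) + 1)⁻¹ • x) from rfl, this]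
  ext v
  simp

lemma fderiv_cutoff_eq_zero {n : ℕ} {x : E3} (h : ‖x‖ < n + 1 ∨ 2 * (n + 1) < ‖x‖) :
    fderiv ℝ (cutoff n) x = 0 := by
  rcases h with h | h
  · have : cutoff n =ᶠ[𝓝 x] fun _ => 1 := by
      filter_upwards [continuous_norm.continuousAt.eventually_lt continuousAt_const h] with y hy
      exact cutoff_eq_one hy.le
    rw [this.fderiv_eq, fderiv_fun_const, Pi.zero_apply]
  · have : cutoff n =ᶠ[𝓝 x] fun _ => 0 := by
      filter_upwards [continuousAt_const.eventually_lt continuous_norm.continuousAt h] with y hy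
      exact cutoff_eq_zero hy.le
    rw [this.fderiv_eq, fderiv_fun_const, Pi.zero_apply]

/-- The derivative of χ_n has size 1/(n+1) and vanishes for |x| > 2(n+1); in the remaining region ω
≤ 1 + |x| ≤ 3(n+1), whence the factor 3. Uniformity in n is the point: it bounds the term g∇χ_n by
ω⁻¹g, so that cutting off is uniformly bounded on 𝓗¹(Ω). -/
lemma exists_norm_fderiv_cutoff_le :
    ∃ C : ℝ, 0 ≤ C ∧ ∀ (n : ℕ) (x : E3), ‖fderiv ℝ (cutoff n) x‖ ≤ C * (weight x)⁻¹ := by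
  obtain ⟨C, hC⟩ := ((unitBump.hasCompactSupport.fderiv (𝕜 := ℝ)).exists_bound_of_continuous
    ((unitBump.contDiff (n := 1)).continuous_fderiv (by norm_num)))
  have hC0 : 0 ≤ C := (norm_nonneg _).trans (hC 0)
  refine ⟨3 * C, by positivity, fun n x => ?_⟩
  have hn : (0 : ℝ) < n + 1 := by positivity
  have hn1 : (1 : ℝ) ≤ n + 1 := by linarith [Nat.cast_nonneg (α := ℝ) n]
  have hw := weight_pos x
  by_cases hx : 2 * ((n : ℝ) + 1) < ‖x‖
  · rw [fderiv_cutoff_eq_zero (Or.inr hx), norm_zero]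
    positivity
  · rw [fderiv_cutoff, norm_smul, norm_inv, Real.norm_of_nonneg hn.le, ← div_eq_mul_inv,
      le_div_iff₀ hw, inv_mul_eq_div, div_mul_eq_mul_div, div_le_iff₀ hn]
    have h3 : weight x ≤ 3 * (n + 1) := (weight_le x).trans (by linarith)
    calc ‖fderiv ℝ unitBump (((n : ℝ) + 1)⁻¹ • x)‖ * weight x
        ≤ C * (3 * (n + 1)) := by gcongr; exact hC _
      _ = 3 * C * (n + 1) := by ring

lemma gradient_add_fun {f g : E3 → ℝ} {x : E3} (hf : DifferentiableAt ℝ f x)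
    (hg : DifferentiableAt ℝ g x) :
    gradient (fun y => f y + g y) x = gradient f x + gradient g x := by
  simp only [gradient, fderiv_fun_add hf hg, map_add]

lemma inner_gradient (f : E3 → ℝ) (x v : E3) : inner ℝ (gradient f x) v = fderiv ℝ f x v := by
  rw [gradient, InnerProductSpace.toDual_symm_apply]

lemma norm_gradient (f : E3 → ℝ) (x : E3) : ‖gradient f x‖ = ‖fderiv ℝ f x‖ := by
  rw [gradient, LinearIsometryEquiv.norm_map]

lemma gradient_mul_fun {f g : E3 → ℝ} {x : E3} (hf : DifferentiableAt ℝ f x)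
    (hg : DifferentiableAt ℝ g x) :
    gradient (fun y => f y * g y) x = f x • gradient g x + g x • gradient f x := by
  refine ext_inner_right ℝ fun v => ?_
  rw [inner_gradient, fderiv_fun_mul hf hg, inner_add_left, real_inner_smul_left,
    real_inner_smul_left, inner_gradient, inner_gradient]
  rfl

lemma continuous_gradient {f : E3 → ℝ} (hf : ContDiff ℝ ∞ f) : Continuous (gradient f) :=
  (InnerProductSpace.toDual ℝ E3).symm.continuous.comp (hf.continuous_fderiv (by simp))

lemma integrable_mul_of_memLp {Ω : Set E3} {g ψ : E3 → ℝ}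
    (hg : MemLp g 2 (weightedVolume Ω)) (hψ : Continuous ψ) (hs : HasCompactSupport ψ) :
    Integrable (fun x => ψ x * g x) (volume.restrict Ω) :=
  integrable_mul_of_memLp_weightedVolume hg hψ hs

/-- Product rule for the weak gradient. -/
lemma IsWeakGradient.mul_left {Ω : Set E3} {g χ : E3 → ℝ} {G : E3 → E3}
    (h : IsWeakGradient Ω g G) (hg : MemLp g 2 (weightedVolume Ω))
    (hG : MemLp G 2 (volume.restrict Ω)) (hχ : ContDiff ℝ ∞ χ) :
    IsWeakGradient Ω (fun x => χ x * g x) (fun x => χ x • G x + g x • gradient χ x) := by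
  intro φ hφ hs ht v
  have h0 := h (fun x => φ x * χ x) (hφ.mul hχ) hs.mul_right
    ((tsupport_mul_subset_left).trans ht) v
  have hd : ∀ x, fderiv ℝ (fun x => φ x * χ x) x v
      = φ x * fderiv ℝ χ x v + χ x * fderiv ℝ φ x v := fun x => by
    rw [fderiv_fun_mul (hφ.differentiable (by simp) x) (hχ.differentiable (by simp) x)]
    rfl
  have i1 : Integrable (fun x => (φ x * fderiv ℝ χ x v) * g x) (volume.restrict Ω) :=
    integrable_mul_of_memLp hg (hφ.continuous.mul (continuous_fderiv_apply_of_contDiff hχ v))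
      hs.mul_right
  have i2 : Integrable (fun x => (χ x * fderiv ℝ φ x v) * g x) (volume.restrict Ω) :=
    integrable_mul_of_memLp hg (hχ.continuous.mul (continuous_fderiv_apply_of_contDiff hφ v))
      (hs.fderiv_apply ℝ v).mul_left
  have i3 : Integrable (fun x => (φ x * χ x) * inner ℝ (G x) v) (volume.restrict Ω) :=
    integrable_mul_inner_of_memLp hG (hφ.continuous.mul hχ.continuous) hs.mul_right v
  have e1 : ∫ x in Ω, fderiv ℝ (fun x => φ x * χ x) x v * g x
      = (∫ x in Ω, (φ x * fderiv ℝ χ x v) * g x) + ∫ x in Ω, (χ x * fderiv ℝ φ x v) * g x := by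
    rw [← integral_add i1 i2]
    refine integral_congr_ae (Eventually.of_forall fun x => ?_)
    simp only [hd]
    ring
  have e2 : ∫ x in Ω, fderiv ℝ φ x v * (χ x * g x)
      = ∫ x in Ω, (χ x * fderiv ℝ φ x v) * g x :=
    integral_congr_ae (Eventually.of_forall fun x => by simp only; ring)
  have e3 : ∫ x in Ω, φ x * inner ℝ (χ x • G x + g x • gradient χ x) v
      = (∫ x in Ω, (φ x * χ x) * inner ℝ (G x) v) +
        ∫ x in Ω, (φ x * fderiv ℝ χ x v) * g x := by
    rw [← integral_add i3 i1]
    refine integral_congr_ae (Eventually.of_forall fun x => ?_)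
    simp only [inner_add_left, real_inner_smul_left, inner_gradient]
    ring
  rw [e1] at h0
  rw [e2, e3]
  linarith

lemma memLp_cutoff_mul {Ω : Set E3} {g : E3 → ℝ} (hg : MemLp g 2 (weightedVolume Ω)) (n : ℕ) :
    MemLp (fun x => cutoff n x * g x) 2 (weightedVolume Ω) := by
  refine hg.of_le_mul (c := 1)
    ((contDiff_cutoff n).continuous.aestronglyMeasurable.mul hg.1) ?_
  refine Eventually.of_forall fun x => ?_
  rw [norm_mul]
  exact mul_le_mul_of_nonneg_right (norm_cutoff_le_one n x) (norm_nonneg _)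

/-- The pointwise gradient of a cutoff of a function with gradient `G`. -/
def cutoffGrad (n : ℕ) (g : E3 → ℝ) (G : E3 → E3) (x : E3) : E3 :=
  cutoff n x • G x + g x • gradient (cutoff n) x

lemma aestronglyMeasurable_cutoffGrad {Ω : Set E3} {g : E3 → ℝ} {G : E3 → E3}
    (hg : MemLp g 2 (weightedVolume Ω)) (hG : MemLp G 2 (volume.restrict Ω)) (n : ℕ) :
    AEStronglyMeasurable (cutoffGrad n g G) (volume.restrict Ω) :=
  ((contDiff_cutoff n).continuous.aestronglyMeasurable.smul hG.1).add
    ((aestronglyMeasurable_weightedVolume_iff.1 hg.1).smul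
      (continuous_gradient (contDiff_cutoff n)).aestronglyMeasurable)

lemma exists_norm_cutoffGrad_le :
    ∃ C : ℝ, 0 ≤ C ∧ ∀ (n : ℕ) (g : E3 → ℝ) (G : E3 → E3) (x : E3),
      ‖cutoffGrad n g G x‖ ≤ ‖G x‖ + C * ‖(weight x)⁻¹ • g x‖ := by
  obtain ⟨C, hC0, hC⟩ := exists_norm_fderiv_cutoff_le
  refine ⟨C, hC0, fun n g G x => ?_⟩
  have hw := weight_pos x
  refine (norm_add_le _ _).trans (add_le_add ?_ ?_)
  · rw [norm_smul]
    exact mul_le_of_le_one_left (norm_nonneg _) (norm_cutoff_le_one n x)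
  · rw [norm_smul, norm_smul, norm_gradient, Real.norm_of_nonneg (inv_pos.2 hw).le]
    calc ‖g x‖ * ‖fderiv ℝ (cutoff n) x‖ ≤ ‖g x‖ * (C * (weight x)⁻¹) := by gcongr; exact hC n x
      _ = _ := by ring

lemma memLp_cutoffGrad {Ω : Set E3} {g : E3 → ℝ} {G : E3 → E3}
    (hg : MemLp g 2 (weightedVolume Ω)) (hG : MemLp G 2 (volume.restrict Ω)) (n : ℕ) :
    MemLp (cutoffGrad n g G) 2 (volume.restrict Ω) := by
  obtain ⟨C, hC0, hC⟩ := exists_norm_cutoffGrad_le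
  refine (hG.norm.add ((memLp_weightedVolume_iff.1 hg).norm.const_mul C)).mono'
    (aestronglyMeasurable_cutoffGrad hg hG n) (Eventually.of_forall fun x => hC n g G x)

lemma eventually_cutoff_eq (x : E3) :
    ∀ᶠ n : ℕ in atTop, cutoff n x = 1 ∧ fderiv ℝ (cutoff n) x = 0 := by
  filter_upwards [eventually_ge_atTop (Nat.ceil ‖x‖)] with n hn
  have : ‖x‖ < n + 1 := by
    have := Nat.le_ceil ‖x‖
    have h2 : ((Nat.ceil ‖x‖ : ℕ) : ℝ) ≤ n := by exact_mod_cast hn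
    linarith
  exact ⟨cutoff_eq_one this.le, fderiv_cutoff_eq_zero (Or.inl this)⟩

/-- Cutoffs converge to the original pair. -/
lemma tendsto_ambientOf_cutoff {Ω : Set E3} {g : E3 → ℝ} {G : E3 → E3}
    (hg : MemLp g 2 (weightedVolume Ω)) (hG : MemLp G 2 (volume.restrict Ω)) :
    Tendsto (fun n => ambientOf (memLp_cutoff_mul hg n) (memLp_cutoffGrad hg hG n)) atTop
      (𝓝 (ambientOf hg hG)) := by
  have t1 : Tendsto (fun n => (memLp_cutoff_mul hg n).toLp) atTop (𝓝 hg.toLp) := by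
    rw [Lp.tendsto_Lp_iff_tendsto_eLpNorm'']
    refine tendsto_eLpNorm_two_zero_of_dominated (h := fun x => 2 * ‖g x‖) (fun n =>
      (memLp_cutoff_mul hg n).1.sub hg.1) (hg.norm.const_mul 2) (fun n => ?_) ?_
    · refine Eventually.of_forall fun x => (norm_sub_le _ _).trans ?_
      have : ‖cutoff n x * g x‖ ≤ ‖g x‖ := by
        rw [norm_mul]
        exact mul_le_of_le_one_left (norm_nonneg _) (norm_cutoff_le_one n x)
      linarith
    · refine Eventually.of_forall fun x => tendsto_const_nhds.congr' ?_
      filter_upwards [eventually_cutoff_eq x] with n hn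
      simp [hn.1]
  have t2 : Tendsto (fun n => (memLp_cutoffGrad hg hG n).toLp) atTop (𝓝 hG.toLp) := by
    rw [Lp.tendsto_Lp_iff_tendsto_eLpNorm'']
    obtain ⟨C, hC0, hC⟩ := exists_norm_cutoffGrad_le
    refine tendsto_eLpNorm_two_zero_of_dominated
      (h := fun x => (‖G x‖ + C * ‖(weight x)⁻¹ • g x‖) + ‖G x‖) (fun n =>
      (memLp_cutoffGrad hg hG n).1.sub hG.1)
      ((hG.norm.add ((memLp_weightedVolume_iff.1 hg).norm.const_mul C)).add hG.norm)
      (fun n => ?_) ?_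
    · exact Eventually.of_forall fun x => (norm_sub_le _ _).trans
        (add_le_add (hC n g G x) le_rfl)
    · refine Eventually.of_forall fun x => tendsto_const_nhds.congr' ?_
      filter_upwards [eventually_cutoff_eq x] with n hn
      simp [cutoffGrad, hn.1, gradient, hn.2]
  exact ((WithLp.prod_continuous_toLp 2 _ _).tendsto _).comp (t1.prodMk_nhds t2)

/-- The cutoff of an element of `𝓗¹(Ω)`. -/
def sobolevCutoff {Ω : Set E3} (n : ℕ) (g : weightedSobolev Ω) : weightedSobolev Ω :=
  sobolevOf (memLp_cutoff_mul (memLp_sobolevFun g) n)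
    (memLp_cutoffGrad (memLp_sobolevFun g) (memLp_sobolevGrad g) n)
    ((isWeakGradient_sobolev g).mul_left (memLp_sobolevFun g) (memLp_sobolevGrad g)
      (contDiff_cutoff n))

lemma sobolevFun_sobolevCutoff {Ω : Set E3} (n : ℕ) (g : weightedSobolev Ω) :
    sobolevFun (sobolevCutoff n g) =ᵐ[volume.restrict Ω] fun x => cutoff n x * sobolevFun g x :=
  sobolevFun_sobolevOf _ _ _

lemma sobolevGrad_sobolevCutoff {Ω : Set E3} (n : ℕ) (g : weightedSobolev Ω) :
    sobolevGrad (sobolevCutoff n g) =ᵐ[volume.restrict Ω]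
      cutoffGrad n (sobolevFun g) (sobolevGrad g) :=
  sobolevGrad_sobolevOf _ _ _

lemma tendsto_sobolevCutoff {Ω : Set E3} (g : weightedSobolev Ω) :
    Tendsto (fun n => sobolevCutoff n g) atTop (𝓝 g) := by
  rw [tendsto_subtype_rng]
  have h := tendsto_ambientOf_cutoff (memLp_sobolevFun g) (memLp_sobolevGrad g)
  have : ambientOf (memLp_sobolevFun g) (memLp_sobolevGrad g) = (g : SobolevAmbient Ω) :=
    ambient_ext (ambientOf_fst _ _) (ambientOf_snd _ _)
  rw [this] at h
  exact h

lemma sobolevCutoff_bounded {Ω : Set E3} (n : ℕ) (g : weightedSobolev Ω) :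
    ∃ r : ℝ, ∀ᵐ x ∂(volume.restrict Ω), r < ‖x‖ → sobolevFun (sobolevCutoff n g) x = 0 := by
  refine ⟨2 * (n + 1), ?_⟩
  filter_upwards [sobolevFun_sobolevCutoff n g] with x hx hr
  rw [hx, cutoff_eq_zero hr.le, zero_mul]

/-- A remainder potential is determined by its values on functions of bounded support. -/
lemma IsRemainderPotential.unique {Ω : Set E3} (hΩ : IsOpen Ω) {a : E3 → ℝ}
    {T T' : weightedSobolev Ω →L[ℝ] weightedSobolev Ω} (hT : IsRemainderPotential Ω a T)
    (hT' : IsRemainderPotential Ω a T') : T' = T := by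
  ext1 g
  refine tendsto_nhds_unique ((T'.continuous.tendsto g).comp (tendsto_sobolevCutoff g)) ?_
  refine ((T.continuous.tendsto g).comp (tendsto_sobolevCutoff g)).congr fun n => ?_
  -- A cutoff has bounded support, so `converges` supplies the absolute convergence under which both
  -- operators are given by the same integral.
  have hc := hT.converges _ (sobolevCutoff_bounded n g)
  refine eq_of_sobolevFun_ae_eq hΩ ?_
  filter_upwards [hT.eq_integral _ hc, hT'.eq_integral _ hc] with y h1 h2
  exact h1.trans h2.symm

lemma exists_subseq_ae_tendsto_sobolevFun {Ω : Set E3} {g : weightedSobolev Ω}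
    {f : ℕ → weightedSobolev Ω} (h : Tendsto f atTop (𝓝 g)) :
    ∃ ns : ℕ → ℕ, StrictMono ns ∧ ∀ᵐ x ∂(volume.restrict Ω),
      Tendsto (fun i => sobolevFun (f (ns i)) x) atTop (𝓝 (sobolevFun g x)) := by
  have h1 : Tendsto (fun n => valueL Ω (f n)) atTop (𝓝 (valueL Ω g)) :=
    ((valueL Ω).continuous.tendsto _).comp ((continuous_subtype_val.tendsto g).comp h)
  obtain ⟨ns, hns, hlim⟩ := (tendstoInMeasure_of_tendsto_Lp h1).exists_seq_tendsto_ae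
  exact ⟨ns, hns, (absolutelyContinuous_weightedVolume Ω).ae_le hlim⟩

/-- It suffices to verify the integral formula of a remainder potential on cutoffs. -/
lemma isRemainderPotential_of_cutoff {Ω : Set E3} {a : E3 → ℝ}
    {T : weightedSobolev Ω →L[ℝ] weightedSobolev Ω}
    (hconv : ∀ g : weightedSobolev Ω,
      (∃ r : ℝ, ∀ᵐ x ∂(volume.restrict Ω), r < ‖x‖ → sobolevFun g x = 0) →
        RemainderConverges Ω a (sobolevFun g))
    (hcut : ∀ (g : weightedSobolev Ω) (n : ℕ), ∀ᵐ y ∂(volume.restrict Ω),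
      sobolevFun (T (sobolevCutoff n g)) y =
        ∫ x in Ω, remainderKernel a x y * (cutoff n x * sobolevFun g x)) :
    IsRemainderPotential Ω a T where
  converges := hconv
  eq_integral := by
    intro g hg
    -- Norm convergence yields pointwise convergence almost everywhere only along a subsequence,
    -- which is enough to identify the limit.
    obtain ⟨ns, hns, hlim⟩ := exists_subseq_ae_tendsto_sobolevFun
      ((T.continuous.tendsto g).comp (tendsto_sobolevCutoff g))
    filter_upwards [hlim, hg, ae_all_iff.2 (hcut g)] with y h1 h2 h3
    refine tendsto_nhds_unique h1 ?_
    simp only [Function.comp_apply, h3]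
    refine Tendsto.comp (g := fun n => ∫ x in Ω,
      remainderKernel a x y * (cutoff n x * sobolevFun g x)) ?_ hns.tendsto_atTop
    -- Since |χ_n| ≤ 1, the integrand for g itself, assumed integrable for this y, is a majorant.
    refine tendsto_integral_of_dominated_convergence
      (fun x => ‖remainderKernel a x y * sobolevFun g x‖) (fun n => ?_) h2.norm (fun n => ?_) ?_
    · refine (h2.1.mul (contDiff_cutoff n).continuous.aestronglyMeasurable).congr
        (Eventually.of_forall fun x => ?_)
      simp only [Pi.mul_apply]
      ring
    · refine Eventually.of_forall fun x => ?_
      rw [norm_mul, norm_mul, norm_mul]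
      gcongr
      exact mul_le_of_le_one_left (norm_nonneg _) (norm_cutoff_le_one n x)
    · refine Eventually.of_forall fun x => tendsto_const_nhds.congr' ?_
      filter_upwards [eventually_cutoff_eq x] with n hn
      rw [hn.1, one_mul]

end Cutoff

/-! ### Hardy's inequality and the Dirichlet problem in the Beppo Levi space -/

section Hardy

lemma integral_weightedVolume (Ω : Set E3) (f : E3 → ℝ) :
    ∫ x, f x ∂(weightedVolume Ω) = ∫ x in Ω, (weight x)⁻¹ ^ 2 * f x := by
  rw [weightedVolume, integral_withDensity_eq_integral_toReal_smul
    measurable_weightedVolume_density (Eventually.of_forall fun x => ENNReal.ofReal_lt_top)]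
  refine integral_congr_ae (Eventually.of_forall fun x => ?_)
  simp only [smul_eq_mul]
  rw [ENNReal.toReal_ofReal (by positivity)]

lemma L2_norm_sq_eq_integral {α F : Type*} [MeasurableSpace α] [NormedAddCommGroup F]
    [InnerProductSpace ℝ F] {μ : Measure α} (f : Lp F 2 μ) : ‖f‖ ^ 2 = ∫ x, ‖f x‖ ^ 2 ∂μ := by
  rw [← real_inner_self_eq_norm_sq, L2.inner_def]
  simp only [real_inner_self_eq_norm_sq]

/-- The coordinate direction `eᵢ`. -/
abbrev basisVec (i : Fin 3) : E3 := EuclideanSpace.single i 1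

lemma inner_basisVec (x : E3) (i : Fin 3) : inner ℝ x (basisVec i) = x i := by
  rw [EuclideanSpace.inner_single_right]; simp

lemma inner_eq_sum (x y : E3) : inner ℝ x y = ∑ i, x i * y i := by
  rw [PiLp.inner_apply]
  exact Finset.sum_congr rfl fun i _ => by simp [mul_comm]

lemma norm_sq_eq_sum (x : E3) : ‖x‖ ^ 2 = ∑ i, x i ^ 2 := by
  rw [EuclideanSpace.norm_sq_eq]; simp

lemma gradient_apply (f : E3 → ℝ) (x : E3) (i : Fin 3) :
    gradient f x i = fderiv ℝ f x (basisVec i) := by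
  rw [← inner_basisVec, inner_gradient]

lemma integral_mul_fderiv_of_hasCompactSupport {f g : E3 → ℝ} (hf : ContDiff ℝ 1 f)
    (hg : ContDiff ℝ 1 g) (hs : HasCompactSupport g) (v : E3) :
    ∫ x, f x * fderiv ℝ g x v = - ∫ x, fderiv ℝ f x v * g x := by
  have cf := (hf.continuous_fderiv (by norm_num)).clm_apply (continuous_const (y := v))
  have cg := (hg.continuous_fderiv (by norm_num)).clm_apply (continuous_const (y := v))
  exact integral_mul_fderiv_eq_neg_fderiv_mul_of_integrable
    ((cf.mul hg.continuous).integrable_of_hasCompactSupport hs.mul_left)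
    ((hf.continuous.mul cg).integrable_of_hasCompactSupport (hs.fderiv_apply ℝ v).mul_left)
    ((hf.continuous.mul hg.continuous).integrable_of_hasCompactSupport hs.mul_left)
    (fun x _ => hf.differentiable (by norm_num) x) (fun x _ => hg.differentiable (by norm_num) x)

/-- The components of the vector field `x / (1 + |x|²)`. -/
def hardyField (i : Fin 3) (x : E3) : ℝ := (1 + ‖x‖ ^ 2)⁻¹ * x i

lemma contDiff_hardyField (i : Fin 3) : ContDiff ℝ 1 (hardyField i) := by
  have h1 : ContDiff ℝ 1 (fun x : E3 => 1 + ‖x‖ ^ 2) := contDiff_const.add (contDiff_norm_sq ℝ)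
  have h2 : ContDiff ℝ 1 (fun x : E3 => x i) := (EuclideanSpace.proj (𝕜 := ℝ) i).contDiff
  exact (h1.inv fun x => by positivity).mul h2

lemma fderiv_hardyField (i : Fin 3) (x : E3) :
    fderiv ℝ (hardyField i) x (basisVec i)
      = (1 + ‖x‖ ^ 2)⁻¹ - 2 * (x i) ^ 2 * ((1 + ‖x‖ ^ 2)⁻¹) ^ 2 := by
  have hpos : (1 + ‖x‖ ^ 2) ≠ 0 := by positivity
  have h1 : HasFDerivAt (fun x : E3 => 1 + ‖x‖ ^ 2) (2 • innerSL ℝ x) x :=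
    (hasStrictFDerivAt_norm_sq x).hasFDerivAt.const_add 1
  have h2 : HasFDerivAt (fun x : E3 => x i) (EuclideanSpace.proj (𝕜 := ℝ) i) x :=
    (EuclideanSpace.proj (𝕜 := ℝ) i).hasFDerivAt
  have h3 := (hasDerivAt_inv hpos).comp_hasFDerivAt x h1
  have h4 := (h3.mul h2).fderiv
  have h5 : hardyField i = ((fun y : ℝ => y⁻¹) ∘ fun x : E3 => 1 + ‖x‖ ^ 2) * fun x => x i := rfl
  rw [h5, h4]
  simp only [Function.comp_apply, add_apply, smul_apply,
    smul_eq_mul, innerSL_apply_apply, PiLp.proj_apply, inner_basisVec]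
  simp
  ring

/-- **Hardy's inequality** for test functions. -/
lemma hardy_inequality {φ : E3 → ℝ} (hφ : ContDiff ℝ ∞ φ) (hs : HasCompactSupport φ) :
    ∫ x, (weight x)⁻¹ ^ 2 * φ x ^ 2 ≤ 4 * ∫ x, ‖gradient φ x‖ ^ 2 := by
  have hw2 : ∀ x : E3, (weight x)⁻¹ ^ 2 = (1 + ‖x‖ ^ 2)⁻¹ := fun x => by
    rw [inv_pow, weight_sq]
  have hsq : ContDiff ℝ 1 (fun x => φ x * φ x) := (hφ.mul hφ).of_le (by simp)
  have hsqs : HasCompactSupport (fun x => φ x * φ x) := hs.mul_left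
  have hcw : Continuous (fun x => (weight x)⁻¹) :=
    continuous_weight.inv₀ fun x => (weight_pos x).ne'
  have i1 : Integrable (fun x => (weight x)⁻¹ ^ 2 * φ x ^ 2) := by
    refine Continuous.integrable_of_hasCompactSupport ((hcw.pow 2).mul (hφ.continuous.pow 2)) ?_
    simp only [pow_two]
    exact hsqs.mul_left
  have i2 : Integrable (fun x => ‖gradient φ x‖ ^ 2) := by
    refine Continuous.integrable_of_hasCompactSupport ((continuous_gradient hφ).norm.pow 2) ?_
    simp only [norm_gradient, pow_two]
    exact (hs.fderiv (𝕜 := ℝ)).norm.mul_left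
  have cX : ∀ i, Continuous (fun x => fderiv ℝ (hardyField i) x (basisVec i)) := fun i =>
    ((contDiff_hardyField i).continuous_fderiv (by norm_num)).clm_apply continuous_const
  have i3 : ∀ i, Integrable (fun x => fderiv ℝ (hardyField i) x (basisVec i) * (φ x * φ x)) :=
    fun i => ((cX i).mul hsq.continuous).integrable_of_hasCompactSupport hsqs.mul_left
  have i4 : ∀ i, Integrable
      (fun x => hardyField i x * fderiv ℝ (fun x => φ x * φ x) x (basisVec i)) := fun i =>
    ((contDiff_hardyField i).continuous.mul ((hsq.continuous_fderiv (by norm_num)).clm_apply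
      continuous_const)).integrable_of_hasCompactSupport (hsqs.fderiv_apply ℝ _).mul_left
  -- Integration by parts with X = x/(1+|x|²): ∫ (div X) φ² = -∫ X·∇(φ²).
  have key : ∫ x, ∑ i, fderiv ℝ (hardyField i) x (basisVec i) * (φ x * φ x)
      = - ∫ x, ∑ i, hardyField i x * fderiv ℝ (fun x => φ x * φ x) x (basisVec i) := by
    rw [integral_finsetSum _ fun i _ => i3 i, integral_finsetSum _ fun i _ => i4 i,
      ← Finset.sum_neg_distrib]
    refine Finset.sum_congr rfl fun i _ => ?_
    rw [integral_mul_fderiv_of_hasCompactSupport (contDiff_hardyField i) hsq hsqs, neg_neg]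
  -- In dimension three div X = (3 + |x|²)/(1 + |x|²)², which is at least ω⁻².
  have lower : ∀ x, (weight x)⁻¹ ^ 2 * φ x ^ 2
      ≤ ∑ i, fderiv ℝ (hardyField i) x (basisVec i) * (φ x * φ x) := by
    intro x
    rw [← Finset.sum_mul, hw2, pow_two (φ x)]
    refine mul_le_mul_of_nonneg_right ?_ (mul_self_nonneg _)
    simp only [fderiv_hardyField]
    rw [Finset.sum_sub_distrib _ _, ← Finset.sum_mul, ← Finset.mul_sum, ← norm_sq_eq_sum]
    have h1 : (0 : ℝ) < 1 + ‖x‖ ^ 2 := by positivity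
    have h2 : ‖x‖ ^ 2 * (1 + ‖x‖ ^ 2)⁻¹ ≤ 1 := by
      rw [← div_eq_mul_inv, div_le_one h1]; linarith
    have h3 : 0 < (1 + ‖x‖ ^ 2)⁻¹ := inv_pos.2 h1
    simp only [Finset.sum_const, Finset.card_univ, Fintype.card_fin, nsmul_eq_mul]
    push_cast
    nlinarith
  -- As |X| ≤ ω⁻¹, Young's inequality gives 2 ω⁻¹|φ||∇φ| ≤ ½ ω⁻²φ² + 2|∇φ|². Absorbing the half on
  -- the left produces the constant 4.
  have upper : ∀ x, -∑ i, hardyField i x * fderiv ℝ (fun x => φ x * φ x) x (basisVec i)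
      ≤ (1 / 2) * ((weight x)⁻¹ ^ 2 * φ x ^ 2) + 2 * ‖gradient φ x‖ ^ 2 := by
    intro x
    have hd := hφ.differentiable (by simp) x
    have e : ∑ i, hardyField i x * fderiv ℝ (fun x => φ x * φ x) x (basisVec i)
        = 2 * φ x * ((1 + ‖x‖ ^ 2)⁻¹ * inner ℝ x (gradient φ x)) := by
      rw [inner_eq_sum, Finset.mul_sum, Finset.mul_sum]
      refine Finset.sum_congr rfl fun i _ => ?_
      rw [fderiv_fun_mul hd hd, gradient_apply, hardyField]
      simp only [add_apply, smul_apply, smul_eq_mul]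
      ring
    have h1 : |inner ℝ x (gradient φ x)| ≤ ‖x‖ * ‖gradient φ x‖ := abs_real_inner_le_norm _ _
    have hwp := weight_pos x
    have h2 : (1 + ‖x‖ ^ 2)⁻¹ * |inner ℝ x (gradient φ x)| ≤ (weight x)⁻¹ * ‖gradient φ x‖ := by
      rw [← hw2]
      have h4 : (weight x)⁻¹ * ‖x‖ ≤ 1 := by
        rw [inv_mul_le_iff₀ hwp, mul_one]; exact norm_le_weight x
      have h5 : 0 < (weight x)⁻¹ := inv_pos.2 hwp
      calc (weight x)⁻¹ ^ 2 * |inner ℝ x (gradient φ x)|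
          ≤ (weight x)⁻¹ ^ 2 * (‖x‖ * ‖gradient φ x‖) := by gcongr
        _ = ((weight x)⁻¹ * ‖x‖) * ((weight x)⁻¹ * ‖gradient φ x‖) := by ring
        _ ≤ 1 * ((weight x)⁻¹ * ‖gradient φ x‖) := by gcongr
        _ = _ := one_mul _
    have hinv : 0 < (1 + ‖x‖ ^ 2)⁻¹ := by positivity
    rw [e]
    calc -(2 * φ x * ((1 + ‖x‖ ^ 2)⁻¹ * inner ℝ x (gradient φ x)))
        ≤ |2 * φ x * ((1 + ‖x‖ ^ 2)⁻¹ * inner ℝ x (gradient φ x))| := neg_le_abs _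
      _ = 2 * |φ x| * ((1 + ‖x‖ ^ 2)⁻¹ * |inner ℝ x (gradient φ x)|) := by
          rw [abs_mul, abs_mul, abs_mul, abs_two, abs_of_pos hinv]
      _ ≤ 2 * |φ x| * ((weight x)⁻¹ * ‖gradient φ x‖) := by gcongr
      _ ≤ (1 / 2) * ((weight x)⁻¹ ^ 2 * |φ x| ^ 2) + 2 * ‖gradient φ x‖ ^ 2 := by
          nlinarith [sq_nonneg ((weight x)⁻¹ * |φ x| - 2 * ‖gradient φ x‖)]
      _ = _ := by rw [sq_abs]
  have j1 := integral_mono i1 (integrable_finsetSum _ fun i _ => i3 i) lower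
  have j2 : ∫ x, -∑ i, hardyField i x * fderiv ℝ (fun x => φ x * φ x) x (basisVec i)
      ≤ ∫ x, ((1 / 2) * ((weight x)⁻¹ ^ 2 * φ x ^ 2) + 2 * ‖gradient φ x‖ ^ 2) :=
    integral_mono (integrable_finsetSum _ fun i _ => i4 i).neg
    ((i1.const_mul (1 / 2)).add (i2.const_mul 2)) upper
  rw [integral_add (i1.const_mul (1 / 2)) (i2.const_mul 2), integral_const_mul,
    integral_const_mul, integral_neg] at j2
  linarith

/-- The pairs `(φ, ∇φ)` of test functions on the whole space. -/
def testPairs : Submodule ℝ (SobolevAmbient Set.univ) where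
  carrier := {p | ∃ φ : E3 → ℝ, ContDiff ℝ ∞ φ ∧ HasCompactSupport φ ∧
    p.fst =ᵐ[volume.restrict Set.univ] φ ∧ p.snd =ᵐ[volume.restrict Set.univ] gradient φ}
  zero_mem' := by
    refine ⟨fun _ => 0, contDiff_const, HasCompactSupport.zero, ?_, ?_⟩
    · exact (absolutelyContinuous_weightedVolume _).ae_le (Lp.coeFn_zero ℝ 2 _)
    · filter_upwards [Lp.coeFn_zero E3 2 (volume.restrict Set.univ)] with x hx
      rw [WithLp.zero_snd, hx]
      simp [gradient]
  add_mem' := by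
    rintro p q ⟨φ, hφ, sφ, p1, p2⟩ ⟨ψ, hψ, sψ, q1, q2⟩
    refine ⟨fun x => φ x + ψ x, hφ.add hψ, sφ.add sψ, ?_, ?_⟩
    · filter_upwards [(absolutelyContinuous_weightedVolume _).ae_le
        (Lp.coeFn_add p.fst q.fst), p1, q1] with x hx h1 h2
      rw [WithLp.add_fst, hx, Pi.add_apply, h1, h2]
    · filter_upwards [Lp.coeFn_add p.snd q.snd, p2, q2] with x hx h1 h2
      rw [WithLp.add_snd, hx, Pi.add_apply, h1, h2,
        gradient_add_fun (hφ.differentiable (by simp) x) (hψ.differentiable (by simp) x)]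
  smul_mem' := by
    rintro c p ⟨φ, hφ, sφ, p1, p2⟩
    refine ⟨fun x => c * φ x, contDiff_const.mul hφ, sφ.mul_left, ?_, ?_⟩
    · filter_upwards [(absolutelyContinuous_weightedVolume _).ae_le
        (Lp.coeFn_smul c p.fst), p1] with x hx h1
      rw [WithLp.smul_fst, hx, Pi.smul_apply, h1, smul_eq_mul]
    · filter_upwards [Lp.coeFn_smul c p.snd, p2] with x hx h1
      rw [WithLp.smul_snd, hx, Pi.smul_apply, h1, gradient, gradient,
        fderiv_const_mul (hφ.differentiable (by simp) x), map_smul]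

/-- The closure of the test functions in the Beppo Levi norm on the whole space. -/
def beppoLevi : Submodule ℝ (SobolevAmbient Set.univ) := testPairs.topologicalClosure

lemma testPairs_le_beppoLevi : testPairs ≤ beppoLevi := testPairs.le_topologicalClosure

lemma isClosed_beppoLevi : IsClosed (beppoLevi : Set (SobolevAmbient Set.univ)) :=
  testPairs.isClosed_topologicalClosure

instance completeSpace_beppoLevi : CompleteSpace beppoLevi :=
  isClosed_beppoLevi.completeSpace_coe

/-- The space is a closure, so a closed condition need only be checked on test functions. Hardy's
inequality and the pairing with Newtonian potentials are extended in this way. -/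
lemma beppoLevi_induction {P : SobolevAmbient Set.univ → Prop} (hP : IsClosed {p | P p})
    (h : ∀ p ∈ testPairs, P p) {p : SobolevAmbient Set.univ} (hp : p ∈ beppoLevi) : P p :=
  closure_minimal (s := (testPairs : Set (SobolevAmbient Set.univ))) h hP hp

lemma hardy_beppoLevi {p : SobolevAmbient Set.univ} (hp : p ∈ beppoLevi) :
    ‖p.fst‖ ^ 2 ≤ 4 * ‖p.snd‖ ^ 2 := by
  refine beppoLevi_induction (P := fun p => ‖p.fst‖ ^ 2 ≤ 4 * ‖p.snd‖ ^ 2) ?_ ?_ hp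
  · exact isClosed_le ((valueL _).continuous.norm.pow 2)
      (continuous_const.mul ((gradientL _).continuous.norm.pow 2))
  · rintro p ⟨φ, hφ, hs, h1, h2⟩
    rw [L2_norm_sq_eq_integral, L2_norm_sq_eq_integral, integral_weightedVolume]
    have := hardy_inequality hφ hs
    have e1 : ∫ x in Set.univ, (weight x)⁻¹ ^ 2 * ‖p.fst x‖ ^ 2
        = ∫ x, (weight x)⁻¹ ^ 2 * φ x ^ 2 := by
      rw [← setIntegral_univ (μ := volume)]
      exact integral_congr_ae (by filter_upwards [h1] with x hx; rw [hx, Real.norm_eq_abs, sq_abs])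
    have e2 : ∫ x in Set.univ, ‖p.snd x‖ ^ 2 = ∫ x, ‖gradient φ x‖ ^ 2 := by
      rw [← setIntegral_univ (μ := volume) (f := fun x => ‖gradient φ x‖ ^ 2)]
      exact integral_congr_ae (by filter_upwards [h2] with x hx; rw [hx])
    rw [e1, e2]
    exact this

lemma testPairs_le_weightedSobolev : testPairs ≤ weightedSobolev Set.univ := by
  rintro p ⟨φ, hφ, hs, h1, h2⟩
  refine IsWeakGradient.congr ?_ h1.symm h2.symm
  intro ψ hψ sψ _ v
  simp only [inner_gradient, setIntegral_univ]
  have := integral_mul_fderiv_of_hasCompactSupport (hψ.of_le (by simp)) (hφ.of_le (by simp)) hs v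
  linarith

lemma beppoLevi_le_weightedSobolev : beppoLevi ≤ weightedSobolev Set.univ :=
  testPairs.topologicalClosure_minimal testPairs_le_weightedSobolev
    (isClosed_weightedSobolev MeasurableSet.univ)

/-- The Dirichlet form on the Beppo Levi space. -/
def dirichletForm : beppoLevi →L[ℝ] beppoLevi →L[ℝ] ℝ :=
  (innerSL ℝ).bilinearComp (gradientL Set.univ ∘L beppoLevi.subtypeL)
    (gradientL Set.univ ∘L beppoLevi.subtypeL)

lemma dirichletForm_apply (u v : beppoLevi) :
    dirichletForm u v =
      inner ℝ (u : SobolevAmbient Set.univ).snd (v : SobolevAmbient Set.univ).snd := rfl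

lemma isCoercive_dirichletForm : IsCoercive dirichletForm := by
  -- Hardy's inequality gives ‖u‖² = ‖ω⁻¹u‖² + ‖∇u‖² ≤ (4 + 1)‖∇u‖².
  refine ⟨1 / 5, by norm_num, fun u => ?_⟩
  rw [dirichletForm_apply, real_inner_self_eq_norm_sq]
  have h1 := hardy_beppoLevi u.2
  have h2 := norm_sq_sobolevAmbient (u : SobolevAmbient Set.univ)
  rw [Submodule.coe_norm]
  nlinarith

/-- The solution operator of the Dirichlet form. -/
def dirichletSolve : beppoLevi →L[ℝ] beppoLevi :=
  (isCoercive_dirichletForm.continuousLinearEquivOfBilin.symm : beppoLevi →L[ℝ] beppoLevi)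

/-- This is the Lax–Milgram theorem: the functional ⟨f, ·⟩ of the full inner product is represented
through the Dirichlet form. -/
lemma inner_snd_dirichletSolve (f k : beppoLevi) :
    inner ℝ (dirichletSolve f : SobolevAmbient Set.univ).snd (k : SobolevAmbient Set.univ).snd
      = inner ℝ f k := by
  rw [← dirichletForm_apply,
    ← isCoercive_dirichletForm.continuousLinearEquivOfBilin_apply (dirichletSolve f) k]
  congr 1
  exact isCoercive_dirichletForm.continuousLinearEquivOfBilin.apply_symm_apply f

/-- Restriction of the ambient Hilbert sums. -/
def ambientRestrict (Ω : Set E3) : SobolevAmbient Set.univ →L[ℝ] SobolevAmbient Ω :=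
  ((WithLp.prodContinuousLinearEquiv 2 ℝ (Lp ℝ 2 (weightedVolume Ω))
    (Lp E3 2 (volume.restrict Ω))).symm : _ →L[ℝ] _) ∘L
  ((lpMono (weightedVolume_mono (Set.subset_univ Ω)) ∘L valueL Set.univ).prod
    (lpMono (Measure.restrict_mono (Set.subset_univ Ω) le_rfl) ∘L gradientL Set.univ))

lemma ambientRestrict_fst (Ω : Set E3) (p : SobolevAmbient Set.univ) :
    (ambientRestrict Ω p).fst =ᵐ[volume.restrict Ω] p.fst :=
  (absolutelyContinuous_weightedVolume Ω).ae_le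
    (coeFn_lpMono (weightedVolume_mono (Set.subset_univ Ω)) p.fst)

lemma ambientRestrict_snd (Ω : Set E3) (p : SobolevAmbient Set.univ) :
    (ambientRestrict Ω p).snd =ᵐ[volume.restrict Ω] p.snd :=
  coeFn_lpMono (Measure.restrict_mono (Set.subset_univ Ω) le_rfl) p.snd

lemma IsWeakGradient.mono {Ω : Set E3} {g : E3 → ℝ} {G : E3 → E3}
    (h : IsWeakGradient Set.univ g G) : IsWeakGradient Ω g G := by
  intro φ hφ hs ht v
  have h0 := h φ hφ hs (Set.subset_univ _) v
  rw [setIntegral_univ, setIntegral_univ] at h0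
  rw [setIntegral_eq_integral_of_forall_compl_eq_zero, h0,
    setIntegral_eq_integral_of_forall_compl_eq_zero]
  · intro x hx
    rw [image_eq_zero_of_notMem_tsupport fun h => hx (ht h), zero_mul]
  · intro x hx
    have : x ∉ tsupport (fderiv ℝ φ) := fun h => hx (ht (tsupport_fderiv_subset ℝ h))
    rw [image_eq_zero_of_notMem_tsupport this, zero_apply, zero_mul]

/-- Restriction of Beppo Levi functions to `Ω`. -/
def sobolevRestrict (Ω : Set E3) : beppoLevi →L[ℝ] weightedSobolev Ω :=
  (ambientRestrict Ω ∘L beppoLevi.subtypeL).codRestrict (weightedSobolev Ω) fun p =>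
    ((beppoLevi_le_weightedSobolev p.2 : IsWeakGradient _ _ _).mono).congr
      (ambientRestrict_fst Ω p).symm (ambientRestrict_snd Ω p).symm

lemma sobolevFun_sobolevRestrict (Ω : Set E3) (p : beppoLevi) :
    sobolevFun (sobolevRestrict Ω p) =ᵐ[volume.restrict Ω]
      (p : SobolevAmbient Set.univ).fst :=
  ambientRestrict_fst Ω p

end Hardy

/-! ### The Newtonian kernel and its smooth regularisation -/

section NewtonKernel

/-- The Newtonian kernel `-1 / (4π|z|)`. -/
def newton (z : E3) : ℝ := -1 / (4 * Real.pi * ‖z‖)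

/-- The gradient of the Newtonian kernel. -/
def newtonGrad (z : E3) : E3 := (4 * Real.pi * ‖z‖ ^ 3)⁻¹ • z

/-- The smooth regularisation `-(4π)⁻¹ (|z|² + ε²)^{-1/2}` of the Newtonian kernel. -/
def newtonReg (ε : ℝ) (z : E3) : ℝ := -(4 * Real.pi)⁻¹ * (‖z‖ ^ 2 + ε ^ 2) ^ (-(1 / 2) : ℝ)

/-- The components of the gradient of the regularised kernel. -/
def newtonRegGrad (ε : ℝ) (i : Fin 3) (z : E3) : ℝ :=
  (4 * Real.pi)⁻¹ * (‖z‖ ^ 2 + ε ^ 2) ^ (-(3 / 2) : ℝ) * z i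

lemma hasFDerivAt_norm_sq_add_rpow {ε : ℝ} (hε : ε ≠ 0) (p : ℝ) (z : E3) :
    HasFDerivAt (fun z : E3 => (‖z‖ ^ 2 + ε ^ 2) ^ p)
      ((p * (‖z‖ ^ 2 + ε ^ 2) ^ (p - 1)) • (2 • innerSL ℝ z)) z :=
  ((hasStrictFDerivAt_norm_sq z).hasFDerivAt.add_const (ε ^ 2)).rpow_const
    (Or.inl (by positivity))

lemma contDiff_norm_sq_add_rpow {ε : ℝ} (hε : ε ≠ 0) (p : ℝ) :
    ContDiff ℝ 1 (fun z : E3 => (‖z‖ ^ 2 + ε ^ 2) ^ p) :=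
  ((contDiff_norm_sq ℝ).add contDiff_const).rpow_const_of_ne fun z => by positivity

lemma contDiff_newtonReg {ε : ℝ} (hε : ε ≠ 0) : ContDiff ℝ 1 (newtonReg ε) :=
  contDiff_const.mul (contDiff_norm_sq_add_rpow hε _)

lemma contDiff_newtonRegGrad {ε : ℝ} (hε : ε ≠ 0) (i : Fin 3) :
    ContDiff ℝ 1 (newtonRegGrad ε i) :=
  (contDiff_const.mul (contDiff_norm_sq_add_rpow hε _)).mul
    (EuclideanSpace.proj (𝕜 := ℝ) i).contDiff

lemma fderiv_newtonReg {ε : ℝ} (hε : ε ≠ 0) (z v : E3) :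
    fderiv ℝ (newtonReg ε) z v =
      (4 * Real.pi)⁻¹ * (‖z‖ ^ 2 + ε ^ 2) ^ (-(3 / 2) : ℝ) * inner ℝ z v := by
  have h := ((hasFDerivAt_norm_sq_add_rpow hε (-(1 / 2)) z).const_mul (-(4 * Real.pi)⁻¹)).fderiv
  change fderiv ℝ (fun z : E3 => -(4 * Real.pi)⁻¹ * (‖z‖ ^ 2 + ε ^ 2) ^ (-(1 / 2) : ℝ)) z v = _
  rw [h]
  simp only [smul_apply, innerSL_apply_apply, smul_eq_mul, nsmul_eq_mul]
  rw [show (-(1 / 2) - 1 : ℝ) = -(3 / 2) by norm_num]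
  push_cast
  ring

lemma fderiv_newtonRegGrad {ε : ℝ} (hε : ε ≠ 0) (i : Fin 3) (z : E3) :
    fderiv ℝ (newtonRegGrad ε i) z (basisVec i) =
      (4 * Real.pi)⁻¹ * ((‖z‖ ^ 2 + ε ^ 2) ^ (-(3 / 2) : ℝ)
        - 3 * (‖z‖ ^ 2 + ε ^ 2) ^ (-(5 / 2) : ℝ) * (z i) ^ 2) := by
  have h := (((hasFDerivAt_norm_sq_add_rpow hε (-(3 / 2)) z).const_mul ((4 * Real.pi)⁻¹)).fun_mul
    (EuclideanSpace.proj (𝕜 := ℝ) i).hasFDerivAt).fderiv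
  change fderiv ℝ (fun z : E3 => (4 * Real.pi)⁻¹ * (‖z‖ ^ 2 + ε ^ 2) ^ (-(3 / 2) : ℝ) *
    (EuclideanSpace.proj (𝕜 := ℝ) i) z) z (basisVec i) = _
  rw [h]
  simp only [add_apply, smul_apply, innerSL_apply_apply, smul_eq_mul, nsmul_eq_mul,
    PiLp.proj_apply, inner_basisVec]
  rw [show (-(3 / 2) - 1 : ℝ) = -(5 / 2) by norm_num]
  simp
  ring

/-- The Laplacian of the regularised kernel. In dimension three the terms in |z|² cancel, leaving a
positive function concentrated at scale ε, which acts as an approximate delta function. -/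
lemma sum_fderiv_newtonRegGrad {ε : ℝ} (hε : ε ≠ 0) (z : E3) :
    ∑ i, fderiv ℝ (newtonRegGrad ε i) z (basisVec i) =
      (4 * Real.pi)⁻¹ * (3 * ε ^ 2 * (‖z‖ ^ 2 + ε ^ 2) ^ (-(5 / 2) : ℝ)) := by
  simp only [fderiv_newtonRegGrad hε]
  rw [← Finset.mul_sum, Finset.sum_sub_distrib _ _, ← Finset.mul_sum, ← norm_sq_eq_sum]
  have hq : 0 < ‖z‖ ^ 2 + ε ^ 2 := by positivity
  have h1 : (‖z‖ ^ 2 + ε ^ 2) ^ (-(3 / 2) : ℝ)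
      = (‖z‖ ^ 2 + ε ^ 2) ^ (-(5 / 2) : ℝ) * (‖z‖ ^ 2 + ε ^ 2) := by
    rw [← Real.rpow_add_one hq.ne']
    norm_num
  simp only [Finset.sum_const, Finset.card_univ, Fintype.card_fin, nsmul_eq_mul, h1]
  push_cast
  ring

lemma norm_newton (z : E3) : ‖newton z‖ = (4 * Real.pi)⁻¹ * ‖z‖⁻¹ := by
  have := Real.pi_pos
  rw [newton, norm_div, norm_neg, norm_one, Real.norm_of_nonneg (by positivity), one_div, mul_inv]

lemma norm_newtonGrad (z : E3) : ‖newtonGrad z‖ = (4 * Real.pi)⁻¹ * (‖z‖ ^ 2)⁻¹ := by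
  have := Real.pi_pos
  rw [newtonGrad, norm_smul, norm_inv, Real.norm_of_nonneg (by positivity)]
  rcases eq_or_ne ‖z‖ 0 with h | h
  · simp [h]
  · field_simp

lemma measurable_newton : Measurable newton := by unfold newton; fun_prop

lemma measurable_newtonGrad : Measurable newtonGrad := by unfold newtonGrad; fun_prop

lemma locallyIntegrable_newton : LocallyIntegrable newton := by
  refine locallyIntegrable_of_norm_le_rpow (by simp) (C := (4 * Real.pi)⁻¹) (α := 1) (by simp)
    (Eventually.of_forall fun z => ?_) measurable_newton.aestronglyMeasurable
  rw [norm_newton, Real.rpow_neg_one]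

lemma locallyIntegrable_newtonGrad : LocallyIntegrable newtonGrad := by
  refine locallyIntegrable_of_norm_le_rpow (by simp) (C := (4 * Real.pi)⁻¹) (α := 2)
    (by simp; norm_num)
    (Eventually.of_forall fun z => ?_) measurable_newtonGrad.aestronglyMeasurable
  rw [norm_newtonGrad, Real.rpow_neg (norm_nonneg _)]
  norm_cast

/-- A sequence of regularisation parameters. -/
def regSeq (n : ℕ) : ℝ := 1 / ((n : ℝ) + 1)

lemma regSeq_pos (n : ℕ) : 0 < regSeq n := by unfold regSeq; positivity

lemma tendsto_regSeq : Tendsto regSeq atTop (𝓝 0) := tendsto_one_div_add_atTop_nhds_zero_nat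

lemma tendsto_norm_sq_add_rpow {z : E3} (hz : z ≠ 0) (p : ℝ) :
    Tendsto (fun n => (‖z‖ ^ 2 + regSeq n ^ 2) ^ p) atTop (𝓝 ((‖z‖ ^ 2) ^ p)) := by
  have h1 : Tendsto (fun n => ‖z‖ ^ 2 + regSeq n ^ 2) atTop (𝓝 (‖z‖ ^ 2)) := by
    simpa using (tendsto_regSeq.pow 2).const_add (‖z‖ ^ 2)
  exact h1.rpow_const (Or.inl (by positivity))

lemma norm_sq_rpow {z : E3} (n : ℕ) : (‖z‖ ^ 2) ^ (-(n / 2) : ℝ) = (‖z‖ ^ n)⁻¹ := by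
  rw [← Real.rpow_natCast ‖z‖ 2, ← Real.rpow_mul (norm_nonneg _), ← Real.rpow_natCast ‖z‖ n,
    ← Real.rpow_neg (norm_nonneg _)]
  congr 1
  push_cast
  ring

lemma norm_sq_add_rpow_le {z : E3} (hz : z ≠ 0) (ε : ℝ) (n : ℕ) :
    (‖z‖ ^ 2 + ε ^ 2) ^ (-(n / 2) : ℝ) ≤ (‖z‖ ^ n)⁻¹ := by
  rw [← norm_sq_rpow]
  exact Real.rpow_le_rpow_of_nonpos (by positivity) (by nlinarith [sq_nonneg ε])
    (by have := Nat.cast_nonneg (α := ℝ) n; linarith)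

lemma ae_ne_zero : ∀ᵐ z : E3, z ≠ 0 := by
  simp [ae_iff, measure_singleton]

lemma newtonReg_tendsto {z : E3} (hz : z ≠ 0) :
    Tendsto (fun n => newtonReg (regSeq n) z) atTop (𝓝 (newton z)) := by
  have h := (tendsto_norm_sq_add_rpow hz (-(1 / 2))).const_mul (-(4 * Real.pi)⁻¹)
  have e := norm_sq_rpow (z := z) 1
  rw [Nat.cast_one, pow_one] at e
  rw [e] at h
  have e2 : newton z = -(4 * Real.pi)⁻¹ * ‖z‖⁻¹ := by
    rw [newton, neg_div, one_div, mul_inv _ ‖z‖, neg_mul]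
  rw [e2]
  exact h

lemma norm_newtonReg_le {z : E3} (hz : z ≠ 0) (ε : ℝ) : ‖newtonReg ε z‖ ≤ ‖newton z‖ := by
  have hpi := Real.pi_pos
  have e := norm_sq_add_rpow_le hz ε 1
  rw [Nat.cast_one, pow_one] at e
  rw [norm_newton, newtonReg, norm_mul, norm_neg, Real.norm_of_nonneg (by positivity),
    Real.norm_of_nonneg (by positivity)]
  gcongr

lemma newtonRegGrad_tendsto {z : E3} (hz : z ≠ 0) :
    Tendsto (fun n => (4 * Real.pi)⁻¹ * (‖z‖ ^ 2 + regSeq n ^ 2) ^ (-(3 / 2) : ℝ)) atTop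
      (𝓝 ((4 * Real.pi * ‖z‖ ^ 3)⁻¹)) := by
  have h := (tendsto_norm_sq_add_rpow hz (-(3 / 2))).const_mul ((4 * Real.pi)⁻¹)
  have e := norm_sq_rpow (z := z) 3
  rw [show ((3 : ℕ) : ℝ) = 3 by norm_num] at e
  rw [e] at h
  rwa [mul_inv _ (‖z‖ ^ 3)]

/-- The regularised gradients are dominated, uniformly in ε, by the locally integrable limit
gradient; this is the majorant for every passage ε → 0. -/
lemma newtonRegGrad_factor_le {z : E3} (hz : z ≠ 0) (ε : ℝ) :
    (4 * Real.pi)⁻¹ * (‖z‖ ^ 2 + ε ^ 2) ^ (-(3 / 2) : ℝ) * ‖z‖ ≤ ‖newtonGrad z‖ := by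
  have hpi := Real.pi_pos
  have e := norm_sq_add_rpow_le hz ε 3
  rw [show ((3 : ℕ) : ℝ) = 3 by norm_num] at e
  have h : 0 < ‖z‖ := norm_pos_iff.2 hz
  calc (4 * Real.pi)⁻¹ * (‖z‖ ^ 2 + ε ^ 2) ^ (-(3 / 2) : ℝ) * ‖z‖
      ≤ (4 * Real.pi)⁻¹ * (‖z‖ ^ 3)⁻¹ * ‖z‖ := by gcongr
    _ = _ := by rw [norm_newtonGrad]; field_simp

/-- Integration by parts against the Newtonian kernel. -/
lemma integral_newton_mul_fderiv {φ : E3 → ℝ} (hφ : ContDiff ℝ 1 φ) (hs : HasCompactSupport φ)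
    (v : E3) :
    ∫ z, newton z * fderiv ℝ φ z v = - ∫ z, inner ℝ (newtonGrad z) v * φ z := by
  have cφ := (hφ.continuous_fderiv (by norm_num)).clm_apply (continuous_const (y := v))
  have i1 : Integrable (fun z => newton z * fderiv ℝ φ z v) :=
    locallyIntegrable_newton.integrable_smul_right_of_hasCompactSupport cφ (hs.fderiv_apply ℝ v)
  have i2 : Integrable (fun z => ‖φ z‖ * ‖v‖ * ‖newtonGrad z‖) :=
    LocallyIntegrable.integrable_smul_left_of_hasCompactSupport
      (fun x => (locallyIntegrable_newtonGrad x).norm) (hφ.continuous.norm.mul continuous_const) hs.norm.mul_right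
  have l1 : Tendsto (fun n => ∫ z, newtonReg (regSeq n) z * fderiv ℝ φ z v) atTop
      (𝓝 (∫ z, newton z * fderiv ℝ φ z v)) := by
    refine tendsto_integral_of_dominated_convergence (fun z => ‖newton z * fderiv ℝ φ z v‖)
      (fun n => ((contDiff_newtonReg (regSeq_pos n).ne').continuous.mul
        cφ).aestronglyMeasurable) i1.norm (fun n => ?_) ?_
    · filter_upwards [ae_ne_zero] with z hz
      rw [norm_mul, norm_mul]
      gcongr
      exact norm_newtonReg_le hz _
    · filter_upwards [ae_ne_zero] with z hz
      exact (newtonReg_tendsto hz).mul_const _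
  have l2 : Tendsto (fun n => -∫ z, fderiv ℝ (newtonReg (regSeq n)) z v * φ z) atTop
      (𝓝 (-∫ z, inner ℝ (newtonGrad z) v * φ z)) := by
    refine (tendsto_integral_of_dominated_convergence _ (fun n => ?_) i2 (fun n => ?_) ?_).neg
    · exact ((((contDiff_newtonReg (regSeq_pos n).ne').continuous_fderiv (by norm_num)).clm_apply
        continuous_const).mul hφ.continuous).aestronglyMeasurable
    · filter_upwards [ae_ne_zero] with z hz
      have h1 := newtonRegGrad_factor_le hz (regSeq n)
      have h2 : 0 ≤ (4 * Real.pi)⁻¹ * (‖z‖ ^ 2 + regSeq n ^ 2) ^ (-(3 / 2) : ℝ) := by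
        have := Real.pi_pos
        positivity
      rw [norm_mul, fderiv_newtonReg (regSeq_pos n).ne', norm_mul, Real.norm_of_nonneg h2]
      calc _ ≤ (4 * Real.pi)⁻¹ * (‖z‖ ^ 2 + regSeq n ^ 2) ^ (-(3 / 2) : ℝ) * (‖z‖ * ‖v‖) * ‖φ z‖ := by
            gcongr
            exact norm_inner_le_norm z v
        _ = ‖φ z‖ * ‖v‖ * ((4 * Real.pi)⁻¹ * (‖z‖ ^ 2 + regSeq n ^ 2) ^ (-(3 / 2) : ℝ) * ‖z‖) := by
            ring
        _ ≤ _ := by gcongr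
    · filter_upwards [ae_ne_zero] with z hz
      simp only [fderiv_newtonReg (regSeq_pos _).ne']
      rw [newtonGrad, real_inner_smul_left]
      exact ((newtonRegGrad_tendsto hz).mul_const _).mul_const _
  -- The identity holds for each regularised kernel by ordinary integration by parts; both sides
  -- have just been shown to converge.
  refine tendsto_nhds_unique l1 (l2.congr fun n => ?_)
  rw [integral_mul_fderiv_of_hasCompactSupport (contDiff_newtonReg (regSeq_pos n).ne') hφ hs]

/-- In polar coordinates the mass of `deltaProfile` is an integral of 3y²(y²+1)^{-5/2}, whose
primitive is this function, vanishing at 0. With the limit 1 at infinity the total mass is (4π)⁻¹ ·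
3 · (4π/3) = 1. -/
lemma tendsto_radial : Tendsto (fun y : ℝ => y ^ 3 * (y ^ 2 + 1) ^ (-(3 / 2) : ℝ)) atTop (𝓝 1) := by
  have h1 : Tendsto (fun y : ℝ => (1 + (y ^ 2)⁻¹) ^ (-(3 / 2) : ℝ)) atTop (𝓝 1) := by
    have h0 : Tendsto (fun y : ℝ => 1 + (y ^ 2)⁻¹) atTop (𝓝 1) := by
      simpa using (tendsto_inv_atTop_zero.comp (tendsto_pow_atTop (α := ℝ) two_ne_zero)).const_add 1
    simpa using h0.rpow_const (p := -(3 / 2)) (Or.inl one_ne_zero)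
  refine h1.congr' ?_
  filter_upwards [eventually_gt_atTop 0] with y hy
  have e : y ^ 2 + 1 = y ^ 2 * (1 + (y ^ 2)⁻¹) := by field_simp
  rw [e, Real.mul_rpow (by positivity) (by positivity), ← Real.rpow_natCast y 2,
    ← Real.rpow_mul hy.le, ← Real.rpow_natCast y 3, ← mul_assoc, ← Real.rpow_add hy]
  norm_num

lemma hasDerivAt_radial (y : ℝ) : HasDerivAt (fun y : ℝ => y ^ 3 * (y ^ 2 + 1) ^ (-(3 / 2) : ℝ))
    (y ^ 2 * (3 * (y ^ 2 + 1) ^ (-(5 / 2) : ℝ))) y := by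
  have hq : 0 < y ^ 2 + 1 := by positivity
  have h1 : HasDerivAt (fun y : ℝ => y ^ 2 + 1) (2 * y) y := by
    simpa using (hasDerivAt_pow 2 y).add_const 1
  have h2 := (hasDerivAt_pow 3 y).fun_mul (h1.rpow_const (p := -(3 / 2)) (Or.inl hq.ne'))
  refine h2.congr_deriv ?_
  have e : (y ^ 2 + 1) ^ (-(3 / 2) : ℝ) = (y ^ 2 + 1) ^ (-(5 / 2) : ℝ) * (y ^ 2 + 1) := by
    rw [← Real.rpow_add_one hq.ne']
    norm_num
  rw [e, show (-(3 / 2) - 1 : ℝ) = -(5 / 2) by norm_num]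
  push_cast
  ring

/-- The mass of the regularised delta function. -/
def deltaProfile (z : E3) : ℝ := (4 * Real.pi)⁻¹ * (3 * (‖z‖ ^ 2 + 1) ^ (-(5 / 2) : ℝ))

lemma deltaProfile_nonneg (z : E3) : 0 ≤ deltaProfile z := by
  have := Real.pi_pos
  unfold deltaProfile
  positivity

lemma integrable_deltaProfile : Integrable deltaProfile := by
  refine Integrable.const_mul ?_ _
  rw [integrable_fun_norm_addHaar volume (f := fun y => 3 * (y ^ 2 + 1) ^ (-(5 / 2) : ℝ))]
  have := integrableOn_Ioi_deriv_of_nonneg' (a := (0 : ℝ)) (fun y _ => hasDerivAt_radial y)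
    (fun y _ => by positivity) tendsto_radial
  simpa using this

lemma integral_deltaProfile : ∫ z, deltaProfile z = 1 := by
  have hpi := Real.pi_pos
  unfold deltaProfile
  rw [integral_const_mul,
    integral_fun_norm_addHaar volume (fun y => 3 * (y ^ 2 + 1) ^ (-(5 / 2) : ℝ))]
  have := integral_Ioi_of_hasDerivAt_of_nonneg' (a := (0 : ℝ)) (fun y _ => hasDerivAt_radial y)
    (fun y _ => by positivity) tendsto_radial
  have hvol : volume.real (Metric.ball (0 : E3) 1) = Real.pi * 4 / 3 := by
    rw [Measure.real, EuclideanSpace.volume_ball_fin_three]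
    simp
    positivity
  simp only [finrank_euclideanSpace, Fintype.card_fin, smul_eq_mul, nsmul_eq_mul, hvol]
  norm_num at this ⊢
  rw [this]
  field_simp

end NewtonKernel

/-! ### Newtonian potentials of test functions: Poisson equation and decay -/

section NewtonPotential

lemma deltaProfile_scaled {ε : ℝ} (hε : 0 < ε) (w : E3) :
    (4 * Real.pi)⁻¹ * (3 * ε ^ 2 * (‖ε • w‖ ^ 2 + ε ^ 2) ^ (-(5 / 2) : ℝ))
      = (ε ^ 3)⁻¹ * deltaProfile w := by
  have e : ‖ε • w‖ ^ 2 + ε ^ 2 = ε ^ 2 * (‖w‖ ^ 2 + 1) := by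
    rw [norm_smul, mul_pow, Real.norm_of_nonneg hε.le]; ring
  have e2 : (ε ^ 2) ^ (-(5 / 2) : ℝ) = (ε ^ 5)⁻¹ := by
    rw [← Real.rpow_natCast ε 2, ← Real.rpow_mul hε.le, ← Real.rpow_natCast ε 5,
      ← Real.rpow_neg hε.le]
    norm_num
  rw [e, Real.mul_rpow (by positivity) (by positivity), e2, deltaProfile]
  field_simp

/-- The Newtonian kernel is a fundamental solution of the Laplace operator. -/
lemma integral_inner_newtonGrad_gradient {φ : E3 → ℝ} (hφ : ContDiff ℝ ∞ φ)
    (hs : HasCompactSupport φ) :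
    ∫ z, inner ℝ (newtonGrad z) (gradient φ z) = - φ 0 := by
  have hφ1 : ContDiff ℝ 1 φ := hφ.of_le (by simp)
  have i2 : Integrable (fun z => ‖gradient φ z‖ * ‖newtonGrad z‖) :=
    LocallyIntegrable.integrable_smul_left_of_hasCompactSupport
      (fun x => (locallyIntegrable_newtonGrad x).norm) (continuous_gradient hφ).norm (by
        simp only [norm_gradient]
        exact (hs.fderiv (𝕜 := ℝ)).norm)
  have l1 : Tendsto (fun n => ∫ z, ∑ i, newtonRegGrad (regSeq n) i z *
      fderiv ℝ φ z (basisVec i)) atTop (𝓝 (∫ z, inner ℝ (newtonGrad z) (gradient φ z))) := by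
    have e : ∀ n z, ∑ i, newtonRegGrad (regSeq n) i z * fderiv ℝ φ z (basisVec i)
        = ((4 * Real.pi)⁻¹ * (‖z‖ ^ 2 + regSeq n ^ 2) ^ (-(3 / 2) : ℝ)) *
          inner ℝ z (gradient φ z) := by
      intro n z
      rw [inner_eq_sum, Finset.mul_sum]
      refine Finset.sum_congr rfl fun i _ => ?_
      rw [gradient_apply, newtonRegGrad]
      ring
    refine tendsto_integral_of_dominated_convergence _ (fun n => ?_) i2 (fun n => ?_) ?_
    · refine (continuous_finsetSum _ fun i _ => ?_).aestronglyMeasurable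
      exact (contDiff_newtonRegGrad (regSeq_pos n).ne' i).continuous.mul
        (continuous_fderiv_apply_of_contDiff hφ _)
    · filter_upwards [ae_ne_zero] with z hz
      have h1 := newtonRegGrad_factor_le hz (regSeq n)
      have h2 : 0 ≤ (4 * Real.pi)⁻¹ * (‖z‖ ^ 2 + regSeq n ^ 2) ^ (-(3 / 2) : ℝ) := by
        have := Real.pi_pos
        positivity
      rw [e, norm_mul, Real.norm_of_nonneg h2]
      calc _ ≤ (4 * Real.pi)⁻¹ * (‖z‖ ^ 2 + regSeq n ^ 2) ^ (-(3 / 2) : ℝ) *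
            (‖z‖ * ‖gradient φ z‖) := by
            gcongr
            exact norm_inner_le_norm z _
        _ = ‖gradient φ z‖ *
            ((4 * Real.pi)⁻¹ * (‖z‖ ^ 2 + regSeq n ^ 2) ^ (-(3 / 2) : ℝ) * ‖z‖) := by ring
        _ ≤ _ := by gcongr
    · filter_upwards [ae_ne_zero] with z hz
      simp only [e]
      rw [newtonGrad, real_inner_smul_left]
      exact (newtonRegGrad_tendsto hz).mul_const _
  obtain ⟨M, hM⟩ := hs.exists_bound_of_continuous hφ.continuous
  -- After rescaling, the approximate delta function is a fixed profile of mass 1 and φ is evaluated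
  -- at εw, so the limit is φ(0).
  have l2 : Tendsto (fun n => -∫ w, deltaProfile w * φ (regSeq n • w)) atTop (𝓝 (-φ 0)) := by
    have : Tendsto (fun n => ∫ w, deltaProfile w * φ (regSeq n • w)) atTop
        (𝓝 (∫ w, deltaProfile w * φ 0)) := by
      refine tendsto_integral_of_dominated_convergence (fun w => deltaProfile w * M)
        (fun n => ?_) (integrable_deltaProfile.mul_const M) (fun n => ?_) ?_
      · exact integrable_deltaProfile.1.mul
          (hφ.continuous.comp (continuous_const_smul _)).aestronglyMeasurable
      · refine Eventually.of_forall fun w => ?_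
        rw [norm_mul, Real.norm_of_nonneg (deltaProfile_nonneg w)]
        exact mul_le_mul_of_nonneg_left (hM _) (deltaProfile_nonneg w)
      · refine Eventually.of_forall fun w => Tendsto.const_mul _ ?_
        have h0 : Tendsto (fun n => regSeq n • w) atTop (𝓝 0) := by
          simpa using tendsto_regSeq.smul_const w
        exact (hφ.continuous.tendsto 0).comp h0
    rw [integral_mul_const, integral_deltaProfile, one_mul] at this
    exact this.neg
  refine tendsto_nhds_unique l1 (l2.congr fun n => ?_)
  have hε := regSeq_pos n
  have cX := fun i => contDiff_newtonRegGrad hε.ne' i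
  have i3 : ∀ i, Integrable (fun z => newtonRegGrad (regSeq n) i z * fderiv ℝ φ z (basisVec i)) :=
    fun i => ((cX i).continuous.mul (continuous_fderiv_apply_of_contDiff hφ _)
      ).integrable_of_hasCompactSupport (hs.fderiv_apply ℝ _).mul_left
  have i4 : ∀ i, Integrable
      (fun z => fderiv ℝ (newtonRegGrad (regSeq n) i) z (basisVec i) * φ z) :=
    fun i => ((((cX i).continuous_fderiv (by norm_num)).clm_apply continuous_const).mul
      hφ.continuous).integrable_of_hasCompactSupport hs.mul_left
  rw [integral_finsetSum _ fun i _ => i3 i]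
  have e : ∀ i, ∫ z, newtonRegGrad (regSeq n) i z * fderiv ℝ φ z (basisVec i)
      = -∫ z, fderiv ℝ (newtonRegGrad (regSeq n) i) z (basisVec i) * φ z := fun i =>
    integral_mul_fderiv_of_hasCompactSupport (cX i) hφ1 hs _
  simp only [e]
  rw [Finset.sum_neg_distrib, ← integral_finsetSum _ fun i _ => i4 i]
  congr 1
  simp only [← Finset.sum_mul, sum_fderiv_newtonRegGrad hε.ne']
  -- Substitution z = εw: the Jacobian factor ε⁻³ is matched by the factor ε⁻³ in
  -- `deltaProfile_scaled`, and both cancel.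
  have hc := Measure.integral_comp_smul (μ := (volume : Measure E3)) (fun z =>
    (4 * Real.pi)⁻¹ * (3 * regSeq n ^ 2 * (‖z‖ ^ 2 + regSeq n ^ 2) ^ (-(5 / 2) : ℝ)) * φ z)
    (regSeq n)
  simp only [deltaProfile_scaled hε] at hc
  simp only [mul_assoc (regSeq n ^ 3)⁻¹] at hc
  rw [integral_const_mul, finrank_euclideanSpace, Fintype.card_fin,
    abs_of_pos (by positivity), smul_eq_mul] at hc
  have h3 : (regSeq n ^ 3)⁻¹ ≠ 0 := by positivity
  exact mul_left_cancel₀ h3 hc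

open scoped Convolution in
/-- The Newtonian potential of a density. -/
def potential (ψ : E3 → ℝ) : E3 → ℝ := newton ⋆[ContinuousLinearMap.lsmul ℝ ℝ, volume] ψ

lemma potential_eq (ψ : E3 → ℝ) (x : E3) : potential ψ x = ∫ t, newton t * ψ (x - t) := rfl

lemma potential_eq' (ψ : E3 → ℝ) (x : E3) : potential ψ x = ∫ y, newton (x - y) * ψ y := by
  rw [potential_eq, ← integral_sub_left_eq_self _ volume x]
  simp

lemma contDiff_potential {ψ : E3 → ℝ} (hψ : ContDiff ℝ ∞ ψ) (hs : HasCompactSupport ψ) :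
    ContDiff ℝ ∞ (potential ψ) :=
  hs.contDiff_convolution_right _ locallyIntegrable_newton hψ

lemma fderiv_potential {ψ : E3 → ℝ} (hψ : ContDiff ℝ ∞ ψ) (hs : HasCompactSupport ψ) (x v : E3) :
    fderiv ℝ (potential ψ) x v = potential (fun y => fderiv ℝ ψ y v) x := by
  have h := (hs.hasFDerivAt_convolution_right (ContinuousLinearMap.lsmul ℝ ℝ)
    locallyIntegrable_newton (hψ.of_le (by simp)) x).fderiv
  rw [potential, h, convolution_precompR_apply _ locallyIntegrable_newton
    (hs.fderiv (𝕜 := ℝ)) (hψ.continuous_fderiv (by simp))]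
  rfl

lemma locallyIntegrable_inner_newtonGrad (v : E3) :
    LocallyIntegrable (fun z => inner ℝ (newtonGrad z) v) := by
  intro z
  obtain ⟨s, hs, hi⟩ := locallyIntegrable_newtonGrad z
  exact ⟨s, hs, hi.inner_const v⟩

lemma contDiff_comp_sub {ψ : E3 → ℝ} (hψ : ContDiff ℝ ∞ ψ) (x : E3) :
    ContDiff ℝ ∞ (fun t => ψ (x - t)) := hψ.comp (contDiff_const.sub contDiff_id)

lemma hasCompactSupport_comp_sub {ψ : E3 → ℝ} (hs : HasCompactSupport ψ) (x : E3) :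
    HasCompactSupport (fun t => ψ (x - t)) :=
  hs.comp_homeomorph (Homeomorph.subLeft x)

lemma fderiv_comp_sub {ψ : E3 → ℝ} (hψ : ContDiff ℝ ∞ ψ) (x t : E3) :
    fderiv ℝ (fun t => ψ (x - t)) t = - fderiv ℝ ψ (x - t) := by
  have h1 : HasFDerivAt (fun t : E3 => x - t) (-ContinuousLinearMap.id ℝ E3) t :=
    (hasFDerivAt_id t).const_sub x
  have h2 := ((hψ.differentiable (by simp) (x - t)).hasFDerivAt.comp t h1).fderiv
  change fderiv ℝ (ψ ∘ fun t => x - t) t = _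
  rw [h2]
  ext v
  simp

/-- The derivative is moved from the density back onto the kernel. This form exhibits the decay
|x|⁻² of the gradient and reappears when the remainder kernel is paired with a test function. -/
lemma fderiv_potential_eq {ψ : E3 → ℝ} (hψ : ContDiff ℝ ∞ ψ) (hs : HasCompactSupport ψ)
    (x v : E3) :
    fderiv ℝ (potential ψ) x v = ∫ t, inner ℝ (newtonGrad t) v * ψ (x - t) := by
  have h := integral_newton_mul_fderiv ((contDiff_comp_sub hψ x).of_le (by simp))
    (hasCompactSupport_comp_sub hs x) v
  simp only [fderiv_comp_sub hψ, neg_apply, mul_neg, integral_neg, neg_inj] at h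
  rw [fderiv_potential hψ hs, potential_eq, h]

lemma fderiv_potential_eq' {ψ : E3 → ℝ} (hψ : ContDiff ℝ ∞ ψ) (hs : HasCompactSupport ψ)
    (x v : E3) :
    fderiv ℝ (potential ψ) x v = ∫ y, inner ℝ (newtonGrad (x - y)) v * ψ y := by
  rw [fderiv_potential_eq hψ hs, ← integral_sub_left_eq_self _ volume x]
  simp

lemma contDiff_fderiv_apply {ψ : E3 → ℝ} (hψ : ContDiff ℝ ∞ ψ) (v : E3) :
    ContDiff ℝ ∞ (fun x => fderiv ℝ ψ x v) :=
  (hψ.fderiv_right (m := ∞) (by simp)).clm_apply contDiff_const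

/-- The Newtonian potential solves the Poisson equation. -/
lemma laplacian_potential {ψ : E3 → ℝ} (hψ : ContDiff ℝ ∞ ψ) (hs : HasCompactSupport ψ) (x : E3) :
    ∑ i, fderiv ℝ (fun y => fderiv ℝ (potential ψ) y (basisVec i)) x (basisVec i) = ψ x := by
  have e : ∀ i, fderiv ℝ (fun y => fderiv ℝ (potential ψ) y (basisVec i)) x (basisVec i)
      = ∫ t, inner ℝ (newtonGrad t) (basisVec i) * fderiv ℝ ψ (x - t) (basisVec i) := by
    intro i
    -- One derivative stays on ψ and only one falls on the kernel, since second derivatives of the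
    -- kernel are not locally integrable.
    have : (fun y => fderiv ℝ (potential ψ) y (basisVec i))
        = potential (fun y => fderiv ℝ ψ y (basisVec i)) :=
      funext fun y => fderiv_potential hψ hs y _
    rw [this, fderiv_potential_eq (contDiff_fderiv_apply hψ _) (hs.fderiv_apply ℝ _)]
  have hi : ∀ i, Integrable
      (fun t => inner ℝ (newtonGrad t) (basisVec i) * fderiv ℝ ψ (x - t) (basisVec i)) := by
    intro i
    refine LocallyIntegrable.integrable_smul_right_of_hasCompactSupport
      (locallyIntegrable_inner_newtonGrad _) ?_ ?_
    · exact (continuous_fderiv_apply_of_contDiff hψ _).comp (continuous_const.sub continuous_id)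
    · exact (hs.fderiv_apply ℝ (basisVec i)).comp_homeomorph (Homeomorph.subLeft x)
  have key := integral_inner_newtonGrad_gradient (contDiff_comp_sub hψ x)
    (hasCompactSupport_comp_sub hs x)
  rw [Finset.sum_congr rfl fun i _ => e i, ← integral_finsetSum _ fun i _ => hi i]
  rw [sub_zero] at key
  rw [← neg_inj, ← key, ← integral_neg]
  refine integral_congr_ae (Eventually.of_forall fun t => ?_)
  simp only
  rw [inner_eq_sum, ← Finset.sum_neg_distrib]
  refine Finset.sum_congr rfl fun i _ => ?_
  rw [gradient_apply, fderiv_comp_sub hψ, inner_basisVec, neg_apply, mul_neg]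

/-- Test functions see the potential as the solution of the Poisson equation. -/
lemma integral_inner_gradient_potential {ψ φ : E3 → ℝ} (hψ : ContDiff ℝ ∞ ψ)
    (hs : HasCompactSupport ψ) (hφ : ContDiff ℝ ∞ φ) (hφs : HasCompactSupport φ) :
    ∫ x, inner ℝ (gradient φ x) (gradient (potential ψ) x) = - ∫ x, ψ x * φ x := by
  have hΦ := contDiff_potential hψ hs
  have c1 : ∀ i : Fin 3, ContDiff ℝ ∞ (fun y => fderiv ℝ (potential ψ) y (basisVec i)) :=
    fun i => contDiff_fderiv_apply hΦ _
  have i1 : ∀ i, Integrable (fun x => fderiv ℝ (potential ψ) x (basisVec i) *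
      fderiv ℝ φ x (basisVec i)) := fun i =>
    ((c1 i).continuous.mul (continuous_fderiv_apply_of_contDiff hφ
      _)).integrable_of_hasCompactSupport (hφs.fderiv_apply ℝ _).mul_left
  have i2 : ∀ i, Integrable (fun x =>
      fderiv ℝ (fun y => fderiv ℝ (potential ψ) y (basisVec i)) x (basisVec i) * φ x) := fun i =>
    ((continuous_fderiv_apply_of_contDiff (c1 i) _).mul hφ.continuous
      ).integrable_of_hasCompactSupport hφs.mul_left
  calc ∫ x, inner ℝ (gradient φ x) (gradient (potential ψ) x)
      = ∫ x, ∑ i, fderiv ℝ (potential ψ) x (basisVec i) * fderiv ℝ φ x (basisVec i) := by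
        refine integral_congr_ae (Eventually.of_forall fun x => ?_)
        simp only [inner_eq_sum, gradient_apply]
        exact Finset.sum_congr rfl fun i _ => mul_comm _ _
    _ = ∑ i, -∫ x, fderiv ℝ (fun y => fderiv ℝ (potential ψ) y (basisVec i)) x (basisVec i)
          * φ x := by
        rw [integral_finsetSum _ fun i _ => i1 i]
        exact Finset.sum_congr rfl fun i _ => integral_mul_fderiv_of_hasCompactSupport
          ((c1 i).of_le (by simp)) (hφ.of_le (by simp)) hφs _
    _ = -∫ x, ψ x * φ x := by
        rw [Finset.sum_neg_distrib, ← integral_finsetSum _ fun i _ => i2 i]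
        simp only [← Finset.sum_mul, laplacian_potential hψ hs]

/-- On the ball continuity and compactness suffice; outside, ω ≤ 2|x| because |x| ≥ r ≥ 1, so decay
in |x| is decay in ω. -/
lemma exists_weight_bound {f : E3 → ℝ} (hf : Continuous f) {r A : ℝ} (hr : 1 ≤ r) (hA : 0 ≤ A)
    (p : ℕ) (h : ∀ x, r ≤ ‖x‖ → ‖f x‖ ≤ A * (‖x‖ ^ p)⁻¹) :
    ∃ C : ℝ, 0 ≤ C ∧ ∀ x, ‖f x‖ ≤ C * (weight x)⁻¹ ^ p := by
  obtain ⟨B, hB⟩ := (isCompact_closedBall (0 : E3) r).exists_bound_of_continuousOn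
    (f := fun x => f x * weight x ^ p) (hf.mul (continuous_weight.pow p)).continuousOn
  have hB0 : 0 ≤ B := (norm_nonneg _).trans (hB 0 (by simp; linarith))
  refine ⟨B + A * 2 ^ p, by positivity, fun x => ?_⟩
  have hw := weight_pos x
  rw [inv_pow, ← div_eq_mul_inv, le_div_iff₀ (by positivity)]
  rcases le_total ‖x‖ r with hx | hx
  · have := hB x (mem_closedBall_zero_iff.2 hx)
    rw [norm_mul, Real.norm_of_nonneg (r := weight x ^ p) (by positivity)] at this
    have h2 : 0 ≤ A * 2 ^ p := by positivity
    linarith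
  · have hx0 : 0 < ‖x‖ := by linarith
    have h2 : weight x ≤ 2 * ‖x‖ := (weight_le x).trans (by linarith)
    calc ‖f x‖ * weight x ^ p ≤ (A * (‖x‖ ^ p)⁻¹) * (2 * ‖x‖) ^ p := by
          gcongr
          exact h x hx
      _ = A * 2 ^ p := by rw [mul_pow]; field_simp
      _ ≤ B + A * 2 ^ p := by linarith

/-- When |x| ≥ 2r every y in the support satisfies |x - y| ≥ |x|/2, at the price of a factor 2^p. -/
lemma norm_integral_kernel_le {ψ : E3 → ℝ} (hψ : Integrable ψ) {r : ℝ}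
    (hs : tsupport ψ ⊆ Metric.ball 0 r) {k : E3 → ℝ} {p : ℕ}
    (hk : ∀ z, ‖k z‖ ≤ (‖z‖ ^ p)⁻¹) {x : E3} (hr : 0 < r) (hx : 2 * r ≤ ‖x‖) :
    ‖∫ y, k (x - y) * ψ y‖ ≤ 2 ^ p * (∫ y, ‖ψ y‖) * (‖x‖ ^ p)⁻¹ := by
  have hx0 : 0 < ‖x‖ := by linarith
  rw [mul_right_comm, ← integral_const_mul]
  refine norm_integral_le_of_norm_le (hψ.norm.const_mul _) (Eventually.of_forall fun y => ?_)
  rw [norm_mul]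
  by_cases hy : y ∈ tsupport ψ
  · have hy' := mem_ball_zero_iff.1 (hs hy)
    have h1 : ‖x‖ / 2 ≤ ‖x - y‖ := by
      have := norm_sub_norm_le x y
      linarith
    refine mul_le_mul_of_nonneg_right ?_ (norm_nonneg _)
    calc ‖k (x - y)‖ ≤ (‖x - y‖ ^ p)⁻¹ := hk _
      _ ≤ ((‖x‖ / 2) ^ p)⁻¹ := by gcongr
      _ = 2 ^ p * (‖x‖ ^ p)⁻¹ := by rw [div_pow, inv_div, div_eq_mul_inv]
  · rw [image_eq_zero_of_notMem_tsupport hy]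
    simp

lemma four_pi_inv_le_one : (4 * Real.pi)⁻¹ ≤ 1 :=
  inv_le_one_of_one_le₀ (by linarith [Real.pi_gt_three])

lemma exists_potential_bound {ψ : E3 → ℝ} (hψ : ContDiff ℝ ∞ ψ) (hs : HasCompactSupport ψ) :
    ∃ C : ℝ, 0 ≤ C ∧ (∀ x, ‖potential ψ x‖ ≤ C * (weight x)⁻¹) ∧
      ∀ x, ‖gradient (potential ψ) x‖ ≤ C * (weight x)⁻¹ ^ 2 := by
  obtain ⟨r₀, hr₀, hr⟩ := exists_tsupport_subset_ball hs
  set r := max r₀ 1 with hrdef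
  have hr1 : 1 ≤ r := le_max_right _ _
  have hsr : tsupport ψ ⊆ Metric.ball 0 r :=
    hr.trans (Metric.ball_subset_ball (le_max_left _ _))
  have hint : Integrable ψ := hψ.continuous.integrable_of_hasCompactSupport hs
  have hΦ := contDiff_potential hψ hs
  have hI : 0 ≤ ∫ y, ‖ψ y‖ := integral_nonneg fun _ => norm_nonneg _
  obtain ⟨C₁, hC₁, h₁⟩ := exists_weight_bound hΦ.continuous (r := 2 * r)
    (A := 2 ^ 1 * ∫ y, ‖ψ y‖) (by linarith) (by positivity) 1 (fun x hx => by
      rw [potential_eq']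
      refine norm_integral_kernel_le hint hsr (p := 1) (fun z => ?_) (by linarith) hx
      rw [norm_newton, pow_one]
      exact mul_le_of_le_one_left (by positivity) four_pi_inv_le_one)
  have hgrad : ∀ x, 2 * r ≤ ‖x‖ → ‖‖gradient (potential ψ) x‖‖
      ≤ 2 ^ 2 * (∫ y, ‖ψ y‖) * (‖x‖ ^ 2)⁻¹ := by
    intro x hx
    rw [norm_norm, norm_gradient]
    refine ContinuousLinearMap.opNorm_le_of_unit_norm (by positivity) fun v hv => ?_
    rw [fderiv_potential_eq' hψ hs]
    refine norm_integral_kernel_le hint hsr (k := fun z => inner ℝ (newtonGrad z) v) (p := 2)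
      (fun z => ?_) (by linarith) hx
    refine (norm_inner_le_norm _ _).trans ?_
    rw [hv, mul_one, norm_newtonGrad]
    exact mul_le_of_le_one_left (by positivity) four_pi_inv_le_one
  obtain ⟨C₂, hC₂, h₂⟩ := exists_weight_bound (continuous_gradient hΦ).norm (r := 2 * r)
    (by linarith) (by positivity) 2 hgrad
  refine ⟨C₁ + C₂, by positivity, fun x => ?_, fun x => ?_⟩
  · have hw : 0 < (weight x)⁻¹ := inv_pos.2 (weight_pos x)
    have := h₁ x
    rw [pow_one] at this
    nlinarith
  · have hw : 0 < (weight x)⁻¹ ^ 2 := by have := weight_pos x; positivity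
    have := h₂ x
    rw [norm_norm] at this
    nlinarith

/-- The function ω⁻⁴ is integrable since 4 > 3. For a potential Φ both ω⁻¹Φ and ∇Φ are of order ω⁻²,
so this places Φ in 𝓗¹ of the whole space. -/
lemma memLp_weight_inv_sq : MemLp (fun x : E3 => (weight x)⁻¹ ^ 2) 2 volume := by
  have hc : Continuous (fun x : E3 => (weight x)⁻¹ ^ 2) :=
    (continuous_weight.inv₀ fun x => (weight_pos x).ne').pow 2
  rw [memLp_two_iff_integrable_sq hc.aestronglyMeasurable]
  have := integrable_rpow_neg_one_add_norm_sq (E := E3) (μ := volume) (r := 4)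
    (by rw [finrank_euclideanSpace, Fintype.card_fin]; norm_num)
  refine this.congr (Eventually.of_forall fun x => ?_)
  have hq : (0 : ℝ) < 1 + ‖x‖ ^ 2 := by positivity
  simp only
  rw [inv_pow, weight_sq, show (-4 / 2 : ℝ) = -((2 : ℕ) : ℝ) by norm_num, Real.rpow_neg hq.le,
    Real.rpow_natCast, inv_pow]

lemma memLp_potential {ψ : E3 → ℝ} (hψ : ContDiff ℝ ∞ ψ) (hs : HasCompactSupport ψ) :
    MemLp (potential ψ) 2 (weightedVolume Set.univ) := by
  obtain ⟨C, hC, h, -⟩ := exists_potential_bound hψ hs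
  rw [memLp_weightedVolume_iff, Measure.restrict_univ]
  refine (memLp_weight_inv_sq.const_mul C).mono' ?_ (Eventually.of_forall fun x => ?_)
  · exact ((continuous_weight.inv₀ fun x => (weight_pos x).ne').smul
      (contDiff_potential hψ hs).continuous).aestronglyMeasurable
  · have hw : 0 < (weight x)⁻¹ := inv_pos.2 (weight_pos x)
    rw [norm_smul, Real.norm_of_nonneg hw.le]
    calc (weight x)⁻¹ * ‖potential ψ x‖ ≤ (weight x)⁻¹ * (C * (weight x)⁻¹) := by
          gcongr; exact h x
      _ = _ := by ring

lemma memLp_gradient_potential {ψ : E3 → ℝ} (hψ : ContDiff ℝ ∞ ψ) (hs : HasCompactSupport ψ) :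
    MemLp (gradient (potential ψ)) 2 (volume.restrict Set.univ) := by
  obtain ⟨C, hC, -, h⟩ := exists_potential_bound hψ hs
  rw [Measure.restrict_univ]
  exact (memLp_weight_inv_sq.const_mul C).mono'
    (continuous_gradient (contDiff_potential hψ hs)).aestronglyMeasurable
    (Eventually.of_forall h)

/-- The potential of a test function belongs to the Beppo Levi space. -/
lemma potential_mem_beppoLevi {ψ : E3 → ℝ} (hψ : ContDiff ℝ ∞ ψ) (hs : HasCompactSupport ψ) :
    ambientOf (memLp_potential hψ hs) (memLp_gradient_potential hψ hs) ∈ beppoLevi := by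
  have hΦ := contDiff_potential hψ hs
  -- The potential is smooth but not compactly supported; its cutoffs are test functions converging
  -- to it in norm.
  refine isClosed_beppoLevi.mem_of_tendsto
    (tendsto_ambientOf_cutoff (memLp_potential hψ hs) (memLp_gradient_potential hψ hs))
    (Eventually.of_forall fun n => testPairs_le_beppoLevi
      ⟨fun x => cutoff n x * potential ψ x, (contDiff_cutoff n).mul hΦ,
        (hasCompactSupport_cutoff n).mul_right, ambientOf_fst _ _, ?_⟩)
  filter_upwards [ambientOf_snd (memLp_cutoff_mul (memLp_potential hψ hs) n)
    (memLp_cutoffGrad (memLp_potential hψ hs) (memLp_gradient_potential hψ hs) n)] with x hx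
  rw [hx, gradient_mul_fun ((contDiff_cutoff n).differentiable (by simp) x)
    (hΦ.differentiable (by simp) x)]
  rfl

/-- The potential as an element of the Beppo Levi space. -/
def potentialElement {ψ : E3 → ℝ} (hψ : ContDiff ℝ ∞ ψ) (hs : HasCompactSupport ψ) : beppoLevi :=
  ⟨_, potential_mem_beppoLevi hψ hs⟩

/-- This is the bridge from the variational solution to its values: pairing ∇u with ∇Φ recovers ∫
ψu. Both sides are continuous in u, so test functions suffice, where it is the weak Poisson
equation. -/
lemma inner_snd_potentialElement {ψ : E3 → ℝ} (hψ : ContDiff ℝ ∞ ψ) (hs : HasCompactSupport ψ)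
    (u : beppoLevi) :
    inner ℝ (u : SobolevAmbient Set.univ).snd
      (potentialElement hψ hs : SobolevAmbient Set.univ).snd
      = - ∫ x, ψ x * (u : SobolevAmbient Set.univ).fst x := by
  refine beppoLevi_induction (P := fun u => inner ℝ u.snd
      (potentialElement hψ hs : SobolevAmbient Set.univ).snd = - ∫ x, ψ x * u.fst x) ?_ ?_ u.2
  · refine isClosed_eq ((gradientL _).continuous.inner continuous_const) ?_
    have := continuous_setIntegral_mul_fst MeasurableSet.univ hψ.continuous hs
    simp only [setIntegral_univ] at this
    exact this.neg
  · rintro p ⟨φ, hφ, hφs, h1, h2⟩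
    have e1 : ∫ x, ψ x * p.fst x = ∫ x, ψ x * φ x := by
      rw [← setIntegral_univ (μ := volume), ← setIntegral_univ (μ := volume) (f := fun x => ψ x * φ x)]
      exact integral_congr_ae (by filter_upwards [h1] with x hx; rw [hx])
    rw [e1, ← integral_inner_gradient_potential hψ hs hφ hφs, L2.inner_def,
      ← setIntegral_univ (μ := volume)]
    refine integral_congr_ae ?_
    filter_upwards [h2, ambientOf_snd (memLp_potential hψ hs)
      (memLp_gradient_potential hψ hs)] with x hx hy
    rw [hx]
    congr 1

end NewtonPotential

/-! ### Mollification, and C¹ test functions for weak gradients -/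

section Mollification

/-- Shrinking mollifiers. -/
def mollifier (n : ℕ) : ContDiffBump (0 : E3) where
  rIn := regSeq n / 2
  rOut := regSeq n
  rIn_pos := half_pos (regSeq_pos n)
  rIn_lt_rOut := half_lt_self (regSeq_pos n)

open scoped Convolution in
/-- Mollification of a function. -/
def mollify (n : ℕ) (f : E3 → ℝ) : E3 → ℝ :=
  (mollifier n).normed volume ⋆[ContinuousLinearMap.lsmul ℝ ℝ, volume] f

lemma regSeq_le_one (n : ℕ) : regSeq n ≤ 1 := by
  unfold regSeq
  rw [div_le_one (by positivity)]
  linarith [Nat.cast_nonneg (α := ℝ) n]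

lemma contDiff_mollify (n : ℕ) {f : E3 → ℝ} (hf : Continuous f) : ContDiff ℝ ∞ (mollify n f) :=
  (mollifier n).hasCompactSupport_normed.contDiff_convolution_left _
    (mollifier n).contDiff_normed hf.locallyIntegrable

lemma fderiv_mollify (n : ℕ) {f : E3 → ℝ} (hf : ContDiff ℝ 1 f) (hs : HasCompactSupport f)
    (x v : E3) : fderiv ℝ (mollify n f) x v = mollify n (fun y => fderiv ℝ f y v) x := by
  have hn : LocallyIntegrable ((mollifier n).normed volume) :=
    (mollifier n).continuous_normed.locallyIntegrable
  have h := (hs.hasFDerivAt_convolution_right (ContinuousLinearMap.lsmul ℝ ℝ) hn hf x).fderiv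
  rw [mollify, h, convolution_precompR_apply _ hn (hs.fderiv (𝕜 := ℝ))
    (hf.continuous_fderiv (by norm_num))]
  rfl

lemma tendsto_mollify {f : E3 → ℝ} (hf : Continuous f) (x : E3) :
    Tendsto (fun n => mollify n f x) atTop (𝓝 (f x)) :=
  ContDiffBump.convolution_tendsto_right_of_continuous tendsto_regSeq hf x

lemma norm_mollify_le (n : ℕ) {f : E3 → ℝ} (hf : Continuous f) {C : ℝ} (hC : ∀ x, ‖f x‖ ≤ C)
    (x : E3) : ‖mollify n f x‖ ≤ 3 * C := by
  have h := (mollifier n).dist_normed_convolution_le (μ := volume) (x₀ := x) (ε := 2 * C)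
    hf.aestronglyMeasurable (fun y _ => by
      rw [dist_eq_norm]
      exact (norm_sub_le _ _).trans (by linarith [hC x, hC y]))
  rw [dist_eq_norm] at h
  have h2 := norm_add_le (mollify n f x - f x) (f x)
  rw [sub_add_cancel] at h2
  have h3 := hC x
  change ‖mollify n f x - f x‖ ≤ _ at h
  linarith

lemma tsupport_mollify_subset (n : ℕ) (f : E3 → ℝ) :
    tsupport (mollify n f) ⊆ Metric.cthickening (regSeq n) (tsupport f) := by
  refine closure_minimal ?_ Metric.isClosed_cthickening
  intro x hx
  obtain ⟨y, hy, z, hz, rfl⟩ := support_convolution_subset _ hx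
  rw [(mollifier n).support_normed_eq] at hy
  refine Metric.mem_cthickening_of_dist_le _ z _ _ (subset_tsupport f hz) ?_
  rw [dist_eq_norm, add_sub_cancel_right]
  exact (mem_ball_zero_iff.1 hy).le

lemma hasCompactSupport_mollify (n : ℕ) {f : E3 → ℝ} (hs : HasCompactSupport f) :
    HasCompactSupport (mollify n f) :=
  (mollifier n).hasCompactSupport_normed.convolution _ hs

/-- The weak gradient may be tested against compactly supported `C¹` functions. -/
lemma IsWeakGradient.integral_fderiv_mul {Ω : Set E3} (hΩ : IsOpen Ω) {g : E3 → ℝ} {G : E3 → E3}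
    (h : IsWeakGradient Ω g G) (hg : MemLp g 2 (weightedVolume Ω))
    (hG : MemLp G 2 (volume.restrict Ω)) {f : E3 → ℝ} (hf : ContDiff ℝ 1 f)
    (hs : HasCompactSupport f) (ht : tsupport f ⊆ Ω) (v : E3) :
    ∫ x in Ω, fderiv ℝ f x v * g x = - ∫ x in Ω, f x * inner ℝ (G x) v := by
  -- Once the mollification radius is below δ, the mollified function is an admissible smooth test
  -- function supported in Ω.
  obtain ⟨δ, hδ, hδΩ⟩ := hs.isCompact.exists_cthickening_subset_open hΩ ht
  have hcd : Continuous (fun x => fderiv ℝ f x v) :=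
    (hf.continuous_fderiv (by norm_num)).clm_apply continuous_const
  have hds : HasCompactSupport (fun x => fderiv ℝ f x v) := hs.fderiv_apply ℝ v
  obtain ⟨C₁, hC₁⟩ := hs.exists_bound_of_continuous hf.continuous
  obtain ⟨C₂, hC₂⟩ := hds.exists_bound_of_continuous hcd
  obtain ⟨r, hr0, hr⟩ := (hs.isCompact.isBounded.cthickening (δ := 1)).exists_pos_norm_lt
  obtain ⟨N, hN⟩ := exists_nat_ge r
  -- All mollification radii are at most 1, so one cutoff χ_N, equal to 1 on the 1-thickening of the
  -- support, gives a majorant independent of n for the function and its derivative alike.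
  have hbound : ∀ (k : E3 → ℝ) (C : ℝ), Continuous k → tsupport k ⊆ tsupport f →
      (∀ x, ‖k x‖ ≤ C) → ∀ n x, ‖mollify n k x‖ ≤ 3 * C * cutoff N x := by
    intro k C hk hks hkC n x
    by_cases hx : x ∈ Metric.cthickening 1 (tsupport f)
    · rw [cutoff_eq_one (by linarith [hr x hx]), mul_one]
      exact norm_mollify_le n hk hkC x
    · have : x ∉ tsupport (mollify n k) := fun h' => hx
        (Metric.cthickening_subset_of_subset _ hks
          (Metric.cthickening_mono (regSeq_le_one n) _ (tsupport_mollify_subset n k h')))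
      rw [image_eq_zero_of_notMem_tsupport this, norm_zero]
      have := (norm_nonneg _).trans (hkC x)
      have := cutoff_nonneg N x
      positivity
  have l1 : Tendsto (fun n => ∫ x in Ω, fderiv ℝ (mollify n f) x v * g x) atTop
      (𝓝 (∫ x in Ω, fderiv ℝ f x v * g x)) := by
    simp only [fderiv_mollify _ hf hs]
    refine tendsto_integral_of_dominated_convergence (fun x => ‖3 * C₂ * cutoff N x * g x‖)
      (fun n => ?_) ?_ (fun n => ?_) ?_
    · exact (contDiff_mollify n hcd).continuous.aestronglyMeasurable.mul
        (aestronglyMeasurable_weightedVolume_iff.1 hg.1)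
    · exact (integrable_mul_of_memLp hg (continuous_const.mul (contDiff_cutoff N).continuous)
        (hasCompactSupport_cutoff N).mul_left).norm
    · refine Eventually.of_forall fun x => ?_
      rw [norm_mul, norm_mul]
      gcongr
      exact (hbound _ C₂ hcd (tsupport_fderiv_apply_subset ℝ v) hC₂ n x).trans (le_abs_self _)
    · exact Eventually.of_forall fun x => (tendsto_mollify hcd x).mul_const _
  have l2 : Tendsto (fun n => -∫ x in Ω, mollify n f x * inner ℝ (G x) v) atTop
      (𝓝 (-∫ x in Ω, f x * inner ℝ (G x) v)) := by
    refine (tendsto_integral_of_dominated_convergence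
      (fun x => ‖3 * C₁ * cutoff N x * inner ℝ (G x) v‖) (fun n => ?_) ?_ (fun n => ?_) ?_).neg
    · exact (contDiff_mollify n hf.continuous).continuous.aestronglyMeasurable.mul
        (hG.inner_const v).1
    · exact (integrable_mul_inner_of_memLp hG (continuous_const.mul (contDiff_cutoff N).continuous)
        (hasCompactSupport_cutoff N).mul_left v).norm
    · refine Eventually.of_forall fun x => ?_
      rw [norm_mul, norm_mul]
      gcongr
      exact (hbound _ C₁ hf.continuous subset_rfl hC₁ n x).trans (le_abs_self _)
    · exact Eventually.of_forall fun x => (tendsto_mollify hf.continuous x).mul_const _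
  refine tendsto_nhds_unique l1 (l2.congr' ?_)
  filter_upwards [tendsto_regSeq.eventually_le_const hδ] with n hn
  exact (h _ (contDiff_mollify n hf.continuous) (hasCompactSupport_mollify n hs)
    ((tsupport_mollify_subset n f).trans ((Metric.cthickening_mono hn _).trans hδΩ)) v).symm

end Mollification

/-! ### The field b = a⁻¹∇a and the explicit remainder kernel -/

section Coefficient

/-- The logarithmic derivatives `a⁻¹ ∂ᵢa`. -/
def coef (a : E3 → ℝ) (i : Fin 3) (z : E3) : ℝ := 1 / a z * partialDeriv i a z

/-- The divergence of `a⁻¹ ∇a`. -/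
def divCoef (a : E3 → ℝ) (x : E3) : ℝ := ∑ i, partialDeriv i (coef a i) x

/-- The remainder kernel with the derivatives carried out. -/
def kernelExplicit (a : E3 → ℝ) (x y : E3) : ℝ :=
  -(divCoef a x * newton (x - y) + ∑ i, coef a i x * newtonGrad (x - y) i)

/-- A coefficient which is `C¹` globally, `C²` up to the boundary of the open set `Ω`, and bounded
below on `Ω` by `c > 0`. -/
structure IsCoefficient (Ω : Set E3) (a : E3 → ℝ) (c : ℝ) : Prop where
  isOpen : IsOpen Ω
  contDiff : ContDiff ℝ 1 a
  contDiffOn : ContDiffOn ℝ 2 a (closure Ω)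
  pos : 0 < c
  lt : ∀ x ∈ Ω, c < a x

variable {Ω : Set E3} {a : E3 → ℝ} {c : ℝ}

lemma IsCoefficient.contDiffAt (ha : IsCoefficient Ω a c) {x : E3} (hx : x ∈ Ω) :
    ContDiffAt ℝ 2 a x :=
  (ha.contDiffOn.mono subset_closure).contDiffAt (ha.isOpen.mem_nhds hx)

lemma IsCoefficient.ne_zero (ha : IsCoefficient Ω a c) {x : E3} (hx : x ∈ Ω) : a x ≠ 0 :=
  (ha.pos.trans (ha.lt x hx)).ne'

lemma IsCoefficient.contDiffAt_partialDeriv (ha : IsCoefficient Ω a c) {x : E3} (hx : x ∈ Ω)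
    (i : Fin 3) : ContDiffAt ℝ 1 (partialDeriv i a) x :=
  ((ha.contDiffAt hx).fderiv_right (m := 1) (by norm_num)).clm_apply contDiffAt_const

lemma IsCoefficient.contDiffAt_coef (ha : IsCoefficient Ω a c) {x : E3} (hx : x ∈ Ω)
    (i : Fin 3) : ContDiffAt ℝ 1 (coef a i) x :=
  (contDiffAt_const.div ha.contDiff.contDiffAt (ha.ne_zero hx)).mul
    (ha.contDiffAt_partialDeriv hx i)

lemma IsCoefficient.continuousOn_coef (ha : IsCoefficient Ω a c) (i : Fin 3) :
    ContinuousOn (coef a i) Ω := fun _ hx =>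
  (ha.contDiffAt_coef hx i).continuousAt.continuousWithinAt

lemma IsCoefficient.continuousOn_divCoef (ha : IsCoefficient Ω a c) :
    ContinuousOn (divCoef a) Ω := by
  intro x hx
  refine ContinuousAt.continuousWithinAt ?_
  exact tendsto_finsetSum _ fun i _ =>
    (((ha.contDiffAt_coef hx i).fderiv_right (m := 0) (by norm_num)).continuousAt.clm_apply
      continuousAt_const)

lemma hasFDerivAt_newton {z : E3} (hz : z ≠ 0) :
    HasFDerivAt newton (innerSL ℝ (newtonGrad z)) z := by
  have h0 : ‖z‖ ≠ 0 := norm_ne_zero_iff.2 hz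
  have h := (((hasStrictFDerivAt_norm_sq z).hasFDerivAt.rpow_const (p := -((1 : ℕ) / 2))
    (Or.inl (by positivity))).const_mul (-(4 * Real.pi)⁻¹))
  have e : (fun z : E3 => -(4 * Real.pi)⁻¹ * (‖z‖ ^ 2) ^ (-((1 : ℕ) / 2) : ℝ)) = newton := by
    funext z
    rw [norm_sq_rpow, newton, neg_div, one_div, mul_inv _ ‖z‖, pow_one, neg_mul]
  rw [e] at h
  refine h.congr_fderiv ?_
  ext v
  have e3 := norm_sq_rpow (z := z) 3
  rw [show (-((1 : ℕ) / 2) - 1 : ℝ) = -((3 : ℕ) / 2) by norm_num, e3]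
  simp only [smul_apply, innerSL_apply_apply, smul_eq_mul, nsmul_eq_mul, newtonGrad,
    real_inner_smul_left]
  rw [mul_inv (4 * Real.pi)]
  push_cast
  ring

/-- The product rule needs P_Δ differentiable at x - y, so the diagonal is excluded; for each y that
is a single point, hence null. -/
lemma IsCoefficient.remainderKernel_eq (ha : IsCoefficient Ω a c) {x y : E3} (hx : x ∈ Ω)
    (hxy : x ≠ y) : remainderKernel a x y = kernelExplicit a x y := by
  have h : ∀ i : Fin 3,
      partialDeriv i (fun z => 1 / a z * partialDeriv i a z * laplaceFundamental z y) x
        = partialDeriv i (coef a i) x * newton (x - y) + coef a i x * newtonGrad (x - y) i := by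
    intro i
    have h1 := ((ha.contDiffAt_coef hx i).differentiableAt (by simp)).hasFDerivAt
    have h2 : HasFDerivAt (fun z => newton (z - y)) (innerSL ℝ (newtonGrad (x - y))) x :=
      (hasFDerivAt_comp_sub y).2 (hasFDerivAt_newton (sub_ne_zero.2 hxy))
    have h3 := (h1.fun_mul h2).fderiv
    change fderiv ℝ (fun z => coef a i z * newton (z - y)) x (basisVec i) = _
    rw [h3]
    simp only [add_apply, smul_apply, smul_eq_mul, innerSL_apply_apply, inner_basisVec]
    change _ = fderiv ℝ (coef a i) x (basisVec i) * _ + _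
    ring
  simp only [remainderKernel, h, kernelExplicit, divCoef]
  rw [Finset.sum_add_distrib, Finset.sum_mul]

lemma ae_ne (y : E3) : ∀ᵐ x : E3, x ≠ y := by simp [ae_iff, measure_singleton]

lemma IsCoefficient.remainderKernel_ae_eq (ha : IsCoefficient Ω a c) (y : E3) :
    ∀ᵐ x ∂(volume.restrict Ω), remainderKernel a x y = kernelExplicit a x y := by
  filter_upwards [ae_restrict_of_ae (ae_ne y), ae_restrict_mem ha.isOpen.measurableSet]
    with x h1 h2 using ha.remainderKernel_eq h2 h1

/-- The second derivative of a function of class `C²` on the closure of an open set is bounded near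
each point of the closure. -/
lemma exists_bound_fderiv_fderiv_nhds (hΩ : IsOpen Ω) (h : ContDiffOn ℝ 2 a (closure Ω)) {p : E3}
    (hp : p ∈ closure Ω) :
    ∃ O : Set E3, IsOpen O ∧ p ∈ O ∧ ∃ C : ℝ, ∀ x ∈ Ω ∩ O, ‖fderiv ℝ (fderiv ℝ a) x‖ ≤ C := by
  -- Unfolding C² regularity within the closure twice gives a second derivative `a''` continuous at
  -- p within a set, hence bounded near p. At points of the open set Ω it agrees with the full
  -- second derivative.
  obtain ⟨u, hu, -, a', ha', hc⟩ :=
    (contDiffWithinAt_succ_iff_hasFDerivWithinAt (n := 1) (by simp)).1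
      ((h p hp).of_le (by norm_num))
  obtain ⟨u', hu', -, a'', ha'', hc'⟩ :=
    (contDiffWithinAt_succ_iff_hasFDerivWithinAt (n := 0) (by simp)).1
      (hc.of_le (by norm_num))
  have hb : {x | ‖a'' x‖ < ‖a'' p‖ + 1} ∈ 𝓝[u'] p :=
    hc'.continuousWithinAt.norm (Iio_mem_nhds (lt_add_one _))
  obtain ⟨O₁, hO₁, hp₁, h₁⟩ := mem_nhdsWithin.1 hu
  obtain ⟨O₂, hO₂, hp₂, h₂⟩ := mem_nhdsWithin.1 hu'
  obtain ⟨O₃, hO₃, hp₃, h₃⟩ := mem_nhdsWithin.1 hb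
  have s₁ : Ω ∩ O₁ ⊆ u := fun x hx => h₁ ⟨hx.2, Or.inr (subset_closure hx.1)⟩
  have s₂ : Ω ∩ (O₁ ∩ O₂) ⊆ u' := fun x hx => h₂ ⟨hx.2.2, Or.inr (s₁ ⟨hx.1, hx.2.1⟩)⟩
  refine ⟨O₁ ∩ O₂ ∩ O₃, (hO₁.inter hO₂).inter hO₃, ⟨⟨hp₁, hp₂⟩, hp₃⟩, ‖a'' p‖ + 1,
    fun x hx => ?_⟩
  have e : ∀ z ∈ Ω ∩ (O₁ ∩ O₂), fderiv ℝ a z = a' z := fun z hz =>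
    ((ha' z (s₁ ⟨hz.1, hz.2.1⟩)).hasFDerivAt
      (mem_of_superset ((hΩ.inter hO₁).mem_nhds ⟨hz.1, hz.2.1⟩) s₁)).fderiv
  have hxm : x ∈ Ω ∩ (O₁ ∩ O₂) := ⟨hx.1, hx.2.1⟩
  have hn : Ω ∩ (O₁ ∩ O₂) ∈ 𝓝 x := (hΩ.inter (hO₁.inter hO₂)).mem_nhds hxm
  have e2 : fderiv ℝ (fderiv ℝ a) x = a'' x :=
    (((ha'' x (s₂ hxm)).hasFDerivAt (mem_of_superset hn s₂)).congr_of_eventuallyEq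
      (mem_of_superset hn e)).fderiv
  rw [e2]
  exact (h₃ ⟨hx.2.2, s₂ hxm⟩ : ‖a'' x‖ < ‖a'' p‖ + 1).le

/-- Local bounds are glued over the compact set closure(Ω) ∩ closed ball. The C² hypothesis on the
closure, rather than on Ω alone, keeps div b bounded up to the boundary. -/
lemma exists_bound_fderiv_fderiv (hΩ : IsOpen Ω) (h : ContDiffOn ℝ 2 a (closure Ω)) (r : ℝ) :
    ∃ C : ℝ, 0 ≤ C ∧ ∀ x ∈ truncated Ω r, ‖fderiv ℝ (fderiv ℝ a) x‖ ≤ C := by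
  have hK : IsCompact (Metric.closedBall (0 : E3) r ∩ closure Ω) :=
    (isCompact_closedBall _ _).inter_right isClosed_closure
  have key : ∃ C : ℝ, ∀ x ∈ Ω ∩ (Metric.closedBall (0 : E3) r ∩ closure Ω),
      ‖fderiv ℝ (fderiv ℝ a) x‖ ≤ C := by
    refine hK.induction_on (p := fun s => ∃ C : ℝ, ∀ x ∈ Ω ∩ s, ‖fderiv ℝ (fderiv ℝ a) x‖ ≤ C)
      ⟨0, by simp⟩ ?_ ?_ ?_
    · rintro s t hst ⟨C, hC⟩
      exact ⟨C, fun x hx => hC x ⟨hx.1, hst hx.2⟩⟩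
    · rintro s t ⟨C, hC⟩ ⟨C', hC'⟩
      refine ⟨max C C', fun x hx => ?_⟩
      rcases hx.2 with h | h
      · exact (hC x ⟨hx.1, h⟩).trans (le_max_left _ _)
      · exact (hC' x ⟨hx.1, h⟩).trans (le_max_right _ _)
    · rintro p hp
      obtain ⟨O, hO, hpO, C, hC⟩ := exists_bound_fderiv_fderiv_nhds hΩ h hp.2
      exact ⟨O, mem_nhdsWithin_of_mem_nhds (hO.mem_nhds hpO), C, hC⟩
  obtain ⟨C, hC⟩ := key
  refine ⟨max C 0, le_max_right _ _, fun x hx => (hC x ⟨hx.1, ?_, ?_⟩).trans (le_max_left _ _)⟩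
  · exact Metric.ball_subset_closedBall hx.2
  · exact subset_closure hx.1

lemma norm_basisVec (i : Fin 3) : ‖basisVec i‖ = 1 := by
  simp [basisVec]

lemma norm_partialDeriv_le (f : E3 → ℝ) (i : Fin 3) (x : E3) :
    ‖partialDeriv i f x‖ ≤ ‖fderiv ℝ f x‖ := by
  have := (fderiv ℝ f x).le_opNorm (basisVec i)
  rwa [norm_basisVec, mul_one] at this

lemma IsCoefficient.norm_inv_le (ha : IsCoefficient Ω a c) {x : E3} (hx : x ∈ Ω) :
    ‖1 / a x‖ ≤ c⁻¹ := by
  have h := ha.lt x hx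
  have h0 := ha.pos
  rw [one_div, norm_inv, Real.norm_of_nonneg (h0.trans h).le]
  exact inv_anti₀ h0 h.le

lemma IsCoefficient.partialDeriv_coef (ha : IsCoefficient Ω a c) {x : E3} (hx : x ∈ Ω)
    (i : Fin 3) :
    partialDeriv i (coef a i) x = 1 / a x * fderiv ℝ (fderiv ℝ a) x (basisVec i) (basisVec i)
      - (1 / a x) * (1 / a x) * partialDeriv i a x * partialDeriv i a x := by
  have h1 : HasFDerivAt (fun z => (a z)⁻¹) _ x :=
    (hasFDerivAt_inv (ha.ne_zero hx)).comp x (ha.contDiff.differentiable (by simp) x).hasFDerivAt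
  have h2 : HasFDerivAt (fun z => fderiv ℝ a z (basisVec i)) _ x :=
    ((((ha.contDiffAt hx).fderiv_right (m := 1) (by norm_num)).differentiableAt
      (by simp)).hasFDerivAt).clm_apply (hasFDerivAt_const (basisVec i) x)
  have h3 := (h1.fun_mul h2).fderiv
  have e : coef a i = fun z => (a z)⁻¹ * fderiv ℝ a z (basisVec i) := by
    funext z; rw [coef, one_div]; rfl
  rw [e]
  change fderiv ℝ (fun z => (a z)⁻¹ * fderiv ℝ a z (basisVec i)) x (basisVec i) = _
  rw [h3]
  have := ha.ne_zero hx
  simp [partialDeriv]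
  change _ = _ - _ * fderiv ℝ a x (basisVec i) * fderiv ℝ a x (basisVec i)
  field_simp
  ring

lemma IsCoefficient.exists_bound (ha : IsCoefficient Ω a c) (r : ℝ) :
    ∃ C : ℝ, 0 ≤ C ∧ ∀ x ∈ truncated Ω r, (∀ i, ‖coef a i x‖ ≤ C) ∧ ‖divCoef a x‖ ≤ C := by
  obtain ⟨C₂, hC₂, h₂⟩ := exists_bound_fderiv_fderiv ha.isOpen ha.contDiffOn r
  obtain ⟨C₁, h₁⟩ := (isCompact_closedBall (0 : E3) r).exists_bound_of_continuousOn
    (ha.contDiff.continuous_fderiv (by simp)).continuousOn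
  have hc := ha.pos
  have hCm : 0 ≤ max C₁ 0 := le_max_right _ _
  have hp : ∀ x ∈ truncated Ω r, ∀ i, ‖partialDeriv i a x‖ ≤ max C₁ 0 := fun x hx i =>
    (norm_partialDeriv_le a i x).trans ((h₁ x (Metric.ball_subset_closedBall hx.2)).trans
      (le_max_left _ _))
  have hA : 0 ≤ c⁻¹ * max C₁ 0 := by positivity
  have hB : 0 ≤ 3 * (c⁻¹ * C₂ + c⁻¹ * c⁻¹ * max C₁ 0 * max C₁ 0) := by positivity
  refine ⟨c⁻¹ * max C₁ 0 + 3 * (c⁻¹ * C₂ + c⁻¹ * c⁻¹ * max C₁ 0 * max C₁ 0), by positivity,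
    fun x hx => ⟨fun i => ?_, ?_⟩⟩
  · rw [coef, norm_mul]
    have := mul_le_mul (ha.norm_inv_le hx.1) (hp x hx i) (norm_nonneg _) (by positivity)
    linarith
  · have h3 : ∀ i, ‖partialDeriv i (coef a i) x‖
        ≤ c⁻¹ * C₂ + c⁻¹ * c⁻¹ * max C₁ 0 * max C₁ 0 := by
      intro i
      rw [ha.partialDeriv_coef hx.1]
      refine (norm_sub_le _ _).trans (add_le_add ?_ ?_)
      · rw [norm_mul]
        refine mul_le_mul (ha.norm_inv_le hx.1) ?_ (norm_nonneg _) (by positivity)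
        have := (fderiv ℝ (fderiv ℝ a) x).le_opNorm₂ (basisVec i) (basisVec i)
        rw [norm_basisVec, mul_one, mul_one] at this
        exact this.trans (h₂ x hx)
      · simp only [norm_mul]
        have h4 := ha.norm_inv_le hx.1
        have h5 := hp x hx i
        gcongr
    refine (norm_sum_le _ _).trans ((Finset.sum_le_sum fun i _ => h3 i).trans ?_)
    simp only [Finset.sum_const, Finset.card_univ, Fintype.card_fin, nsmul_eq_mul]
    push_cast
    linarith

end Coefficient

/-! ### Convergence of the remainder integral and Fubini's theorem -/

section KernelIntegrals

variable {Ω : Set E3} {a : E3 → ℝ} {c : ℝ}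

lemma norm_apply_le (v : E3) (i : Fin 3) : ‖v i‖ ≤ ‖v‖ := by
  have := norm_inner_le_norm (𝕜 := ℝ) v (basisVec i)
  rwa [norm_basisVec, mul_one, inner_basisVec] at this

lemma norm_newton_sub_comm (x y : E3) : ‖newton (x - y)‖ = ‖newton (y - x)‖ := by
  rw [norm_newton, norm_newton, norm_sub_rev]

lemma norm_newtonGrad_sub_comm (x y : E3) : ‖newtonGrad (x - y)‖ = ‖newtonGrad (y - x)‖ := by
  rw [norm_newtonGrad, norm_newtonGrad, norm_sub_rev]

lemma norm_kernelExplicit_le {C : ℝ} {x : E3} (h1 : ∀ i, ‖coef a i x‖ ≤ C)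
    (h2 : ‖divCoef a x‖ ≤ C) (hC : 0 ≤ C) (y : E3) :
    ‖kernelExplicit a x y‖ ≤ C * (‖newton (y - x)‖ + 3 * ‖newtonGrad (y - x)‖) := by
  rw [kernelExplicit, norm_neg]
  refine (norm_add_le _ _).trans ?_
  rw [mul_add]
  refine add_le_add ?_ ?_
  · rw [norm_mul, norm_newton_sub_comm]
    gcongr
  · refine (norm_sum_le _ _).trans ?_
    have : ∀ i, ‖coef a i x * newtonGrad (x - y) i‖ ≤ C * ‖newtonGrad (y - x)‖ := by
      intro i
      rw [norm_mul, ← norm_newtonGrad_sub_comm]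
      have := norm_apply_le (newtonGrad (x - y)) i
      have := h1 i
      gcongr
    refine (Finset.sum_le_sum fun i _ => this i).trans (le_of_eq ?_)
    simp only [Finset.sum_const, Finset.card_univ, Fintype.card_fin, nsmul_eq_mul]
    push_cast
    ring

lemma IsCoefficient.aestronglyMeasurable_coef (ha : IsCoefficient Ω a c) (i : Fin 3) :
    AEStronglyMeasurable (coef a i) (volume.restrict Ω) :=
  (ha.continuousOn_coef i).aestronglyMeasurable ha.isOpen.measurableSet

lemma IsCoefficient.aestronglyMeasurable_divCoef (ha : IsCoefficient Ω a c) :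
    AEStronglyMeasurable (divCoef a) (volume.restrict Ω) :=
  ha.continuousOn_divCoef.aestronglyMeasurable ha.isOpen.measurableSet

lemma truncated_le (Ω : Set E3) (r : ℝ) :
    (volume : Measure E3).restrict (truncated Ω r) ≤ volume.restrict Ω :=
  Measure.restrict_mono_set _ Set.inter_subset_left

lemma IsCoefficient.aestronglyMeasurable_kernelExplicit (ha : IsCoefficient Ω a c)
    (μ : Measure E3) [SFinite μ] :
    AEStronglyMeasurable (fun p : E3 × E3 => kernelExplicit a p.2 p.1)
      (μ.prod (volume.restrict Ω)) := by
  have hs : Measurable (fun p : E3 × E3 => p.2 - p.1) := measurable_snd.sub measurable_fst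
  refine AEStronglyMeasurable.neg (AEStronglyMeasurable.add ?_ ?_)
  · exact ha.aestronglyMeasurable_divCoef.comp_snd.mul
      (measurable_newton.comp hs).aestronglyMeasurable
  · refine Finset.aestronglyMeasurable_fun_sum _ fun i _ => ?_
    refine (ha.aestronglyMeasurable_coef i).comp_snd.mul ?_
    exact ((EuclideanSpace.proj (𝕜 := ℝ) i).continuous.measurable.comp
      (measurable_newtonGrad.comp hs)).aestronglyMeasurable

/-- On bounded sets the kernel is dominated by |y-x|⁻¹ + |y-x|⁻² up to constants, so the integrand
is dominated by that of a convolution of two integrable functions. -/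
lemma IsCoefficient.integrable_prod_kernel (ha : IsCoefficient Ω a c) {r : ℝ} {g : E3 → ℝ}
    (hg : IntegrableOn g (truncated Ω r)) (M : ℝ) :
    Integrable (fun p : E3 × E3 => kernelExplicit a p.2 p.1 * g p.2)
      ((volume.restrict (Metric.ball 0 M)).prod (volume.restrict (truncated Ω r))) := by
  obtain ⟨C, hC, hb⟩ := ha.exists_bound r
  set D := truncated Ω r with hD
  have hDm : MeasurableSet D := ha.isOpen.measurableSet.inter measurableSet_ball
  set B : Set E3 := Metric.ball 0 M
  -- Differences y - x with |y| < M and |x| < r have norm below M + r, so cutting the kernel off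
  -- there loses nothing and makes it integrable.
  set B' : Set E3 := Metric.ball 0 (M + r) with hB'
  set K : E3 → ℝ := B'.indicator (fun z => C * (‖newton z‖ + 3 * ‖newtonGrad z‖)) with hK
  have hKi : Integrable K := by
    rw [hK, integrable_indicator_iff measurableSet_ball]
    have h1 := (locallyIntegrable_newton.integrableOn_isCompact
      (isCompact_closedBall (0 : E3) (M + r))).mono_set Metric.ball_subset_closedBall
    have h2 := (locallyIntegrable_newtonGrad.integrableOn_isCompact
      (isCompact_closedBall (0 : E3) (M + r))).mono_set Metric.ball_subset_closedBall
    exact (h1.norm.add (h2.norm.const_mul 3)).const_mul C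
  have hgi : Integrable (D.indicator fun x => ‖g x‖) := (integrable_indicator_iff hDm).2 hg.norm
  have hconv := (hgi.convolution_integrand (ContinuousLinearMap.mul ℝ ℝ) hKi).restrict
    (s := B ×ˢ D)
  rw [← Measure.prod_restrict] at hconv
  refine hconv.mono' ?_ ?_
  · refine AEStronglyMeasurable.mul ?_ hg.aestronglyMeasurable.comp_snd
    refine (ha.aestronglyMeasurable_kernelExplicit (volume.restrict B)).mono_measure ?_
    exact Measure.prod_mono le_rfl (truncated_le Ω r)
  · rw [Measure.prod_restrict]
    filter_upwards [ae_restrict_mem (measurableSet_ball.prod hDm)] with p hp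
    have h1 : p.1 - p.2 ∈ B' := by
      rw [hB', mem_ball_zero_iff]
      have e1 := mem_ball_zero_iff.1 hp.1
      have e2 := mem_ball_zero_iff.1 hp.2.2
      exact (norm_sub_le _ _).trans_lt (add_lt_add e1 e2)
    rw [ContinuousLinearMap.mul_apply', Set.indicator_of_mem hp.2, hK, Set.indicator_of_mem h1,
      norm_mul, mul_comm]
    exact mul_le_mul_of_nonneg_left
      (norm_kernelExplicit_le (hb _ hp.2).1 (hb _ hp.2).2 hC _) (norm_nonneg _)

lemma IsCoefficient.ae_integrableOn_kernel (ha : IsCoefficient Ω a c) {r : ℝ} {g : E3 → ℝ}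
    (hg : IntegrableOn g (truncated Ω r)) :
    ∀ᵐ y : E3, IntegrableOn (fun x => kernelExplicit a x y * g x) (truncated Ω r) := by
  -- Fubini requires y in a bounded set; countably many balls exhaust the space.
  have h : ∀ M : ℕ, ∀ᵐ y : E3, y ∈ Metric.ball (0 : E3) M →
      IntegrableOn (fun x => kernelExplicit a x y * g x) (truncated Ω r) := fun M =>
    (ae_restrict_iff' measurableSet_ball).1 (ha.integrable_prod_kernel hg M).prod_right_ae
  filter_upwards [ae_all_iff.2 h] with y hy
  obtain ⟨M, hM⟩ := exists_nat_gt ‖y‖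
  exact hy M (mem_ball_zero_iff.2 hM)

lemma IsCoefficient.remainderKernel_ae_eq_truncated (ha : IsCoefficient Ω a c) (r : ℝ) (y : E3) :
    ∀ᵐ x ∂(volume.restrict (truncated Ω r)), remainderKernel a x y = kernelExplicit a x y :=
  ae_mono (truncated_le Ω r) (ha.remainderKernel_ae_eq y)

lemma IsCoefficient.setIntegral_remainderKernel (ha : IsCoefficient Ω a c) (r : ℝ) (g : E3 → ℝ)
    (y : E3) : ∫ x in truncated Ω r, remainderKernel a x y * g x
      = ∫ x in truncated Ω r, kernelExplicit a x y * g x := by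
  refine integral_congr_ae ?_
  filter_upwards [ha.remainderKernel_ae_eq_truncated r y] with x hx
  rw [hx]

lemma IsCoefficient.remainderConverges (ha : IsCoefficient Ω a c) (g : weightedSobolev Ω)
    (hg : ∃ r : ℝ, ∀ᵐ x ∂(volume.restrict Ω), r < ‖x‖ → sobolevFun g x = 0) :
    RemainderConverges Ω a (sobolevFun g) := by
  obtain ⟨r, hr⟩ := hg
  -- The function vanishes only where r < |x|, while `truncated` uses an open ball; r + 1 leaves
  -- room.
  have hi : IntegrableOn (sobolevFun g) (truncated Ω (r + 1)) :=
    integrableOn_truncated (memLp_sobolevFun g) (r + 1)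
  refine ae_restrict_of_ae ?_
  filter_upwards [ha.ae_integrableOn_kernel hi] with y hy
  have h2 : IntegrableOn (fun x => remainderKernel a x y * sobolevFun g x)
      (truncated Ω (r + 1)) := by
    refine Integrable.congr hy ?_
    filter_upwards [ha.remainderKernel_ae_eq_truncated (r + 1) y] with x hx
    rw [hx]
  refine h2.of_ae_sdiff_eq_zero ha.isOpen.measurableSet.nullMeasurableSet ?_
  filter_upwards [(ae_restrict_iff' ha.isOpen.measurableSet).1 hr] with x hx hxm
  have hx1 : r < ‖x‖ := by
    by_contra hlt
    refine hxm.2 ⟨hxm.1, mem_ball_zero_iff.2 ?_⟩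
    linarith
  rw [hx hxm.1 hx1, mul_zero]

lemma IsCoefficient.locallyIntegrable_integral_kernel (ha : IsCoefficient Ω a c) {r : ℝ}
    {g : E3 → ℝ} (hg : IntegrableOn g (truncated Ω r)) :
    LocallyIntegrable (fun y => ∫ x in truncated Ω r, remainderKernel a x y * g x) := by
  intro y
  refine ⟨Metric.ball 0 (‖y‖ + 1), Metric.isOpen_ball.mem_nhds
    (mem_ball_zero_iff.2 (lt_add_one _)), ?_⟩
  simp only [ha.setIntegral_remainderKernel]
  exact (ha.integrable_prod_kernel hg (‖y‖ + 1)).integral_prod_left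

lemma integral_mul_kernelExplicit {ψ : E3 → ℝ} (hψ : ContDiff ℝ ∞ ψ) (hs : HasCompactSupport ψ)
    (a : E3 → ℝ) (x : E3) :
    ∫ y, ψ y * kernelExplicit a x y = -(divCoef a x * potential ψ x
      + ∑ i, coef a i x * fderiv ℝ (potential ψ) x (basisVec i)) := by
  have i1 : Integrable (fun y => newton (x - y) * ψ y) := by
    have := (locallyIntegrable_newton.integrable_smul_left_of_hasCompactSupport
      (contDiff_comp_sub hψ x).continuous (hasCompactSupport_comp_sub hs x)).comp_sub_left x
    refine this.congr (Eventually.of_forall fun y => ?_)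
    simp [mul_comm]
  have i2 : ∀ i, Integrable (fun y => newtonGrad (x - y) i * ψ y) := by
    intro i
    have := (LocallyIntegrable.integrable_smul_left_of_hasCompactSupport
      (locallyIntegrable_inner_newtonGrad (basisVec i))
      (contDiff_comp_sub hψ x).continuous (hasCompactSupport_comp_sub hs x)).comp_sub_left x
    refine this.congr (Eventually.of_forall fun y => ?_)
    simp [mul_comm, inner_basisVec]
  have e : ∀ y, ψ y * kernelExplicit a x y = -(divCoef a x * (newton (x - y) * ψ y)
      + ∑ i, coef a i x * (newtonGrad (x - y) i * ψ y)) := by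
    intro y
    rw [kernelExplicit, mul_neg, mul_add, Finset.mul_sum]
    congr 2
    · ring
    · exact Finset.sum_congr rfl fun i _ => by ring
  simp only [e, integral_neg]
  rw [integral_add (i1.const_mul _) (integrable_finsetSum _ fun i _ => (i2 i).const_mul _),
    integral_const_mul, integral_finsetSum _ fun i _ => (i2 i).const_mul _, potential_eq']
  simp only [integral_const_mul, fderiv_potential_eq' hψ hs, inner_basisVec]

/-- Pairing the remainder potential with a test function. -/
lemma IsCoefficient.integral_mul_remainder (ha : IsCoefficient Ω a c) {r : ℝ} {g : E3 → ℝ}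
    (hg : IntegrableOn g (truncated Ω r)) {ψ : E3 → ℝ} (hψ : ContDiff ℝ ∞ ψ)
    (hs : HasCompactSupport ψ) :
    ∫ y, ψ y * ∫ x in truncated Ω r, remainderKernel a x y * g x
      = ∫ x in truncated Ω r, -(divCoef a x * potential ψ x
      + ∑ i, coef a i x * fderiv ℝ (potential ψ) x (basisVec i)) * g x := by
  obtain ⟨M, -, hM⟩ := exists_tsupport_subset_ball hs
  have hz : ∀ y ∉ Metric.ball (0 : E3) M, ψ y = 0 := fun y hy =>
    image_eq_zero_of_notMem_tsupport fun h => hy (hM h)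
  obtain ⟨A, hA⟩ := hs.exists_bound_of_continuous hψ.continuous
  have hint : Integrable (fun p : E3 × E3 => ψ p.1 * (kernelExplicit a p.2 p.1 * g p.2))
      ((volume.restrict (Metric.ball 0 M)).prod (volume.restrict (truncated Ω r))) :=
    (ha.integrable_prod_kernel hg M).bdd_mul
      (hψ.continuous.comp continuous_fst).aestronglyMeasurable
      (Eventually.of_forall fun p => hA p.1)
  have e1 : ∫ y, ψ y * ∫ x in truncated Ω r, remainderKernel a x y * g x
      = ∫ y in Metric.ball 0 M, ∫ x in truncated Ω r, ψ y * (kernelExplicit a x y * g x) := by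
    simp only [ha.setIntegral_remainderKernel, integral_const_mul]
    refine (setIntegral_eq_integral_of_forall_compl_eq_zero fun y hy => ?_).symm
    rw [hz y hy, zero_mul]
  -- After exchanging integrals the inner integral over y is the kernel paired with ψ, that is,
  -- -div(bΦ) at x.
  rw [e1, integral_integral_swap (f := fun y x => ψ y * (kernelExplicit a x y * g x)) hint]
  refine integral_congr_ae (Eventually.of_forall fun x => ?_)
  simp only
  rw [← integral_mul_kernelExplicit hψ hs, ← integral_mul_const]
  rw [setIntegral_eq_integral_of_forall_compl_eq_zero fun y hy => by rw [hz y hy, zero_mul]]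
  simp only [mul_assoc]

end KernelIntegrals

/-! ### Solution operators for the far and near parts of the right-hand side -/

section RemainderOperators

variable {Ω : Set E3} {a : E3 → ℝ} {c : ℝ}

/-- The vector field `a⁻¹ ∇a`. -/
def logGrad (a : E3 → ℝ) (x : E3) : E3 := (1 / a x) • gradient a x

lemma logGrad_apply (a : E3 → ℝ) (x : E3) (i : Fin 3) : logGrad a x i = coef a i x := by
  rw [logGrad, PiLp.smul_apply, gradient_apply]
  rfl

lemma inner_logGrad (a : E3 → ℝ) (x v : E3) : inner ℝ (logGrad a x) v = ∑ i, coef a i x * v i := by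
  simp only [inner_eq_sum, logGrad_apply]

lemma norm_le_sum_norm (v : E3) : ‖v‖ ≤ ∑ i, ‖v i‖ := by
  refine abs_le_of_sq_le_sq' ?_ (Finset.sum_nonneg fun i _ => norm_nonneg _) |>.2
  rw [norm_sq_eq_sum]
  refine le_trans (le_of_eq ?_)
    (Finset.sum_sq_le_sq_sum_of_nonneg fun i _ => norm_nonneg (v i))
  simp

lemma IsCoefficient.continuousOn_logGrad (ha : IsCoefficient Ω a c) :
    ContinuousOn (logGrad a) Ω := by
  have h : Continuous (gradient a) :=
    (InnerProductSpace.toDual ℝ E3).symm.continuous.comp (ha.contDiff.continuous_fderiv (by simp))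
  exact (continuousOn_const.div ha.contDiff.continuous.continuousOn fun x hx => ha.ne_zero hx).smul
    h.continuousOn

lemma IsCoefficient.norm_logGrad_le (ha : IsCoefficient Ω a c) {x : E3} (hx : x ∈ Ω) :
    ‖logGrad a x‖ ≤ c⁻¹ * ‖gradient a x‖ := by
  rw [logGrad, norm_smul]
  exact mul_le_mul_of_nonneg_right (ha.norm_inv_le hx) (norm_nonneg _)

/-- Multiplication by a bounded coefficient. -/
lemma exists_lpMul_of_bound {F F' : Type*} [NormedAddCommGroup F] [NormedSpace ℝ F]
    [NormedAddCommGroup F'] [NormedSpace ℝ F'] {μ : Measure E3} {m : E3 → F →L[ℝ] F'}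
    (hm : AEStronglyMeasurable m μ) {C : ℝ} (hC : 0 ≤ C) (hb : ∀ᵐ x ∂μ, ‖m x‖ ≤ C) :
    ∃ M : Lp F 2 μ →L[ℝ] Lp F' 2 μ, ∀ f, M f =ᵐ[μ] fun x => m x (f x) := by
  refine ⟨lpMul μ μ m C hC hm Measure.AbsolutelyContinuous.rfl fun f _ => ?_,
    fun f => coeFn_lpMul _ _ _ _ f⟩
  refine eLpNorm_le_mul_eLpNorm_of_ae_le_mul ?_ 2
  filter_upwards [hb] with x hx
  exact ((m x).le_opNorm _).trans (mul_le_mul_of_nonneg_right hx (norm_nonneg _))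

/-- The multiplication `G ↦ ω² (1 - χₙ) a⁻¹ ∇a · G`. -/
lemma IsCoefficient.exists_tailMul (ha : IsCoefficient Ω a c) (n : ℕ) {C : ℝ} (hC : 0 ≤ C)
    (hb : ∀ x ∈ Ω, (1 - cutoff n x) * (weight x * ‖logGrad a x‖) ≤ C) :
    ∃ M : Lp E3 2 (volume.restrict Ω) →L[ℝ] Lp ℝ 2 (weightedVolume Ω), ‖M‖ ≤ C ∧
      ∀ G, M G =ᵐ[weightedVolume Ω]
        fun x => weight x ^ 2 * ((1 - cutoff n x) * inner ℝ (logGrad a x) (G x)) := by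
  set m : E3 → E3 →L[ℝ] ℝ := fun x =>
    (weight x ^ 2 * (1 - cutoff n x)) • innerSL ℝ (logGrad a x) with hmdef
  have hm : AEStronglyMeasurable m (weightedVolume Ω) := by
    rw [aestronglyMeasurable_weightedVolume_iff]
    refine ContinuousOn.aestronglyMeasurable ?_ ha.isOpen.measurableSet
    exact ((continuous_weight.pow 2).mul (continuous_const.sub
      (contDiff_cutoff n).continuous)).continuousOn.smul
      ((innerSL ℝ).continuous.comp_continuousOn ha.continuousOn_logGrad)
  have hbd : ∀ f : E3 → E3, AEStronglyMeasurable f (volume.restrict Ω) →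
      eLpNorm (fun x => m x (f x)) 2 (weightedVolume Ω)
        ≤ ENNReal.ofReal C * eLpNorm f 2 (volume.restrict Ω) := by
    intro f _
    rw [eLpNorm_weightedVolume]
    refine eLpNorm_le_mul_eLpNorm_of_ae_le_mul ?_ 2
    filter_upwards [ae_restrict_mem ha.isOpen.measurableSet] with x hx
    have hw := weight_pos x
    have h1 : 0 ≤ 1 - cutoff n x := sub_nonneg.2 (cutoff_le_one n x)
    simp only [hmdef, smul_apply, innerSL_apply_apply, smul_eq_mul, norm_mul, norm_inv, norm_pow,
      Real.norm_of_nonneg hw.le, Real.norm_of_nonneg h1]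
    have h2 := norm_inner_le_norm (𝕜 := ℝ) (logGrad a x) (f x)
    calc (weight x)⁻¹ * (weight x ^ 2 * (1 - cutoff n x) * ‖(inner ℝ (logGrad a x) (f x) : ℝ)‖)
        ≤ (weight x)⁻¹ * (weight x ^ 2 * (1 - cutoff n x) * (‖logGrad a x‖ * ‖f x‖)) := by gcongr
      _ = ((1 - cutoff n x) * (weight x * ‖logGrad a x‖)) * ‖f x‖ := by field_simp
      _ ≤ C * ‖f x‖ := mul_le_mul_of_nonneg_right (hb x hx) (norm_nonneg _)
  refine ⟨lpMul _ _ m C hC hm (weightedVolume_absolutelyContinuous Ω) hbd,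
    norm_lpMul_le _ _ _ _, fun G => ?_⟩
  filter_upwards [coeFn_lpMul hC hm (weightedVolume_absolutelyContinuous Ω) hbd G] with x hx
  rw [hx]
  simp [hmdef, mul_assoc]

lemma sobolevGrad_sobolevRestrict (Ω : Set E3) (p : beppoLevi) :
    sobolevGrad (sobolevRestrict Ω p) =ᵐ[volume.restrict Ω]
      (p : SobolevAmbient Set.univ).snd :=
  ambientRestrict_snd Ω p

lemma opNorm_comp_neg_comp_le {X₁ X₂ X₃ X₄ : Type*} [NormedAddCommGroup X₁] [NormedSpace ℝ X₁]
    [NormedAddCommGroup X₂] [NormedSpace ℝ X₂] [NormedAddCommGroup X₃] [NormedSpace ℝ X₃]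
    [NormedAddCommGroup X₄] [NormedSpace ℝ X₄] (A : X₃ →L[ℝ] X₄) (M : X₂ →L[ℝ] X₃)
    (W : X₁ →L[ℝ] X₂) {C : ℝ} (hM : ‖M‖ ≤ C) : ‖A ∘L (-(M ∘L W))‖ ≤ ‖A‖ * ‖W‖ * C := by
  have h1 := ContinuousLinearMap.opNorm_comp_le A (-(M ∘L W))
  have h2 := ContinuousLinearMap.opNorm_comp_le M W
  rw [norm_neg] at h1
  have h3 : ‖M‖ * ‖W‖ ≤ C * ‖W‖ := mul_le_mul_of_nonneg_right hM (norm_nonneg W)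
  have h4 := mul_le_mul_of_nonneg_left (h2.trans h3) (norm_nonneg A)
  linarith

/-- The operator solving `⟨∇u, ∇k⟩ = ⟨f, V k⟩` for all `k`. -/
def solveAgainst {Y : Type*} [NormedAddCommGroup Y] [InnerProductSpace ℝ Y] [CompleteSpace Y]
    (V : beppoLevi →L[ℝ] Y) : Y →L[ℝ] beppoLevi :=
  dirichletSolve ∘L ContinuousLinearMap.adjoint V

lemma inner_snd_solveAgainst {Y : Type*} [NormedAddCommGroup Y] [InnerProductSpace ℝ Y]
    [CompleteSpace Y] (V : beppoLevi →L[ℝ] Y) (f : Y) (k : beppoLevi) :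
    inner ℝ (solveAgainst V f : SobolevAmbient Set.univ).snd (k : SobolevAmbient Set.univ).snd
      = inner ℝ f (V k) := by
  rw [solveAgainst, ContinuousLinearMap.comp_apply, inner_snd_dirichletSolve,
    ContinuousLinearMap.adjoint_inner_left]

lemma exists_solveAgainst_add {X Y Z : Type*} [NormedAddCommGroup X] [NormedSpace ℝ X]
    [NormedAddCommGroup Y] [InnerProductSpace ℝ Y] [CompleteSpace Y]
    [NormedAddCommGroup Z] [InnerProductSpace ℝ Z] [CompleteSpace Z]
    (V : beppoLevi →L[ℝ] Y) (W : beppoLevi →L[ℝ] Z) (M : X →L[ℝ] Y) (N : X →L[ℝ] Z) :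
    ∃ S : X →L[ℝ] beppoLevi, ∀ (h : X) (k : beppoLevi),
      inner ℝ (S h : SobolevAmbient Set.univ).snd (k : SobolevAmbient Set.univ).snd
        = inner ℝ (M h) (V k) + inner ℝ (N h) (W k) := by
  refine ⟨solveAgainst V ∘L M + solveAgainst W ∘L N, fun h k => ?_⟩
  rw [← inner_snd_solveAgainst, ← inner_snd_solveAgainst]
  exact inner_add_left _ _ _

/-- The function class of an element of `𝓗¹(Ω)`. -/
def sobolevFunL (Ω : Set E3) : weightedSobolev Ω →L[ℝ] Lp ℝ 2 (weightedVolume Ω) :=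
  valueL Ω ∘L (weightedSobolev Ω).subtypeL

/-- The gradient class of an element of `𝓗¹(Ω)`. -/
def sobolevGradL (Ω : Set E3) : weightedSobolev Ω →L[ℝ] Lp E3 2 (volume.restrict Ω) :=
  gradientL Ω ∘L (weightedSobolev Ω).subtypeL

/-- The restriction of the values of an element of the Beppo Levi space to `Ω`. -/
def beppoLeviFun (Ω : Set E3) : beppoLevi →L[ℝ] Lp ℝ 2 (weightedVolume Ω) :=
  sobolevFunL Ω ∘L sobolevRestrict Ω

/-- The restriction of the gradient of an element of the Beppo Levi space to `Ω`. -/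
def beppoLeviGrad (Ω : Set E3) : beppoLevi →L[ℝ] Lp E3 2 (volume.restrict Ω) :=
  sobolevGradL Ω ∘L sobolevRestrict Ω

lemma coeFn_beppoLeviFun (k : beppoLevi) :
    beppoLeviFun Ω k =ᵐ[volume.restrict Ω] (k : SobolevAmbient Set.univ).fst :=
  sobolevFun_sobolevRestrict Ω k

lemma coeFn_beppoLeviGrad (k : beppoLevi) :
    beppoLeviGrad Ω k =ᵐ[volume.restrict Ω] (k : SobolevAmbient Set.univ).snd :=
  sobolevGrad_sobolevRestrict Ω k

/-- The factor ω² cancels the density ω⁻², so an unweighted pairing over Ω becomes an inner product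
in the weighted space. In this form the far part can be fed to `solveAgainst`. -/
lemma inner_weightedVolume {f : E3 → ℝ} {h : E3 → ℝ} {w v : Lp ℝ 2 (weightedVolume Ω)}
    (hw : w =ᵐ[weightedVolume Ω] fun x => weight x ^ 2 * f x)
    (hv : v =ᵐ[volume.restrict Ω] h) : inner ℝ w v = ∫ x in Ω, f x * h x := by
  rw [L2.inner_def, integral_weightedVolume]
  refine integral_congr_ae ?_
  filter_upwards [(absolutelyContinuous_weightedVolume Ω).ae_le hw, hv] with x hx hy
  have hw := (weight_pos x).ne'
  rw [hx, hy]
  simp only [RCLike.inner_apply, conj_trivial]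
  field_simp

/-- The solution operator for the part of the right-hand side supported far away. -/
lemma IsCoefficient.exists_tail (ha : IsCoefficient Ω a c) :
    ∃ K : ℝ, 0 ≤ K ∧ ∀ (n : ℕ) (C : ℝ), 0 ≤ C →
      (∀ x ∈ Ω, (1 - cutoff n x) * (weight x * ‖logGrad a x‖) ≤ C) →
      ∃ S : weightedSobolev Ω →L[ℝ] beppoLevi, ‖S‖ ≤ K * C ∧
        ∀ (g : weightedSobolev Ω) (k : beppoLevi),
          inner ℝ (S g : SobolevAmbient Set.univ).snd (k : SobolevAmbient Set.univ).snd
          = -∫ x in Ω, (1 - cutoff n x) * inner ℝ (logGrad a x) (sobolevGrad g x) *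
              (k : SobolevAmbient Set.univ).fst x := by
  -- This constant depends neither on n nor on C, so shrinking the coefficient bound makes the
  -- operator as small as desired.
  refine ⟨‖solveAgainst (beppoLeviFun Ω)‖ * ‖sobolevGradL Ω‖, by positivity,
    fun n C hC hb => ?_⟩
  obtain ⟨M, hM, hMG⟩ := ha.exists_tailMul n hC hb
  refine ⟨solveAgainst (beppoLeviFun Ω) ∘L (-(M ∘L sobolevGradL Ω)), ?_, fun g k => ?_⟩
  · exact opNorm_comp_neg_comp_le _ _ _ hM
  · rw [ContinuousLinearMap.comp_apply, inner_snd_solveAgainst, neg_apply,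
      ContinuousLinearMap.comp_apply, inner_neg_left,
      inner_weightedVolume (hMG (sobolevGradL Ω g)) (coeFn_beppoLeviFun k)]
    rfl

/-- The divergence of `χₙ a⁻¹ ∇a`. -/
def divCutoffCoef (a : E3 → ℝ) (n : ℕ) (x : E3) : ℝ :=
  cutoff n x * divCoef a x + ∑ i, coef a i x * fderiv ℝ (cutoff n) x (basisVec i)

lemma IsCoefficient.continuousOn_divCutoffCoef (ha : IsCoefficient Ω a c) (n : ℕ) :
    ContinuousOn (divCutoffCoef a n) Ω := by
  refine ((contDiff_cutoff n).continuous.continuousOn.mul ha.continuousOn_divCoef).add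
    (continuousOn_finsetSum _ fun i _ => (ha.continuousOn_coef i).mul ?_)
  exact (continuous_fderiv_apply_of_contDiff (contDiff_cutoff n) _).continuousOn

lemma IsCoefficient.exists_fieldMul (ha : IsCoefficient Ω a c) (n : ℕ) (r : ℝ) :
    ∃ M : Lp ℝ 2 (volume.restrict (truncated Ω r)) →L[ℝ] Lp E3 2 (volume.restrict (truncated Ω r)),
      ∀ h, M h =ᵐ[volume.restrict (truncated Ω r)]
        fun x => h x • cutoff n x • logGrad a x := by
  obtain ⟨C, hC, hb⟩ := ha.exists_bound r
  have hDm : MeasurableSet (truncated Ω r) := ha.isOpen.measurableSet.inter measurableSet_ball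
  refine exists_lpMul_of_bound (μ := volume.restrict (truncated Ω r))
    (m := fun x => (ContinuousLinearMap.toSpanSingleton ℝ (cutoff n x • logGrad a x) : ℝ →L[ℝ] E3))
    (C := ∑ _i : Fin 3, C) ?_ (Finset.sum_nonneg fun _ _ => hC) ?_
  · refine (ContinuousOn.aestronglyMeasurable ?_ ha.isOpen.measurableSet).mono_measure
      (truncated_le Ω r)
    exact (ContinuousLinearMap.toSpanSingletonCLE :
      E3 ≃L[ℝ] (ℝ →L[ℝ] E3)).continuous.comp_continuousOn
      ((contDiff_cutoff n).continuous.continuousOn.smul ha.continuousOn_logGrad)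
  · filter_upwards [ae_restrict_mem hDm] with x hx
    rw [ContinuousLinearMap.norm_toSpanSingleton, norm_smul]
    refine (mul_le_of_le_one_left (norm_nonneg _) (norm_cutoff_le_one n x)).trans ?_
    refine (norm_le_sum_norm _).trans (Finset.sum_le_sum fun i _ => ?_)
    rw [logGrad_apply]
    exact (hb x hx).1 i

lemma IsCoefficient.exists_divMul (ha : IsCoefficient Ω a c) (n : ℕ) (r : ℝ) :
    ∃ M : Lp ℝ 2 (volume.restrict (truncated Ω r)) →L[ℝ] Lp ℝ 2 (volume.restrict (truncated Ω r)),
      ∀ h, M h =ᵐ[volume.restrict (truncated Ω r)]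
        fun x => divCutoffCoef a n x * h x := by
  obtain ⟨C, hC, hb⟩ := ha.exists_bound r
  obtain ⟨C', hC', hb'⟩ := exists_norm_fderiv_cutoff_le
  have hDm : MeasurableSet (truncated Ω r) := ha.isOpen.measurableSet.inter measurableSet_ball
  refine exists_lpMul_of_bound (μ := volume.restrict (truncated Ω r))
    (m := fun x => divCutoffCoef a n x • ContinuousLinearMap.id ℝ ℝ)
    (C := C + ∑ _i : Fin 3, C * C') ?_
    (add_nonneg hC (Finset.sum_nonneg fun _ _ => mul_nonneg hC hC')) ?_
  · exact ((ha.continuousOn_divCutoffCoef n).smul continuousOn_const).aestronglyMeasurable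
      ha.isOpen.measurableSet |>.mono_measure (truncated_le Ω r)
  · filter_upwards [ae_restrict_mem hDm] with x hx
    rw [norm_smul, ContinuousLinearMap.norm_id, mul_one, divCutoffCoef]
    refine (norm_add_le _ _).trans (add_le_add ?_ ?_)
    · rw [norm_mul]
      exact (mul_le_of_le_one_left (norm_nonneg _) (norm_cutoff_le_one n x)).trans (hb x hx).2
    · refine (norm_sum_le _ _).trans (Finset.sum_le_sum fun i _ => ?_)
      rw [norm_mul]
      refine mul_le_mul ((hb x hx).1 i) ((norm_partialDeriv_le _ i x).trans ((hb' n x).trans ?_))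
        (norm_nonneg _) hC
      exact mul_le_of_le_one_right hC' (inv_le_one_of_one_le₀ (one_le_weight x))

/-- The solution operator for the localised part of the right-hand side. -/
lemma IsCoefficient.exists_core (ha : IsCoefficient Ω a c) (n : ℕ) (r : ℝ) :
    ∃ S : Lp ℝ 2 (volume.restrict (truncated Ω r)) →L[ℝ] beppoLevi,
      ∀ (h : Lp ℝ 2 (volume.restrict (truncated Ω r))) (k : beppoLevi),
        inner ℝ (S h : SobolevAmbient Set.univ).snd (k : SobolevAmbient Set.univ).snd
        = ∫ x in truncated Ω r, h x * (divCutoffCoef a n x * (k : SobolevAmbient Set.univ).fst x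
          + cutoff n x * inner ℝ (logGrad a x) ((k : SobolevAmbient Set.univ).snd x)) := by
  obtain ⟨M₁, hM₁⟩ := ha.exists_fieldMul n r
  obtain ⟨M₂, hM₂⟩ := ha.exists_divMul n r
  have hmono := truncated_le Ω r
  -- The density h div(χ_n b) is paired with k and the field h χ_n b with ∇k. Here h is merely in L²
  -- of the truncated set, which allows factorisation through a compact map.
  obtain ⟨S, hS⟩ := exists_solveAgainst_add (restrictTruncated Ω r ∘L beppoLeviFun Ω)
    (lpMono hmono ∘L beppoLeviGrad Ω) M₂ M₁
  refine ⟨S, fun h k => ?_⟩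
  rw [hS]
  have hV : (restrictTruncated Ω r ∘L beppoLeviFun Ω) k
      =ᵐ[volume.restrict (truncated Ω r)] (k : SobolevAmbient Set.univ).fst :=
    (coeFn_restrictTruncated Ω r _).trans (ae_mono hmono (coeFn_beppoLeviFun k))
  have hW : (lpMono hmono ∘L beppoLeviGrad Ω) k
      =ᵐ[volume.restrict (truncated Ω r)] (k : SobolevAmbient Set.univ).snd :=
    (coeFn_lpMono hmono _).trans (ae_mono hmono (coeFn_beppoLeviGrad k))
  generalize (restrictTruncated Ω r ∘L beppoLeviFun Ω) k = v at hV ⊢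
  generalize (lpMono hmono ∘L beppoLeviGrad Ω) k = w at hW ⊢
  rw [L2.inner_def, L2.inner_def,
    ← integral_add (L2.integrable_inner _ _) (L2.integrable_inner _ _)]
  refine integral_congr_ae ?_
  filter_upwards [hM₁ h, hM₂ h, hV, hW] with x h1 h2 h3 h4
  rw [h1, h2, h3, h4]
  simp only [real_inner_smul_left, RCLike.inner_apply, conj_trivial]
  ring

end RemainderOperators

/-! ### Coefficients whose products with integrable functions on bounded parts are integrable -/

section LocallyBounded

/-- Continuity on `Ω` together with boundedness on the bounded parts of `Ω`. -/
def TameOn (Ω : Set E3) (p : E3 → ℝ) : Prop :=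
  ContinuousOn p Ω ∧ ∀ r : ℝ, ∃ C : ℝ, ∀ x ∈ truncated Ω r, ‖p x‖ ≤ C

variable {Ω : Set E3} {a p q : E3 → ℝ} {c : ℝ}

lemma Continuous.tameOn (hp : Continuous p) : TameOn Ω p := by
  refine ⟨hp.continuousOn, fun r => ?_⟩
  obtain ⟨C, hC⟩ := (isCompact_closedBall (0 : E3) r).exists_bound_of_continuousOn hp.continuousOn
  exact ⟨C, fun x hx => hC x (Metric.ball_subset_closedBall hx.2)⟩

lemma TameOn.add (hp : TameOn Ω p) (hq : TameOn Ω q) : TameOn Ω (fun x => p x + q x) := by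
  refine ⟨hp.1.add hq.1, fun r => ?_⟩
  obtain ⟨C, hC⟩ := hp.2 r
  obtain ⟨C', hC'⟩ := hq.2 r
  exact ⟨C + C', fun x hx => norm_add_le_of_le (hC x hx) (hC' x hx)⟩

lemma TameOn.mul (hp : TameOn Ω p) (hq : TameOn Ω q) : TameOn Ω (fun x => p x * q x) := by
  refine ⟨hp.1.mul hq.1, fun r => ?_⟩
  obtain ⟨C, hC⟩ := hp.2 r
  obtain ⟨C', hC'⟩ := hq.2 r
  refine ⟨C * C', fun x hx => ?_⟩
  rw [norm_mul]
  exact mul_le_mul (hC x hx) (hC' x hx) (norm_nonneg _) ((norm_nonneg _).trans (hC x hx))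

lemma TameOn.neg (hp : TameOn Ω p) : TameOn Ω (fun x => -p x) := by
  refine ⟨hp.1.neg, fun r => ?_⟩
  obtain ⟨C, hC⟩ := hp.2 r
  exact ⟨C, fun x hx => by rw [norm_neg]; exact hC x hx⟩

lemma TameOn.sum {p : Fin 3 → E3 → ℝ} (hp : ∀ i, TameOn Ω (p i)) :
    TameOn Ω (fun x => ∑ i, p i x) := by
  refine ⟨continuousOn_finsetSum _ fun i _ => (hp i).1, fun r => ?_⟩
  choose C hC using fun i => (hp i).2 r
  exact ⟨∑ i, C i, fun x hx => norm_sum_le_of_le _ fun i _ => hC i x hx⟩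

lemma IsCoefficient.tameOn_coef (ha : IsCoefficient Ω a c) (i : Fin 3) : TameOn Ω (coef a i) :=
  ⟨ha.continuousOn_coef i, fun r =>
    let ⟨C, _, hC⟩ := ha.exists_bound r
    ⟨C, fun x hx => (hC x hx).1 i⟩⟩

lemma IsCoefficient.tameOn_divCoef (ha : IsCoefficient Ω a c) : TameOn Ω (divCoef a) :=
  ⟨ha.continuousOn_divCoef, fun r =>
    let ⟨C, _, hC⟩ := ha.exists_bound r
    ⟨C, fun x hx => (hC x hx).2⟩⟩

lemma TameOn.integrableOn_mul (hΩ : IsOpen Ω) (hp : TameOn Ω p) {h : E3 → ℝ} {r : ℝ}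
    (hh : IntegrableOn h (truncated Ω r)) :
    IntegrableOn (fun x => p x * h x) (truncated Ω r) := by
  obtain ⟨C, hC⟩ := hp.2 r
  refine hh.bdd_mul ((hp.1.aestronglyMeasurable hΩ.measurableSet).mono_measure
    (truncated_le Ω r)) (c := C) ?_
  filter_upwards [ae_restrict_mem (hΩ.measurableSet.inter measurableSet_ball)] with x hx
  exact hC x hx

end LocallyBounded

/-! ### The variational solution equals the remainder integral -/

section Representation

variable {Ω : Set E3} {a : E3 → ℝ} {c : ℝ}

lemma sobolevCutoff_ae_eq_zero (m : ℕ) (g : weightedSobolev Ω) :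
    ∀ᵐ x ∂(volume.restrict Ω), 2 * ((m : ℝ) + 1) ≤ ‖x‖ →
      sobolevFun (sobolevCutoff m g) x = 0 := by
  filter_upwards [sobolevFun_sobolevCutoff m g] with x hx h
  rw [hx, cutoff_eq_zero h, zero_mul]

lemma sobolevGrad_sobolevCutoff_ae_eq_zero (m : ℕ) (g : weightedSobolev Ω) :
    ∀ᵐ x ∂(volume.restrict Ω), 2 * ((m : ℝ) + 1) < ‖x‖ →
      sobolevGrad (sobolevCutoff m g) x = 0 := by
  filter_upwards [sobolevGrad_sobolevCutoff m g] with x hx h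
  rw [hx, cutoffGrad, cutoff_eq_zero h.le, zero_smul, gradient, fderiv_cutoff_eq_zero (Or.inr h),
    map_zero, smul_zero, add_zero]

lemma setIntegral_eq_truncated_of_ae (hΩ : IsOpen Ω) {h p : E3 → ℝ} {r : ℝ}
    (hh : ∀ᵐ x ∂(volume.restrict Ω), r ≤ ‖x‖ → h x = 0) :
    ∫ x in Ω, p x * h x = ∫ x in truncated Ω r, p x * h x := by
  refine setIntegral_eq_of_subset_of_ae_sdiff_eq_zero hΩ.measurableSet.nullMeasurableSet
    Set.inter_subset_left ?_
  filter_upwards [(ae_restrict_iff' hΩ.measurableSet).1 hh] with x hx hxm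
  rw [hx hxm.1, mul_zero]
  by_contra hlt
  exact hxm.2 ⟨hxm.1, mem_ball_zero_iff.2 (not_le.1 hlt)⟩

/-- The components of `χ_M (1 - χₙ) Φ a⁻¹ ∇a`. -/
def tailField (a Φ : E3 → ℝ) (n M : ℕ) (i : Fin 3) (x : E3) : ℝ :=
  cutoff M x * ((1 - cutoff n x) * coef a i x * Φ x)

lemma tailField_eq_zero {a Φ : E3 → ℝ} {n M : ℕ} {i : Fin 3} {x : E3} (hx : ‖x‖ ≤ n + 1) :
    tailField a Φ n M i x = 0 := by
  rw [tailField, cutoff_eq_one hx]; ring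

/-- The field b is differentiable only in Ω, but 1 - χ_n vanishes on an open ball containing the
complement, so the product extends by zero as a C¹ function. The same vanishing puts its support
inside Ω and removes boundary terms. -/
lemma IsCoefficient.contDiff_tailField (ha : IsCoefficient Ω a c) {n : ℕ}
    (hn : Ωᶜ ⊆ Metric.ball 0 (n + 1)) {Φ : E3 → ℝ} (hΦ : ContDiff ℝ ∞ Φ) (M : ℕ) (i : Fin 3) :
    ContDiff ℝ 1 (tailField a Φ n M i) := by
  rw [contDiff_iff_contDiffAt]
  intro x
  by_cases hx : x ∈ Ω
  · have hc : ∀ k, ContDiffAt ℝ 1 (cutoff k) x := fun k =>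
      ((contDiff_cutoff k).of_le (by simp)).contDiffAt
    exact (hc M).mul (((contDiffAt_const.sub (hc n)).mul (ha.contDiffAt_coef hx i)).mul
      (hΦ.of_le (by simp)).contDiffAt)
  · refine (contDiffAt_const (c := (0 : ℝ))).congr_of_eventuallyEq ?_
    filter_upwards [Metric.isOpen_ball.mem_nhds (hn hx)] with y hy
    exact tailField_eq_zero (mem_ball_zero_iff.1 hy).le

lemma hasCompactSupport_tailField (a Φ : E3 → ℝ) (n M : ℕ) (i : Fin 3) :
    HasCompactSupport (tailField a Φ n M i) :=
  (hasCompactSupport_cutoff M).mul_right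

lemma tsupport_tailField_subset {n : ℕ} (hn : Ωᶜ ⊆ Metric.ball 0 (n + 1)) (a Φ : E3 → ℝ) (M : ℕ)
    (i : Fin 3) : tsupport (tailField a Φ n M i) ⊆ Ω := by
  have h1 : tsupport (tailField a Φ n M i) ⊆ (Metric.ball 0 (n + 1))ᶜ := by
    refine closure_minimal ?_ Metric.isOpen_ball.isClosed_compl
    intro x hx hb
    exact hx (tailField_eq_zero (mem_ball_zero_iff.1 hb).le)
  exact h1.trans (Set.compl_subset_comm.1 hn)

lemma IsCoefficient.fderiv_tailField (ha : IsCoefficient Ω a c) {n M : ℕ} {Φ : E3 → ℝ}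
    (hΦ : ContDiff ℝ ∞ Φ) (i : Fin 3) {x : E3} (hx : x ∈ Ω) (hM : ‖x‖ < M + 1) :
    fderiv ℝ (tailField a Φ n M i) x (basisVec i)
      = (1 - cutoff n x) * (partialDeriv i (coef a i) x * Φ x
          + coef a i x * fderiv ℝ Φ x (basisVec i))
        - coef a i x * fderiv ℝ (cutoff n) x (basisVec i) * Φ x := by
  have e : tailField a Φ n M i =ᶠ[𝓝 x] fun y => (1 - cutoff n y) * coef a i y * Φ y := by
    filter_upwards [(isOpen_lt continuous_norm continuous_const).mem_nhds hM] with y hy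
    rw [tailField, cutoff_eq_one (le_of_lt hy), one_mul]
  have h1 := (((contDiff_cutoff n).differentiable (by simp) x).hasFDerivAt).const_sub 1
  have h2 := ((ha.contDiffAt_coef hx i).differentiableAt (by simp)).hasFDerivAt
  have h3 := (hΦ.differentiable (by simp) x).hasFDerivAt
  rw [e.fderiv_eq, ((h1.fun_mul h2).fun_mul h3).fderiv]
  simp only [add_apply, smul_apply, neg_apply, smul_eq_mul]
  change _ = (1 - cutoff n x) * (fderiv ℝ (coef a i) x (basisVec i) * Φ x + _) - _
  ring

/-- Integration by parts in the part of the bilinear form supported far away. -/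
lemma IsCoefficient.integral_tail (ha : IsCoefficient Ω a c) {n : ℕ}
    (hn : Ωᶜ ⊆ Metric.ball 0 (n + 1)) (m : ℕ) (g : weightedSobolev Ω) {Φ : E3 → ℝ}
    (hΦ : ContDiff ℝ ∞ Φ) :
    ∫ x in Ω, (1 - cutoff n x) * inner ℝ (logGrad a x) (sobolevGrad (sobolevCutoff m g) x) * Φ x
      = -∫ x in Ω, ((1 - cutoff n x) * (divCoef a x * Φ x
          + ∑ i, coef a i x * fderiv ℝ Φ x (basisVec i))
        - (∑ i, coef a i x * fderiv ℝ (cutoff n) x (basisVec i)) * Φ x)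
          * sobolevFun (sobolevCutoff m g) x := by
  set h := sobolevCutoff m g with hh
  -- With this M the cutoff χ_M equals 1 for |x| ≤ M + 1, hence on a neighbourhood of the support of
  -- χ_m; it provides compact support without changing the integrals.
  set M : ℕ := 2 * (m + 1) with hM
  have hMr : (M : ℝ) = 2 * ((m : ℝ) + 1) := by rw [hM]; push_cast; ring
  have hf := fun i => ha.contDiff_tailField hn hΦ M i
  have hs := fun i => hasCompactSupport_tailField a Φ n M i
  -- The tail field is only C¹, as b is, so the weak gradient is tested against C¹ functions.
  have key : ∀ i, ∫ x in Ω, fderiv ℝ (tailField a Φ n M i) x (basisVec i) * sobolevFun h x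
      = -∫ x in Ω, tailField a Φ n M i x * inner ℝ (sobolevGrad h x) (basisVec i) := fun i =>
    (isWeakGradient_sobolev h).integral_fderiv_mul ha.isOpen (memLp_sobolevFun h)
      (memLp_sobolevGrad h) (hf i) (hs i) (tsupport_tailField_subset hn a Φ M i) _
  have i1 : ∀ i, IntegrableOn (fun x => fderiv ℝ (tailField a Φ n M i) x (basisVec i)
      * sobolevFun h x) Ω := fun i =>
    integrable_mul_of_memLp_weightedVolume (memLp_sobolevFun h)
      (((hf i).continuous_fderiv (by simp)).clm_apply continuous_const)
      ((hs i).fderiv_apply ℝ _)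
  have i2 : ∀ i, IntegrableOn (fun x => tailField a Φ n M i x
      * inner ℝ (sobolevGrad h x) (basisVec i)) Ω := fun i =>
    integrable_mul_inner_of_memLp (memLp_sobolevGrad h) (hf i).continuous (hs i) _
  have e1 : ∫ x in Ω, (1 - cutoff n x) * inner ℝ (logGrad a x) (sobolevGrad h x) * Φ x
      = ∫ x in Ω, ∑ i, tailField a Φ n M i x * inner ℝ (sobolevGrad h x) (basisVec i) := by
    refine integral_congr_ae ?_
    filter_upwards [sobolevGrad_sobolevCutoff_ae_eq_zero m g] with x hx
    rw [← hh] at hx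
    rcases le_or_gt ‖x‖ (2 * ((m : ℝ) + 1)) with hle | hlt
    · have : cutoff M x = 1 := cutoff_eq_one (by linarith)
      simp only [tailField, this, one_mul, inner_logGrad, inner_basisVec]
      rw [Finset.mul_sum, Finset.sum_mul]
      exact Finset.sum_congr rfl fun i _ => by ring
    · simp [hx hlt]
  have e2 : ∫ x in Ω, ((1 - cutoff n x) * (divCoef a x * Φ x
          + ∑ i, coef a i x * fderiv ℝ Φ x (basisVec i))
        - (∑ i, coef a i x * fderiv ℝ (cutoff n) x (basisVec i)) * Φ x) * sobolevFun h x
      = ∫ x in Ω, ∑ i, fderiv ℝ (tailField a Φ n M i) x (basisVec i) * sobolevFun h x := by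
    refine integral_congr_ae ?_
    filter_upwards [sobolevCutoff_ae_eq_zero m g, ae_restrict_mem ha.isOpen.measurableSet]
      with x hx hxΩ
    rw [← hh] at hx
    rcases lt_or_ge ‖x‖ (2 * ((m : ℝ) + 1)) with hlt | hle
    · rw [← Finset.sum_mul]
      congr 1
      simp only [ha.fderiv_tailField hΦ _ hxΩ (show ‖x‖ < M + 1 by linarith)]
      rw [Finset.sum_sub_distrib, ← Finset.mul_sum, Finset.sum_add_distrib, ← Finset.sum_mul,
        ← Finset.sum_mul]
      rfl
    · simp [hx hle]
  rw [e1, e2, integral_finsetSum _ fun i _ => i2 i, integral_finsetSum _ fun i _ => i1 i,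
    ← Finset.sum_neg_distrib]
  exact Finset.sum_congr rfl fun i _ => by rw [key i, neg_neg]

lemma divCutoffCoef_eq_zero {a : E3 → ℝ} {n : ℕ} {x : E3} (hx : 2 * ((n : ℝ) + 1) < ‖x‖) :
    divCutoffCoef a n x = 0 := by
  simp [divCutoffCoef, cutoff_eq_zero hx.le, fderiv_cutoff_eq_zero (Or.inr hx)]

lemma locallyIntegrable_fst (u : SobolevAmbient Set.univ) : LocallyIntegrable u.fst := by
  intro x
  refine ⟨truncated Set.univ (‖x‖ + 1), ?_, integrableOn_truncated (Lp.memLp u.fst) _⟩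
  rw [truncated, Set.univ_inter]
  exact Metric.isOpen_ball.mem_nhds (mem_ball_zero_iff.2 (lt_add_one _))

/-- The variational solution is the remainder potential. -/
lemma IsCoefficient.solution_ae_eq (ha : IsCoefficient Ω a c) {n : ℕ}
    (hn : Ωᶜ ⊆ Metric.ball 0 (n + 1)) (m : ℕ) (g : weightedSobolev Ω) (u : beppoLevi)
    (hu : ∀ k : beppoLevi,
      inner ℝ (u : SobolevAmbient Set.univ).snd (k : SobolevAmbient Set.univ).snd
      = (-∫ x in Ω, (1 - cutoff n x) *
          inner ℝ (logGrad a x) (sobolevGrad (sobolevCutoff m g) x) *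
            (k : SobolevAmbient Set.univ).fst x)
        + ∫ x in truncated Ω (2 * (n + 1) + 1), sobolevFun (sobolevCutoff m g) x *
            (divCutoffCoef a n x * (k : SobolevAmbient Set.univ).fst x
            + cutoff n x * inner ℝ (logGrad a x) ((k : SobolevAmbient Set.univ).snd x))) :
    (u : SobolevAmbient Set.univ).fst =ᵐ[volume]
      fun y => ∫ x in Ω, remainderKernel a x y * sobolevFun (sobolevCutoff m g) x := by
  set h := sobolevCutoff m g with hh
  set r : ℝ := 2 * ((m : ℝ) + 1) with hr
  have hz : ∀ᵐ x ∂(volume.restrict Ω), r ≤ ‖x‖ → sobolevFun h x = 0 :=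
    sobolevCutoff_ae_eq_zero m g
  have hhi : IntegrableOn (sobolevFun h) (truncated Ω r) :=
    integrableOn_truncated (memLp_sobolevFun h) r
  have eF : (fun y => ∫ x in Ω, remainderKernel a x y * sobolevFun h x)
      = fun y => ∫ x in truncated Ω r, remainderKernel a x y * sobolevFun h x :=
    funext fun y => setIntegral_eq_truncated_of_ae ha.isOpen hz
  rw [eF]
  -- Both sides are locally integrable on the whole space, so it suffices to pair them with every
  -- test function ψ.
  refine ae_eq_of_integral_contDiff_smul_eq (locallyIntegrable_fst _)
    (ha.locallyIntegrable_integral_kernel hhi) fun ψ hψ hs => ?_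
  simp only [smul_eq_mul]
  set Φ := potential ψ with hΦdef
  have hΦ : ContDiff ℝ ∞ Φ := contDiff_potential hψ hs
  have hk1 := ambientOf_fst (memLp_potential hψ hs) (memLp_gradient_potential hψ hs)
  have hk2 := ambientOf_snd (memLp_potential hψ hs) (memLp_gradient_potential hψ hs)
  have hmono : (volume : Measure E3).restrict Ω ≤ volume.restrict Set.univ :=
    Measure.restrict_mono_set _ (Set.subset_univ Ω)
  have hD : MeasurableSet (truncated Ω (2 * ((n : ℝ) + 1) + 1)) :=
    ha.isOpen.measurableSet.inter measurableSet_ball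
  have A : ∫ x in Ω, (1 - cutoff n x) * inner ℝ (logGrad a x) (sobolevGrad h x) *
      (potentialElement hψ hs : SobolevAmbient Set.univ).fst x
      = ∫ x in Ω, (1 - cutoff n x) * inner ℝ (logGrad a x) (sobolevGrad h x) * Φ x := by
    refine integral_congr_ae ?_
    filter_upwards [ae_mono hmono hk1] with x hx
    congr 1
  have B : ∫ x in truncated Ω (2 * (n + 1) + 1), sobolevFun h x *
        (divCutoffCoef a n x * (potentialElement hψ hs : SobolevAmbient Set.univ).fst x
        + cutoff n x * inner ℝ (logGrad a x)
          ((potentialElement hψ hs : SobolevAmbient Set.univ).snd x))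
      = ∫ x in truncated Ω r, (divCutoffCoef a n x * Φ x
        + cutoff n x * ∑ i, coef a i x * fderiv ℝ Φ x (basisVec i)) * sobolevFun h x := by
    rw [← setIntegral_eq_truncated_of_ae ha.isOpen hz]
    rw [setIntegral_eq_of_subset_of_forall_sdiff_eq_zero ha.isOpen.measurableSet
      (s := truncated Ω (2 * ((n : ℝ) + 1) + 1)) Set.inter_subset_left]
    · refine integral_congr_ae ?_
      filter_upwards [ae_mono ((truncated_le Ω _).trans hmono) hk1,
        ae_mono ((truncated_le Ω _).trans hmono) hk2] with x h1 h2
      have h1' : (potentialElement hψ hs : SobolevAmbient Set.univ).fst x = Φ x := h1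
      have h2' : (potentialElement hψ hs : SobolevAmbient Set.univ).snd x = gradient Φ x := h2
      rw [h1', h2', inner_logGrad]
      simp only [gradient_apply]
      ring
    · intro x hx
      -- The truncation radius exceeds 2(n+1) by 1, so outside it |x| > 2(n+1) strictly and ∇χ_n
      -- vanishes together with χ_n.
      have hlt : 2 * ((n : ℝ) + 1) < ‖x‖ := by
        by_contra hle
        exact hx.2 ⟨hx.1, mem_ball_zero_iff.2 (by linarith)⟩
      rw [divCutoffCoef_eq_zero hlt, cutoff_eq_zero hlt.le]
      ring
  -- The choice k = Φ turns the left side into -∫ ψu; the far part is integrated by parts back onto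
  -- the coefficient.
  have hK := hu (potentialElement hψ hs)
  rw [inner_snd_potentialElement, A, B, ha.integral_tail hn m g hΦ, neg_neg,
    setIntegral_eq_truncated_of_ae ha.isOpen hz] at hK
  have tΦ : TameOn Ω Φ := Continuous.tameOn hΦ.continuous
  have td : TameOn Ω (fun x => ∑ i, coef a i x * fderiv ℝ Φ x (basisVec i)) :=
    TameOn.sum fun i => (ha.tameOn_coef i).mul
      (Continuous.tameOn (continuous_fderiv_apply_of_contDiff hΦ _))
  have tχ : TameOn Ω (cutoff n) := Continuous.tameOn (contDiff_cutoff n).continuous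
  have te : TameOn Ω (fun x => ∑ i, coef a i x * fderiv ℝ (cutoff n) x (basisVec i)) :=
    TameOn.sum fun i => (ha.tameOn_coef i).mul
      (Continuous.tameOn (continuous_fderiv_apply_of_contDiff (contDiff_cutoff n) _))
  have t1 : TameOn Ω (fun x => (1 + -cutoff n x) * (divCoef a x * Φ x
          + ∑ i, coef a i x * fderiv ℝ Φ x (basisVec i))
        + -((∑ i, coef a i x * fderiv ℝ (cutoff n) x (basisVec i)) * Φ x)) :=
    (((Continuous.tameOn continuous_const).add tχ.neg).mul
      ((ha.tameOn_divCoef.mul tΦ).add td)).add (te.mul tΦ).neg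
  have t2 : TameOn Ω (fun x => divCutoffCoef a n x * Φ x
        + cutoff n x * ∑ i, coef a i x * fderiv ℝ Φ x (basisVec i)) :=
    (((tχ.mul ha.tameOn_divCoef).add te).mul tΦ).add (tχ.mul td)
  simp only [← sub_eq_add_neg] at t1
  -- In the sum the two terms with ∇χ_n cancel and the factors 1 - χ_n and χ_n add to 1. What
  -- remains is the integral of g div(bΦ), independent of n.
  rw [← integral_add (t1.integrableOn_mul ha.isOpen hhi) (t2.integrableOn_mul ha.isOpen hhi),
    neg_eq_iff_eq_neg, ← integral_neg] at hK
  rw [hK, ha.integral_mul_remainder hhi hψ hs]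
  refine integral_congr_ae (Eventually.of_forall fun x => ?_)
  simp only [divCutoffCoef]
  ring

end Representation

/-! ### Small plus compact decomposition of the remainder potential -/

section Decomposition

variable {Ω : Set E3} {a : E3 → ℝ} {c : ℝ}

/-- The restriction `𝓗¹(Ω) → L²(Ω ∩ B(0, r))`. -/
def sobolevToTruncated (Ω : Set E3) (r : ℝ) :
    weightedSobolev Ω →L[ℝ] Lp ℝ 2 (volume.restrict (truncated Ω r)) :=
  restrictTruncated Ω r ∘L sobolevFunL Ω

lemma coeFn_sobolevToTruncated (r : ℝ) (g : weightedSobolev Ω) :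
    sobolevToTruncated Ω r g =ᵐ[volume.restrict (truncated Ω r)] sobolevFun g :=
  coeFn_restrictTruncated Ω r _

/-- Where 1 - χ_n is nonzero, |x| > n + 1, and there ω|∇a| < cδ by the decay hypothesis; the bound
1/a ≤ c⁻¹ removes c. The same n is taken large enough for the ball to contain the complement of Ω.
-/
lemma IsCoefficient.exists_cutoff_small (ha : IsCoefficient Ω a c)
    (hbd : Bornology.IsBounded Ωᶜ)
    (hdecay : Tendsto (fun x => weight x • gradient a x) (cocompact E3) (𝓝 0)) {δ : ℝ}
    (hδ : 0 < δ) :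
    ∃ n : ℕ, Ωᶜ ⊆ Metric.ball 0 (n + 1) ∧
      ∀ x ∈ Ω, (1 - cutoff n x) * (weight x * ‖logGrad a x‖) ≤ δ := by
  have hc := ha.pos
  obtain ⟨R₁, hR₁⟩ := hbd.exists_norm_le
  have h1 : ∀ᶠ x in cocompact E3, ‖weight x • gradient a x‖ < c * δ := by
    have := hdecay.norm
    rw [norm_zero] at this
    exact this.eventually (gt_mem_nhds (by positivity))
  rw [← Metric.cobounded_eq_cocompact, ← comap_norm_atTop, eventually_comap] at h1
  obtain ⟨R₂, hR₂⟩ := eventually_atTop.1 h1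
  obtain ⟨n, hn⟩ := exists_nat_ge (max R₁ R₂)
  refine ⟨n, fun x hx => mem_ball_zero_iff.2 ?_, fun x hx => ?_⟩
  · have := hR₁ x hx
    have := (le_max_left R₁ R₂).trans hn
    linarith
  · rcases le_or_gt ‖x‖ (n + 1) with h | h
    · rw [cutoff_eq_one h, sub_self, zero_mul]
      exact hδ.le
    · have hx2 := hR₂ ‖x‖ (by have := (le_max_right R₁ R₂).trans hn; linarith) x rfl
      have hw := weight_pos x
      rw [norm_smul, Real.norm_of_nonneg hw.le] at hx2
      have h2 : 1 - cutoff n x ≤ 1 := by linarith [cutoff_nonneg n x]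
      calc (1 - cutoff n x) * (weight x * ‖logGrad a x‖)
          ≤ 1 * (weight x * ‖logGrad a x‖) := by gcongr
        _ ≤ weight x * (c⁻¹ * ‖gradient a x‖) := by
            rw [one_mul]; exact mul_le_mul_of_nonneg_left (ha.norm_logGrad_le hx) hw.le
        _ = c⁻¹ * (weight x * ‖gradient a x‖) := by ring
        _ ≤ c⁻¹ * (c * δ) := by gcongr
        _ = δ := by field_simp

/-- The variational solution operator is the remainder potential. -/
lemma IsCoefficient.isRemainderPotential (ha : IsCoefficient Ω a c) {n : ℕ}
    (hn : Ωᶜ ⊆ Metric.ball 0 (n + 1)) {P : weightedSobolev Ω →L[ℝ] beppoLevi}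
    (hP : ∀ (h : weightedSobolev Ω) (k : beppoLevi),
      inner ℝ (P h : SobolevAmbient Set.univ).snd (k : SobolevAmbient Set.univ).snd
      = (-∫ x in Ω, (1 - cutoff n x) * inner ℝ (logGrad a x) (sobolevGrad h x) *
            (k : SobolevAmbient Set.univ).fst x)
        + ∫ x in truncated Ω (2 * (n + 1) + 1), sobolevFun h x *
            (divCutoffCoef a n x * (k : SobolevAmbient Set.univ).fst x
            + cutoff n x * inner ℝ (logGrad a x) ((k : SobolevAmbient Set.univ).snd x)))
    {T : weightedSobolev Ω →L[ℝ] weightedSobolev Ω}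
    (hT : ∀ h, T h = sobolevRestrict Ω (P h)) : IsRemainderPotential Ω a T := by
  refine isRemainderPotential_of_cutoff ha.remainderConverges fun g m => ?_
  have hsol := ha.solution_ae_eq hn m g (P (sobolevCutoff m g)) fun k => hP _ k
  rw [hT]
  filter_upwards [sobolevFun_sobolevRestrict Ω (P (sobolevCutoff m g)),
    ae_restrict_of_ae hsol] with y h1 h2
  rw [h1, h2]
  refine integral_congr_ae ?_
  filter_upwards [sobolevFun_sobolevCutoff m g] with x hx
  rw [hx]

lemma opNorm_comp_lt {X Y Z : Type*} [NormedAddCommGroup X] [NormedSpace ℝ X]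
    [NormedAddCommGroup Y] [NormedSpace ℝ Y] [NormedAddCommGroup Z] [NormedSpace ℝ Z]
    (A : Y →L[ℝ] Z) (S : X →L[ℝ] Y) {K ε : ℝ} (hK : 0 ≤ K) (hε : 0 < ε)
    (hS : ‖S‖ ≤ K * (ε / (‖A‖ * K + 1))) : ‖A ∘L S‖ < ε := by
  have hA := norm_nonneg A
  calc ‖A ∘L S‖ ≤ ‖A‖ * ‖S‖ := ContinuousLinearMap.opNorm_comp_le _ _
    _ ≤ ‖A‖ * (K * (ε / (‖A‖ * K + 1))) := mul_le_mul_of_nonneg_left hS hA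
    _ = ε * (‖A‖ * K) / (‖A‖ * K + 1) := by ring
    _ < ε := by
      rw [div_lt_iff₀ (by positivity)]
      nlinarith

lemma inner_snd_sum_solution {r : ℝ} {h : weightedSobolev Ω} {u v k : beppoLevi} {A : ℝ}
    {F : E3 → ℝ}
    (hu : inner ℝ (u : SobolevAmbient Set.univ).snd (k : SobolevAmbient Set.univ).snd = A)
    (hv : inner ℝ (v : SobolevAmbient Set.univ).snd (k : SobolevAmbient Set.univ).snd
      = ∫ x in truncated Ω r, sobolevToTruncated Ω r h x * F x) :
    inner ℝ ((u + v : beppoLevi) : SobolevAmbient Set.univ).snd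
      (k : SobolevAmbient Set.univ).snd
      = A + ∫ x in truncated Ω r, sobolevFun h x * F x := by
  have e : ((u + v : beppoLevi) : SobolevAmbient Set.univ).snd
      = (u : SobolevAmbient Set.univ).snd + (v : SobolevAmbient Set.univ).snd := rfl
  rw [e, inner_add_left, hu, hv]
  congr 1
  refine integral_congr_ae ?_
  filter_upwards [coeFn_sobolevToTruncated r h] with x hx
  rw [hx]

/-- Some operator with the property `P` differs from a compact one by an operator of norm less than
`ε`. -/
def HasDecomposition {X : Type*} [NormedAddCommGroup X] [NormedSpace ℝ X] (P : (X →L[ℝ] X) → Prop)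
    (ε : ℝ) : Prop :=
  ∃ S C : X →L[ℝ] X, P (S + C) ∧ ‖S‖ < ε ∧ IsCompactOperator C

/-- The remainder potential is, up to a small operator, compact. -/
lemma IsCoefficient.exists_decomposition (ha : IsCoefficient Ω a c)
    (hbd : Bornology.IsBounded Ωᶜ)
    (hdecay : Tendsto (fun x => weight x • gradient a x) (cocompact E3) (𝓝 0))
    (hJ : ∀ r : ℝ, IsCompactOperator (sobolevToTruncated Ω r)) {ε : ℝ} (hε : 0 < ε) :
    HasDecomposition (IsRemainderPotential Ω a) ε := by
  obtain ⟨K, hK, htail⟩ := ha.exists_tail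
  -- Chosen so that (norm of restriction) · K · δ < ε; the added 1 covers a vanishing product.
  have hδ : 0 < ε / (‖sobolevRestrict Ω‖ * K + 1) := by positivity
  obtain ⟨n, hn, hsmall⟩ := ha.exists_cutoff_small hbd hdecay hδ
  obtain ⟨S, hS, hSg⟩ := htail n _ hδ.le hsmall
  obtain ⟨Q, hQ⟩ := ha.exists_core n (2 * (n + 1) + 1)
  have hP := fun h k => inner_snd_sum_solution (r := 2 * (n + 1) + 1) (hSg h k)
    (hQ (sobolevToTruncated Ω (2 * (n + 1) + 1) h) k)
  exact ⟨sobolevRestrict Ω ∘L S,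
    (sobolevRestrict Ω ∘L Q) ∘L sobolevToTruncated Ω (2 * (n + 1) + 1),
    ha.isRemainderPotential hn (P := S + Q ∘L sobolevToTruncated Ω (2 * (n + 1) + 1)) hP
      fun h => (map_add (sobolevRestrict Ω) _ _).symm,
    opNorm_comp_lt _ _ hK hε hS, (hJ _).clm_comp (sobolevRestrict Ω ∘L Q)⟩

/-- An operator characterised by a property for which arbitrarily fine decompositions exist. -/
lemma existsUnique_fredholm_of_hasDecomposition {X : Type*} [NormedAddCommGroup X]
    [InnerProductSpace ℝ X] [CompleteSpace X] {P : (X →L[ℝ] X) → Prop}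
    (huniq : ∀ T T', P T → P T' → T' = T) (hdec : ∀ ε : ℝ, 0 < ε → HasDecomposition P ε) :
    ∃ R : X →L[ℝ] X, P R ∧ (∀ R', P R' → R' = R) ∧
      (∀ ε : ℝ, 0 < ε → ∃ Rs Rc : X →L[ℝ] X, R = Rs + Rc ∧ ‖Rs‖ < ε ∧ IsCompactOperator Rc) ∧
      IsFredholmOfIndexZero (ContinuousLinearMap.id ℝ X + R) := by
  obtain ⟨S, C, hP, hS, hC⟩ := hdec 1 one_pos
  refine ⟨S + C, hP, fun R' hR' => huniq _ _ hP hR', fun ε hε => ?_,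
    isFredholmOfIndexZero_id_add_small_add_compact S C hS hC⟩
  obtain ⟨S', C', hP', hS', hC'⟩ := hdec ε hε
  -- The construction for each ε uses a different cutoff and so yields an a priori different
  -- operator; uniqueness identifies it with the one already fixed.
  exact ⟨S', C', huniq _ _ hP' hP, hS', hC'⟩

end Decomposition

/-! ### The local cone condition for smooth boundaries -/

section ConeCondition

variable {Ω : Set E3}

/-- Near the point `p`, the set `Ω` is stable under small translations in the directions of a ball
of vectors. -/
def ConeConditionAt (Ω : Set E3) (p : E3) : Prop :=
  ∃ (v : E3) (δ : ℝ), 0 < δ ∧ ∀ x ∈ Ω ∩ Metric.ball p δ, ∀ t ∈ Set.Ioo (0 : ℝ) δ,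
    ∀ w ∈ Metric.ball v δ, x + t • w ∈ Ω

lemma coneConditionAt_of_mem (hΩ : IsOpen Ω) {p : E3} (hp : p ∈ Ω) : ConeConditionAt Ω p := by
  obtain ⟨η, hη, hball⟩ := Metric.isOpen_iff.1 hΩ p hp
  refine ⟨0, min 1 (η / 2), by positivity, fun x hx t ht w hw => hball ?_⟩
  have h1 : ‖x - p‖ < min 1 (η / 2) := mem_ball_iff_norm.1 hx.2
  have h2 : ‖w‖ < min 1 (η / 2) := mem_ball_zero_iff.1 hw
  have hm1 := min_le_left 1 (η / 2)
  have hm2 := min_le_right 1 (η / 2)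
  have h3 : ‖t • w‖ < η / 2 := by
    rw [norm_smul, Real.norm_of_nonneg ht.1.le]
    nlinarith [ht.1, ht.2, norm_nonneg w]
  rw [mem_ball_iff_norm, add_sub_right_comm]
  linarith [norm_add_le (x - p) (t • w)]

/-- Move in a direction v along which dφ(p) is negative. Strict differentiability makes the
increment of φ from x to x + tw close to t dφ(p)w uniformly in x near p, so φ decreases and
negativity persists. -/
lemma coneConditionAt_of_sublevel {p : E3} {U : Set E3} (hU : IsOpen U) (hpU : p ∈ U) {φ : E3 → ℝ}
    (hφ : ContDiffOn ℝ ∞ φ U) (hd : fderiv ℝ φ p ≠ 0) (hs : ∀ x ∈ U, (x ∈ Ω ↔ φ x < 0)) :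
    ConeConditionAt Ω p := by
  set L := fderiv ℝ φ p with hL
  obtain ⟨v, hv⟩ : ∃ v, L v < 0 := by
    obtain ⟨v, hv⟩ := DFunLike.ne_iff.1 hd
    rcases lt_or_gt_of_ne hv with h | h
    · exact ⟨v, h⟩
    · exact ⟨-v, by rw [map_neg]; exact neg_neg_of_pos h⟩
  set m := -L v with hm
  have hm0 : 0 < m := neg_pos.2 hv
  -- The approximation error is at most c t‖w‖ ≤ t m/4, while the linear term is at most -t m/2.
  set c : NNReal := ⟨m / (4 * (‖v‖ + 1)), by positivity⟩ with hc
  have hc0 : 0 < c := by rw [← NNReal.coe_pos, hc]; show 0 < m / (4 * (‖v‖ + 1)); positivity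
  have hcv : (c : ℝ) * (‖v‖ + 1) = m / 4 := by
    show m / (4 * (‖v‖ + 1)) * (‖v‖ + 1) = m / 4
    field_simp
  have hstrict : HasStrictFDerivAt φ L p :=
    (hφ.contDiffAt (hU.mem_nhds hpU)).hasStrictFDerivAt (by simp)
  obtain ⟨s, hsp, happ⟩ := hstrict.approximates_deriv_on_nhds (c := c) (Or.inr hc0)
  obtain ⟨η, hη, hball⟩ := Metric.mem_nhds_iff.1 (inter_mem hsp (hU.mem_nhds hpU))
  -- The bound 1 gives ‖w‖ ≤ ‖v‖ + 1, the second bound gives dφ(p)w ≤ -m/2, and the third keeps x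
  -- and x + tw in the ball where the approximation holds.
  refine ⟨v, min (min 1 (m / (2 * (‖L‖ + 1)))) (η / (‖v‖ + 2)), by positivity,
    fun x hx t ht w hw => ?_⟩
  set δ := min (min 1 (m / (2 * (‖L‖ + 1)))) (η / (‖v‖ + 2)) with hδ
  have d1 : δ ≤ 1 := (min_le_left _ _).trans (min_le_left _ _)
  have d2 : δ * (2 * (‖L‖ + 1)) ≤ m := by
    rw [← le_div_iff₀ (by positivity)]
    exact (min_le_left _ _).trans (min_le_right _ _)
  have d3 : δ * (‖v‖ + 2) ≤ η := by
    rw [← le_div_iff₀ (by positivity)]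
    exact min_le_right _ _
  have hx' : ‖x - p‖ < δ := mem_ball_iff_norm.1 hx.2
  have hw' : ‖w - v‖ < δ := mem_ball_iff_norm.1 hw
  have hwn : ‖w‖ ≤ ‖v‖ + 1 := by
    have := norm_add_le (w - v) v
    rw [sub_add_cancel] at this
    linarith
  have htw : ‖t • w‖ ≤ δ * (‖v‖ + 1) := by
    rw [norm_smul, Real.norm_of_nonneg ht.1.le]
    exact mul_le_mul ht.2.le hwn (norm_nonneg _) (ht.1.trans ht.2).le
  have hvn := norm_nonneg v
  have hδ0 := ht.1.trans ht.2
  have hxb : x ∈ Metric.ball p η := mem_ball_iff_norm.2 (by nlinarith)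
  have hyb : x + t • w ∈ Metric.ball p η := by
    rw [mem_ball_iff_norm, add_sub_right_comm]
    have := norm_add_le (x - p) (t • w)
    nlinarith
  have hLw : L w ≤ -m / 2 := by
    have h1 : L w = L v + L (w - v) := by rw [map_sub]; ring
    have h2 : L (w - v) ≤ ‖L‖ * ‖w - v‖ := (Real.le_norm_self _).trans (L.le_opNorm _)
    have h3 : ‖L‖ * ‖w - v‖ ≤ ‖L‖ * δ := mul_le_mul_of_nonneg_left hw'.le (norm_nonneg _)
    nlinarith
  have h4 := (Real.le_norm_self _).trans (happ _ (hball hyb).1 _ (hball hxb).1)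
  rw [add_sub_cancel_left, map_smul, smul_eq_mul, norm_smul, Real.norm_of_nonneg ht.1.le] at h4
  have h5 : (c : ℝ) * (t * ‖w‖) ≤ t * (m / 4) := by
    rw [← hcv]
    have := mul_le_mul_of_nonneg_left hwn (mul_nonneg c.2 ht.1.le)
    change (c : ℝ) * t * ‖w‖ ≤ (c : ℝ) * t * (‖v‖ + 1) at this
    linarith
  have h6 : t * L w ≤ t * (-m / 2) := mul_le_mul_of_nonneg_left hLw ht.1.le
  have h7 := (hs x (hball hxb).2).1 hx.1
  refine (hs _ (hball hyb).2).2 ?_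
  nlinarith [mul_pos ht.1 hm0]

lemma IsSmoothExteriorDomain.coneConditionAt (hΩ : IsSmoothExteriorDomain Ω) {p : E3}
    (hp : p ∈ closure Ω) : ConeConditionAt Ω p := by
  by_cases h : p ∈ Ω
  · exact coneConditionAt_of_mem hΩ.isOpen h
  · obtain ⟨U, hU, hpU, φ, hφ, hd, hs⟩ := hΩ.smooth_boundary p
      (by rw [frontier, hΩ.isOpen.interior_eq]; exact ⟨hp, h⟩)
    exact coneConditionAt_of_sublevel hU hpU hφ hd hs

end ConeCondition

/-! ### Density of test functions in L² and the dual form of the norm -/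

section Duality

/-- The classes of test functions supported in `U`. -/
def testFunctions (U : Set E3) : Submodule ℝ (Lp ℝ 2 (volume.restrict U)) where
  carrier := {f | ∃ φ : E3 → ℝ, ContDiff ℝ ∞ φ ∧ HasCompactSupport φ ∧ tsupport φ ⊆ U ∧
    f =ᵐ[volume.restrict U] φ}
  zero_mem' := ⟨fun _ => 0, contDiff_const, HasCompactSupport.zero, by simp [tsupport],
    Lp.coeFn_zero ℝ 2 _⟩
  add_mem' := by
    rintro p q ⟨φ, hφ, sφ, tφ, p1⟩ ⟨ψ, hψ, sψ, tψ, q1⟩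
    refine ⟨fun x => φ x + ψ x, hφ.add hψ, sφ.add sψ,
      (tsupport_add φ ψ).trans (Set.union_subset tφ tψ), ?_⟩
    filter_upwards [Lp.coeFn_add p q, p1, q1] with x hx h1 h2
    rw [hx, Pi.add_apply, h1, h2]
  smul_mem' := by
    rintro c p ⟨φ, hφ, sφ, tφ, p1⟩
    refine ⟨fun x => c * φ x, contDiff_const.mul hφ, sφ.mul_left,
      (tsupport_mul_subset_right).trans tφ, ?_⟩
    filter_upwards [Lp.coeFn_smul c p, p1] with x hx h1
    rw [hx, Pi.smul_apply, h1, smul_eq_mul]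

lemma dense_testFunctions {U : Set E3} (hU : IsOpen U) :
    (testFunctions U).topologicalClosure = ⊤ := by
  rw [Submodule.topologicalClosure_eq_top_iff, Submodule.eq_bot_iff]
  intro f hf
  have hz : ∀ᵐ x, x ∈ U → f x = 0 := by
    refine hU.ae_eq_zero_of_integral_contDiff_smul_eq_zero ?_ fun φ hφ hs ht => ?_
    · exact locallyIntegrableOn_of_locallyIntegrable_restrict
        ((Lp.memLp f).locallyIntegrable (by norm_num))
    · have hm : MemLp φ 2 (volume.restrict U) :=
        (hφ.continuous.memLp_of_hasCompactSupport hs).restrict _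
      have h0 := (Submodule.mem_orthogonal _ _).1 hf hm.toLp ⟨φ, hφ, hs, ht, hm.coeFn_toLp⟩
      rw [← setIntegral_eq_integral_of_forall_compl_eq_zero (s := U) fun x hx => by
        rw [image_eq_zero_of_notMem_tsupport fun h => hx (ht h), zero_smul], ← h0, L2.inner_def]
      refine integral_congr_ae ?_
      filter_upwards [hm.coeFn_toLp] with x hx
      rw [hx]
      simp [mul_comm]
  refine Lp.ext ?_
  filter_upwards [ae_restrict_of_ae hz, ae_restrict_mem hU.measurableSet,
    Lp.coeFn_zero ℝ 2 (volume.restrict U)] with x h1 h2 h3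
  rw [h1 h2, h3, Pi.zero_apply]

/-- The `L²` norm is determined by testing against test functions. -/
lemma norm_le_of_forall_test {U : Set E3} (hU : IsOpen U) {f : Lp ℝ 2 (volume.restrict U)} {A : ℝ}
    (hA : 0 ≤ A) (h : ∀ ψ : E3 → ℝ, ContDiff ℝ ∞ ψ → HasCompactSupport ψ → tsupport ψ ⊆ U →
      ∫ x in U, f x * ψ x ≤ A * (eLpNorm ψ 2 volume).toReal) : ‖f‖ ≤ A := by
  have key : ∀ w ∈ (testFunctions U).topologicalClosure, inner ℝ f w ≤ A * ‖w‖ := by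
    intro w hw
    refine closure_minimal (s := (testFunctions U : Set (Lp ℝ 2 (volume.restrict U))))
      (t := {w | inner ℝ f w ≤ A * ‖w‖}) ?_ ?_ hw
    · rintro w ⟨ψ, hψ, hs, ht, hw⟩
      have e1 : inner ℝ f w = ∫ x in U, f x * ψ x := by
        rw [L2.inner_def]
        refine integral_congr_ae ?_
        filter_upwards [hw] with x hx
        rw [hx]
        simp [mul_comm]
      have e2 : ‖w‖ = (eLpNorm ψ 2 volume).toReal := by
        rw [Lp.norm_def, eLpNorm_congr_ae hw, eLpNorm_restrict_eq_of_support_subset]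
        exact (subset_tsupport ψ).trans ht
      rw [Set.mem_ofPred_eq, e1, e2]
      exact h ψ hψ hs ht
    · exact isClosed_le (continuous_const.inner continuous_id) (continuous_const.mul continuous_norm)
  -- By density the element f itself is admissible, giving ‖f‖² ≤ A‖f‖.
  have h1 := key f (by rw [dense_testFunctions hU]; trivial)
  rw [real_inner_self_eq_norm_sq] at h1
  by_contra hlt
  rw [not_le] at hlt
  nlinarith [norm_nonneg f]

end Duality

/-! ### Translates inside Ω are controlled by the weak gradient -/

section Translation

variable {Ω : Set E3}

/-- Extension by zero. -/
def sobolevExtend (g : weightedSobolev Ω) : E3 → ℝ := Ω.indicator (sobolevFun g)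

lemma memLp_indicator_sobolevFun (hΩ : IsOpen Ω) (g : weightedSobolev Ω) (r : ℝ) :
    MemLp ((truncated Ω r).indicator (sobolevFun g)) 2 volume := by
  rw [memLp_indicator_iff_restrict (hΩ.measurableSet.inter measurableSet_ball)]
  exact memLp_truncated (memLp_sobolevFun g) r

lemma locallyIntegrable_sobolevExtend (hΩ : IsOpen Ω) (g : weightedSobolev Ω) :
    LocallyIntegrable (sobolevExtend g) := by
  intro x
  refine ⟨Metric.ball 0 (‖x‖ + 1), Metric.isOpen_ball.mem_nhds
    (mem_ball_zero_iff.2 (lt_add_one _)), ?_⟩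
  rw [sobolevExtend, IntegrableOn, integrable_indicator_iff hΩ.measurableSet, IntegrableOn,
    Measure.restrict_restrict hΩ.measurableSet]
  exact integrableOn_truncated (memLp_sobolevFun g) _

lemma norm_sobolevGrad_toLp_le (g : weightedSobolev Ω) :
    ‖(g : SobolevAmbient Ω).snd‖ ≤ ‖g‖ := norm_snd_le _

lemma hasFDerivAt_integral_translate {f ψ : E3 → ℝ} (hf : LocallyIntegrable f)
    (hψ : ContDiff ℝ ∞ ψ) (hs : HasCompactSupport ψ) (x : E3) :
    ∃ D : E3 →L[ℝ] ℝ, HasFDerivAt (fun x => ∫ y, f y * ψ (y - x)) D x ∧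
      ∀ v, D v = -∫ y, f y * fderiv ℝ ψ (y - x) v := by
  set χ : E3 → ℝ := fun y => ψ (-y) with hχ
  have hχ1 : ContDiff ℝ ∞ χ := hψ.comp contDiff_neg
  have hχs : HasCompactSupport χ := hs.comp_homeomorph (Homeomorph.neg E3)
  have e : (fun x => ∫ y, f y * ψ (y - x)) =
      convolution f χ (ContinuousLinearMap.lsmul ℝ ℝ) volume := by
    funext x
    simp [convolution, hχ]
  have hd : ∀ y v, fderiv ℝ χ y v = -fderiv ℝ ψ (-y) v := by
    intro y v
    have h1 : HasFDerivAt (fun y : E3 => -y) (-ContinuousLinearMap.id ℝ E3) y :=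
      (hasFDerivAt_id y).neg
    have h := ((hψ.differentiable (by simp) (-y)).hasFDerivAt.comp y h1).fderiv
    change fderiv ℝ (ψ ∘ fun y => -y) y v = _
    rw [h]
    simp
  refine ⟨_, by rw [e]; exact hχs.hasFDerivAt_convolution_right _ hf (hχ1.of_le (by simp)) x,
    fun v => ?_⟩
  rw [convolution_precompR_apply _ hf (hχs.fderiv (𝕜 := ℝ)) (hχ1.continuous_fderiv (by simp)),
    ← integral_neg]
  simp only [convolution, hd, neg_sub]
  simp

/-- Difference quotients in weak form. -/
lemma integral_mul_translate_sub_le (hΩ : IsOpen Ω) (g : weightedSobolev Ω) {U : Set E3} {z : E3}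
    (hU : ∀ x ∈ U, ∀ s ∈ Set.Icc (0 : ℝ) 1, x + s • z ∈ Ω) {ψ : E3 → ℝ} (hψ : ContDiff ℝ ∞ ψ)
    (hs : HasCompactSupport ψ) (ht : tsupport ψ ⊆ U) :
    (∫ y, sobolevExtend g y * ψ (y - z)) - ∫ y, sobolevExtend g y * ψ y
      ≤ ‖z‖ * ‖g‖ * (eLpNorm ψ 2 volume).toReal := by
  have hf := locallyIntegrable_sobolevExtend hΩ g
  choose D hD hDv using hasFDerivAt_integral_translate hf hψ hs
  have hF : ∀ s : ℝ, HasDerivAt (fun s : ℝ => ∫ y, sobolevExtend g y * ψ (y - s • z))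
      (D (s • z) z) s := by
    intro s
    have h1 : HasDerivAt (fun s : ℝ => s • z) z s := by
      simpa using (hasDerivAt_id s).smul_const z
    exact (hD (s • z)).comp_hasDerivAt s h1
  have hb : ∀ s ∈ Set.Ico (0 : ℝ) 1,
      ‖D (s • z) z‖ ≤ ‖z‖ * ‖g‖ * (eLpNorm ψ 2 volume).toReal := by
    intro s hs01
    set ψs : E3 → ℝ := fun y => ψ (y - s • z) with hψs
    have c1 : ContDiff ℝ ∞ ψs := hψ.comp (contDiff_id.sub contDiff_const)
    have c2 : HasCompactSupport ψs := hs.comp_homeomorph (Homeomorph.subRight (s • z))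
    -- The whole segment from x to x + z must stay in Ω, so that every intermediate translate of ψ
    -- may be tested against the weak gradient.
    have c3 : tsupport ψs ⊆ Ω := by
      have h1 : tsupport ψs ⊆ (fun y => y - s • z) ⁻¹' tsupport ψ :=
        tsupport_comp_subset_preimage ψ (continuous_id.sub continuous_const)
      intro y hy
      have := hU _ (ht (h1 hy)) s ⟨hs01.1, hs01.2.le⟩
      simpa using this
    have hd : ∀ y, fderiv ℝ ψs y z = fderiv ℝ ψ (y - s • z) z := fun y => by
      rw [((hasFDerivAt_comp_sub (s • z)).2
        (hψ.differentiable (by simp) (y - s • z)).hasFDerivAt).fderiv]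
    have hw := isWeakGradient_sobolev g ψs c1 c2 c3 z
    have hm : MemLp (fun y => ψs y • z) 2 (volume.restrict Ω) :=
      ((c1.continuous.smul continuous_const).memLp_of_hasCompactSupport c2.smul_right).restrict _
    have e1 : D (s • z) z = inner ℝ (g : SobolevAmbient Ω).snd hm.toLp := by
      rw [hDv, L2.inner_def]
      have : ∫ y, sobolevExtend g y * fderiv ℝ ψ (y - s • z) z
          = ∫ y in Ω, fderiv ℝ ψs y z * sobolevFun g y := by
        rw [← integral_indicator hΩ.measurableSet]
        refine integral_congr_ae (Eventually.of_forall fun y => ?_)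
        simp only [sobolevExtend, hd]
        by_cases hy : y ∈ Ω
        · rw [Set.indicator_of_mem hy, Set.indicator_of_mem hy, mul_comm]
        · rw [Set.indicator_of_notMem hy, Set.indicator_of_notMem hy, zero_mul]
      rw [this, hw, neg_neg]
      refine integral_congr_ae ?_
      filter_upwards [hm.coeFn_toLp] with y hy
      rw [hy, real_inner_smul_right]
      rfl
    have e2 : ‖hm.toLp‖ ≤ ‖z‖ * (eLpNorm ψ 2 volume).toReal := by
      have hfin : eLpNorm ψ 2 volume ≠ ⊤ :=
        (hψ.continuous.memLp_of_hasCompactSupport hs).2.ne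
      have h3 : eLpNorm ψs 2 volume = eLpNorm ψ 2 volume :=
        eLpNorm_comp_measurePreserving hψ.continuous.aestronglyMeasurable
          (measurePreserving_sub_right volume (s • z))
      rw [Lp.norm_toLp, ← ENNReal.toReal_ofReal (norm_nonneg z), ← ENNReal.toReal_mul]
      refine ENNReal.toReal_mono (ENNReal.mul_ne_top ENNReal.ofReal_ne_top hfin) ?_
      rw [← h3]
      refine le_trans ?_ (mul_le_mul_right (eLpNorm_restrict_le ψs 2 volume Ω) _)
      refine eLpNorm_le_mul_eLpNorm_of_ae_le_mul (Eventually.of_forall fun y => ?_) 2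
      rw [norm_smul, mul_comm]
    rw [e1]
    refine (norm_inner_le_norm _ _).trans ?_
    have := mul_le_mul (norm_sobolevGrad_toLp_le g) e2 (norm_nonneg _) (norm_nonneg _)
    linarith
  -- Mean value inequality in s: the derivative of the pairing with ψ(· - sz) is the pairing of ∇g·z
  -- with that translate, bounded by Cauchy–Schwarz.
  have := norm_image_sub_le_of_norm_deriv_le_segment_01'
    (fun s _ => (hF s).hasDerivWithinAt) hb
  simp only [one_smul, zero_smul, sub_zero] at this
  exact (Real.le_norm_self _).trans this

/-- Difference quotients are controlled by the gradient. -/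
lemma lintegral_translate_sub_le (hΩ : IsOpen Ω) (g : weightedSobolev Ω) {U : Set E3}
    (hUo : IsOpen U) {ρ : ℝ} (hUb : U ⊆ Metric.ball 0 ρ) {z : E3}
    (hU : ∀ x ∈ U, ∀ s ∈ Set.Icc (0 : ℝ) 1, x + s • z ∈ Ω) :
    ∫⁻ x in U, ‖sobolevFun g (x + z) - sobolevFun g x‖ₑ ^ 2
      ≤ ENNReal.ofReal ((‖z‖ * ‖g‖) ^ 2) := by
  have hUΩ : U ⊆ Ω := fun x hx => by simpa using hU x hx 0 (by simp)
  have hUz : ∀ x ∈ U, x + z ∈ Ω := fun x hx => by simpa using hU x hx 1 (by simp)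
  have m1 : MemLp (fun x => sobolevFun g (x + z)) 2 (volume.restrict U) := by
    have h1 := ((memLp_indicator_sobolevFun hΩ g (ρ + ‖z‖)).comp_measurePreserving
      (measurePreserving_add_right volume z)).restrict U
    refine (memLp_congr_ae ?_).1 h1
    filter_upwards [ae_restrict_mem hUo.measurableSet] with x hx
    have hm : x + z ∈ truncated Ω (ρ + ‖z‖) := by
      refine ⟨hUz x hx, mem_ball_zero_iff.2 ?_⟩
      have := mem_ball_zero_iff.1 (hUb hx)
      linarith [norm_add_le x z]
    rw [Function.comp_apply, Set.indicator_of_mem hm]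
  have m2 : MemLp (sobolevFun g) 2 (volume.restrict U) :=
    (memLp_truncated (memLp_sobolevFun g) ρ).mono_measure
      (Measure.restrict_mono_set _ (Set.subset_inter hUΩ hUb))
  have m : MemLp (fun x => sobolevFun g (x + z) - sobolevFun g x) 2 (volume.restrict U) :=
    m1.sub m2
  have hn : ‖m.toLp‖ ≤ ‖z‖ * ‖g‖ := by
    -- By duality the translation is shifted from g, which is not differentiable, onto the test
    -- function.
    refine norm_le_of_forall_test hUo (by positivity) fun ψ hψ hs ht => ?_
    have hf := locallyIntegrable_sobolevExtend hΩ g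
    have j1 : Integrable (fun y => sobolevExtend g y * ψ (y - z)) := by
      have := hf.integrable_smul_left_of_hasCompactSupport
        (hψ.continuous.comp (continuous_id.sub continuous_const))
        (hs.comp_homeomorph (Homeomorph.subRight z))
      exact this.congr (Eventually.of_forall fun y => mul_comm _ _)
    have j2 : Integrable (fun y => sobolevExtend g y * ψ y) :=
      (hf.integrable_smul_left_of_hasCompactSupport hψ.continuous hs).congr
        (Eventually.of_forall fun y => mul_comm _ _)
    have j1' : Integrable (fun x => sobolevExtend g (x + z) * ψ x) := by
      simpa using j1.comp_add_right z
    have e1 : ∫ y, sobolevExtend g y * ψ (y - z) = ∫ x, sobolevExtend g (x + z) * ψ x := by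
      rw [← integral_add_right_eq_self _ z]
      simp
    have e2 : ∫ x in U, MemLp.toLp _ m x * ψ x
        = (∫ y, sobolevExtend g y * ψ (y - z)) - ∫ y, sobolevExtend g y * ψ y := by
      have e3 : ∫ x in U, (sobolevExtend g (x + z) * ψ x - sobolevExtend g x * ψ x)
          = ∫ x, (sobolevExtend g (x + z) * ψ x - sobolevExtend g x * ψ x) :=
        setIntegral_eq_integral_of_forall_compl_eq_zero fun x hx => by
          rw [image_eq_zero_of_notMem_tsupport fun h => hx (ht h)]
          ring
      rw [e1, ← integral_sub j1' j2, ← e3]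
      refine integral_congr_ae ?_
      filter_upwards [m.coeFn_toLp, ae_restrict_mem hUo.measurableSet] with x hx hxU
      rw [hx, sobolevExtend, Set.indicator_of_mem (hUz x hxU), Set.indicator_of_mem (hUΩ hxU)]
      ring
    rw [e2]
    exact integral_mul_translate_sub_le hΩ g hU hψ hs ht
  rw [Lp.norm_toLp] at hn
  have h1 := (ENNReal.le_ofReal_iff_toReal_le m.2.ne (by positivity)).2 hn
  rw [eLpNorm_two_eq_lintegral] at h1
  have h2 := ENNReal.rpow_le_rpow h1 (z := 2) (by norm_num)
  rw [← ENNReal.rpow_mul, show (1 / 2 * 2 : ℝ) = 1 by norm_num, ENNReal.rpow_one,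
    ENNReal.ofReal_rpow_of_nonneg (by positivity) (by norm_num)] at h2
  exact_mod_cast h2

end Translation

/-! ### Compactness from control by finitely many functionals -/

section CompactnessCriterion

/-- `F` is controlled by finitely many functionals up to `ε` times the square of the norm. -/
def HasFiniteControl {X : Type*} [NormedAddCommGroup X] [NormedSpace ℝ X] (F : X → ℝ≥0∞) (ε : ℝ) :
    Prop :=
  ∃ S : Finset (X →L[ℝ] ℝ), ∃ C : ℝ, 0 ≤ C ∧
    ∀ g, F g ≤ ENNReal.ofReal (ε * ‖g‖ ^ 2 + C * ∑ l ∈ S, (l g) ^ 2)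

lemma HasFiniteControl.mono {X : Type*} [NormedAddCommGroup X] [NormedSpace ℝ X] {F F' : X → ℝ≥0∞}
    {ε : ℝ} (h : HasFiniteControl F ε) (hF : ∀ g, F' g ≤ F g) : HasFiniteControl F' ε :=
  let ⟨S, C, hC, hS⟩ := h
  ⟨S, C, hC, fun g => (hF g).trans (hS g)⟩

lemma hasFiniteControl_zero {X : Type*} [NormedAddCommGroup X] [NormedSpace ℝ X] (ε : ℝ) :
    HasFiniteControl (fun _ : X => 0) ε :=
  ⟨∅, 0, le_rfl, fun _ => zero_le⟩

lemma HasFiniteControl.add {X : Type*} [NormedAddCommGroup X] [NormedSpace ℝ X] {F F' : X → ℝ≥0∞}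
    {ε : ℝ} (hε : 0 < ε) (h : HasFiniteControl F (ε / 2)) (h' : HasFiniteControl F' (ε / 2)) :
    HasFiniteControl (fun g => F g + F' g) ε := by
  classical
  obtain ⟨S, C, hC, hS⟩ := h
  obtain ⟨S', C', hC', hS'⟩ := h'
  refine ⟨S ∪ S', C + C', by positivity, fun g => ?_⟩
  have p : ∀ T : Finset (X →L[ℝ] ℝ), 0 ≤ ∑ l ∈ T, (l g) ^ 2 := fun T =>
    Finset.sum_nonneg fun _ _ => sq_nonneg _
  have q : ∀ T, T ⊆ S ∪ S' → ∑ l ∈ T, (l g) ^ 2 ≤ ∑ l ∈ S ∪ S', (l g) ^ 2 := fun T hT =>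
    Finset.sum_le_sum_of_subset_of_nonneg hT fun _ _ _ => sq_nonneg _
  refine (add_le_add (hS g) (hS' g)).trans ?_
  rw [← ENNReal.ofReal_add
    (add_nonneg (by positivity) (mul_nonneg hC (p S)))
    (add_nonneg (by positivity) (mul_nonneg hC' (p S')))]
  refine ENNReal.ofReal_le_ofReal ?_
  have e1 := mul_le_mul_of_nonneg_left (q S Finset.subset_union_left) hC
  have e2 := mul_le_mul_of_nonneg_left (q S' Finset.subset_union_right) hC'
  linarith

lemma hasFiniteControl_of_exists {X ι : Type*} [NormedAddCommGroup X] [NormedSpace ℝ X]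
    {F D : X → ℝ≥0∞} {ε : ℝ} (hε : 0 ≤ ε) (T : Finset ι) (l : ι → X →L[ℝ] ℝ) {V : ℝ≥0∞}
    (hV : V ≠ ⊤) (hF : ∀ g, F g ≤ D g + 2 * (∑ c ∈ T, ‖l c g‖ₑ ^ 2) * V)
    (hD : ∀ g, D g ≤ ENNReal.ofReal (ε * ‖g‖ ^ 2)) : HasFiniteControl F ε := by
  classical
  refine ⟨T.image l, 2 * (T.card : ℝ) * V.toReal, by positivity, fun g => ?_⟩
  -- Distinct indices may give the same functional, which the image counts once; the cardinality
  -- factor compensates.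
  have h1 : ∑ c ∈ T, (l c g) ^ 2 ≤ T.card * ∑ k ∈ T.image l, (k g) ^ 2 := by
    rw [← nsmul_eq_mul]
    refine Finset.sum_le_card_nsmul _ _ _ fun c hc => ?_
    exact Finset.single_le_sum (f := fun k : X →L[ℝ] ℝ => (k g) ^ 2) (fun _ _ => sq_nonneg _)
      (Finset.mem_image_of_mem l hc)
  have h2 : 2 * (∑ c ∈ T, ‖l c g‖ₑ ^ 2) * V
      = ENNReal.ofReal (2 * (∑ c ∈ T, (l c g) ^ 2) * V.toReal) := by
    have : ∑ c ∈ T, ‖l c g‖ₑ ^ 2 = ENNReal.ofReal (∑ c ∈ T, (l c g) ^ 2) := by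
      rw [ENNReal.ofReal_sum_of_nonneg fun _ _ => sq_nonneg _]
      refine Finset.sum_congr rfl fun c _ => ?_
      rw [← sq_abs, ENNReal.ofReal_pow (abs_nonneg _), ← Real.norm_eq_abs, ofReal_norm]
    rw [ENNReal.ofReal_mul (mul_nonneg zero_le_two (Finset.sum_nonneg fun _ _ => sq_nonneg _)),
      ENNReal.ofReal_mul zero_le_two, ENNReal.ofReal_toReal hV, this, ENNReal.ofReal_ofNat]
  refine (hF g).trans ((add_le_add (hD g) h2.le).trans ?_)
  rw [← ENNReal.ofReal_add (by positivity) (mul_nonneg (mul_nonneg zero_le_two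
    (Finset.sum_nonneg fun _ _ => sq_nonneg _)) ENNReal.toReal_nonneg)]
  refine ENNReal.ofReal_le_ofReal (add_le_add_right ?_ _)
  have := mul_le_mul_of_nonneg_left h1 (mul_nonneg zero_le_two (ENNReal.toReal_nonneg (a := V)))
  linarith

/-- An operator which is controlled by finitely many functionals up to an arbitrarily small multiple
of the norm is compact. -/
lemma isCompactOperator_of_forall_le {X Y : Type*} [NormedAddCommGroup X] [NormedSpace ℝ X]
    [NormedAddCommGroup Y] [NormedSpace ℝ Y] [CompleteSpace Y] (J : X →L[ℝ] Y)
    (h : ∀ ε : ℝ, 0 < ε → HasFiniteControl (fun g => ‖J g‖ₑ ^ 2) ε) : IsCompactOperator J := by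
  refine (isCompactOperator_iff_isCompact_closure_image_closedBall (J : X →ₗ[ℝ] Y) one_pos).2 ?_
  refine TotallyBounded.isCompact_of_isClosed (TotallyBounded.closure ?_) isClosed_closure
  rw [Metric.totallyBounded_iff]
  intro ε hε
  -- Differences in the unit ball have squared norm at most 4, so this term contributes ε²/2; η is
  -- chosen so that the functionals contribute at most ε²/4.
  obtain ⟨S, C, hC, hSe⟩ := h (ε ^ 2 / 8) (by positivity)
  have hS : ∀ g, ‖J g‖ ^ 2 ≤ ε ^ 2 / 8 * ‖g‖ ^ 2 + C * ∑ l ∈ S, (l g) ^ 2 := by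
    intro g
    have := hSe g
    simp only [← ofReal_norm, ← ENNReal.ofReal_pow (norm_nonneg (J g))] at this
    exact (ENNReal.ofReal_le_ofReal_iff (add_nonneg (by positivity)
      (mul_nonneg hC (Finset.sum_nonneg fun _ _ => sq_nonneg _)))).1 this
  set K : X →L[ℝ] (S → ℝ) := ContinuousLinearMap.pi fun l : S => l.1 with hK
  set B : Set X := Metric.closedBall 0 1 with hB
  -- The values of the finitely many functionals form a bounded set in finite dimension; a finite
  -- η-net there selects the centres of an ε-net for the image under `J`.
  have htb : TotallyBounded (K '' B) :=
    ((K.lipschitz.isBounded_image Metric.isBounded_closedBall).isCompact_closure).totallyBounded.subset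
      subset_closure
  set η : ℝ := ε / (2 * Real.sqrt (C * S.card + 1)) with hη
  have hη0 : 0 < η := by positivity
  have hη2 : η ^ 2 * (C * S.card + 1) = ε ^ 2 / 4 := by
    rw [hη, div_pow, mul_pow, Real.sq_sqrt (by positivity)]
    field_simp
    norm_num
  obtain ⟨T, hTK, hTf, hcov⟩ := Metric.finite_approx_of_totallyBounded htb η hη0
  choose f hf hfK using fun z (hz : z ∈ T) => hTK hz
  have := hTf.to_subtype
  refine ⟨Set.range fun z : T => J (f z.1 z.2), Set.finite_range _, ?_⟩
  rintro _ ⟨g, hg, rfl⟩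
  obtain ⟨z, hz, hgz⟩ := Set.mem_iUnion₂.1 (hcov (Set.mem_image_of_mem K hg))
  refine Set.mem_iUnion₂.2 ⟨J (f z hz), ⟨⟨z, hz⟩, rfl⟩, ?_⟩
  rw [← hfK z hz, mem_ball_iff_norm, ← map_sub] at hgz
  have h1 : ∀ l ∈ S, (l (g - f z hz)) ^ 2 ≤ η ^ 2 := by
    intro l hl
    have h2 := (norm_le_pi_norm (K (g - f z hz)) ⟨l, hl⟩).trans hgz.le
    have h3 : K (g - f z hz) ⟨l, hl⟩ = l (g - f z hz) := rfl
    rw [h3] at h2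
    rw [← sq_abs]
    exact pow_le_pow_left₀ (abs_nonneg _) h2 2
  have h4 : ‖g - f z hz‖ ≤ 2 := by
    have e1 := mem_closedBall_zero_iff.1 hg
    have e2 := mem_closedBall_zero_iff.1 (hf z hz)
    linarith [norm_sub_le g (f z hz)]
  have h5 : ∑ l ∈ S, (l (g - f z hz)) ^ 2 ≤ S.card * η ^ 2 := by
    simpa using Finset.sum_le_sum h1
  have h6 : ‖g - f z hz‖ ^ 2 ≤ 4 := by nlinarith [norm_nonneg (g - f z hz)]
  have h7 := hS (g - f z hz)
  have h8 : C * ∑ l ∈ S, (l (g - f z hz)) ^ 2 ≤ C * (S.card * η ^ 2) :=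
    mul_le_mul_of_nonneg_left h5 hC
  have h9 : ε ^ 2 / 8 * ‖g - f z hz‖ ^ 2 ≤ ε ^ 2 / 8 * 4 :=
    mul_le_mul_of_nonneg_left h6 (by positivity)
  have h10 : ‖J (g - f z hz)‖ ^ 2 < ε ^ 2 := by nlinarith [sq_pos_of_pos hη0, sq_pos_of_pos hε]
  rw [mem_ball_iff_norm]
  change ‖J g - J (f z hz)‖ < ε
  rw [← map_sub]
  exact lt_of_pow_lt_pow_left₀ 2 hε.le h10

end CompactnessCriterion

/-! ### Rellich's theorem by averaging over balls -/

section Averages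

/-- The difference of c and the average is the average of c - f, whose square is at most the mean
square; (s + t)² ≤ 2(s² + t²) does the rest. -/
lemma enorm_sq_le_average {B : Set E3} (hB0 : volume B ≠ 0) (hB : volume B ≠ ⊤) {f : E3 → ℝ}
    (hf : IntegrableOn f B) (c : ℝ) :
    ‖c‖ₑ ^ 2 ≤ 2 * ((volume B)⁻¹ * ∫⁻ y in B, ‖c - f y‖ₑ ^ 2) + 2 * ‖⨍ y in B, f y‖ₑ ^ 2 := by
  set μ : Measure E3 := (volume B)⁻¹ • volume.restrict B with hμ
  have hprob : IsProbabilityMeasure μ := ⟨by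
    rw [hμ, Measure.smul_apply, Measure.restrict_apply_univ, smul_eq_mul,
      ENNReal.inv_mul_cancel hB0 hB]⟩
  have hfμ : Integrable f μ := hf.smul_measure (ENNReal.inv_ne_top.2 hB0)
  have hav : ⨍ y in B, f y = ∫ y, f y ∂μ := by
    rw [average_eq', Measure.restrict_apply_univ]
  have hd : c - ⨍ y in B, f y = ∫ y, (c - f y) ∂μ := by
    rw [integral_sub (integrable_const c) hfμ, hav]
    simp
  have h1 : ‖c - ⨍ y in B, f y‖ₑ ^ 2 ≤ (volume B)⁻¹ * ∫⁻ y in B, ‖c - f y‖ₑ ^ 2 := by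
    have h2 : ‖c - ⨍ y in B, f y‖ₑ ≤ eLpNorm (fun y => c - f y) 2 μ := by
      rw [hd]
      refine (enorm_integral_le_lintegral_enorm _).trans ?_
      rw [← eLpNorm_one_eq_lintegral_enorm]
      exact eLpNorm_le_eLpNorm_of_exponent_le (by norm_num)
        (aestronglyMeasurable_const.sub hfμ.aestronglyMeasurable)
    have h3 := ENNReal.rpow_le_rpow h2 (z := 2) (by norm_num)
    rw [eLpNorm_two_eq_lintegral, ← ENNReal.rpow_mul, show (1 / 2 * 2 : ℝ) = 1 by norm_num,
      ENNReal.rpow_one, hμ, lintegral_smul_measure] at h3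
    exact_mod_cast h3
  have h4 : ‖c‖ₑ ≤ ‖c - ⨍ y in B, f y‖ₑ + ‖⨍ y in B, f y‖ₑ := by
    have := enorm_add_le (c - ⨍ y in B, f y) (⨍ y in B, f y)
    rwa [sub_add_cancel] at this
  have h5 : ‖c‖ₑ ^ 2 ≤ 2 * (‖c - ⨍ y in B, f y‖ₑ ^ 2 + ‖⨍ y in B, f y‖ₑ ^ 2) := by
    refine (pow_le_pow_left' h4 2).trans ?_
    have := ENNReal.rpow_add_le_mul_rpow_add_rpow ‖c - ⨍ y in B, f y‖ₑ ‖⨍ y in B, f y‖ₑ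
      (p := 2) (by norm_num)
    rw [show (2 - 1 : ℝ) = 1 by norm_num, ENNReal.rpow_one] at this
    exact_mod_cast this
  rw [mul_add] at h5
  exact h5.trans (add_le_add_left (mul_le_mul_right h1 2) _)

variable {Ω : Set E3}

lemma exists_averageFunctional {B : Set E3} (hB : MeasurableSet B) {r : ℝ}
    (hBr : B ⊆ truncated Ω r) :
    ∃ l : weightedSobolev Ω →L[ℝ] ℝ, ∀ g, l g = ⨍ y in B, sobolevFun g y := by
  have hfin : volume.restrict (truncated Ω r) B ≠ ⊤ := measure_ne_top _ _
  refine ⟨(volume.real B)⁻¹ • (innerSL ℝ (indicatorConstLp 2 hB hfin (1 : ℝ)) ∘L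
    sobolevToTruncated Ω r), fun g => ?_⟩
  rw [smul_apply, ContinuousLinearMap.comp_apply, innerSL_apply_apply,
    L2.inner_indicatorConstLp_one, setAverage_eq]
  congr 1
  have hmono : (volume.restrict (truncated Ω r)).restrict B = volume.restrict B := by
    rw [Measure.restrict_restrict hB, Set.inter_eq_left.2 hBr]
  rw [hmono]
  refine integral_congr_ae ?_
  exact ae_mono (Measure.restrict_mono_set _ hBr) (coeFn_sobolevToTruncated r g)

lemma measurable_sobolevFun (g : weightedSobolev Ω) : Measurable (sobolevFun g) :=
  (Lp.stronglyMeasurable _).measurable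

/-- The `L²` norm on `A` is controlled by finitely many functionals up to a small multiple of the
Sobolev norm. -/
def FinitelyControlled (Ω A : Set E3) : Prop :=
  ∀ ε : ℝ, 0 < ε → HasFiniteControl
    (fun g : weightedSobolev Ω => ∫⁻ x in A, ‖sobolevFun g x‖ₑ ^ 2) ε

lemma FinitelyControlled.mono {A A' : Set E3} (h : FinitelyControlled Ω A') (hA : A ⊆ A') :
    FinitelyControlled Ω A := fun ε hε => (h ε hε).mono fun _ => lintegral_mono_set hA

lemma FinitelyControlled.union {A A' : Set E3} (h : FinitelyControlled Ω A)
    (h' : FinitelyControlled Ω A') : FinitelyControlled Ω (A ∪ A') := fun _ hε =>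
  (HasFiniteControl.add hε (h _ (half_pos hε)) (h' _ (half_pos hε))).mono fun _ =>
    lintegral_union_le _ _ _

lemma finitelyControlled_empty : FinitelyControlled Ω ∅ := fun ε _ =>
  (hasFiniteControl_zero ε).mono fun g => by simp

lemma setLIntegral_ball_comp_add (x c : E3) (r : ℝ) (f : E3 → ℝ≥0∞) :
    ∫⁻ y in Metric.ball (x + c) r, f y = ∫⁻ z in Metric.ball c r, f (x + z) := by
  rw [← (measurePreserving_add_left volume x).setLIntegral_comp_preimage_emb
    (measurableEmbedding_addLeft x)]
  congr 2
  ext z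
  simp [dist_eq_norm]

lemma volume_ball_two_mul (c c' : E3) {r : ℝ} (hr : 0 ≤ r) :
    volume (Metric.ball c (2 * r)) = 8 * volume (Metric.ball c' r) := by
  rw [Measure.addHaar_ball _ _ (by positivity), Measure.addHaar_ball _ _ hr, ← mul_assoc,
    finrank_euclideanSpace, Fintype.card_fin, mul_pow, ENNReal.ofReal_mul (by norm_num)]
  norm_num

/-- The mean over the base point of the difference quotients in the directions of a ball. -/
lemma lintegral_lintegral_translate_le (hΩ : IsOpen Ω) (g : weightedSobolev Ω) {U Z : Set E3}
    (hUo : IsOpen U) {ρ : ℝ} (hUb : U ⊆ Metric.ball 0 ρ) {κ : ℝ} (hκ : ∀ z ∈ Z, ‖z‖ ≤ κ)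
    (hZ : MeasurableSet Z) (hU : ∀ z ∈ Z, ∀ x ∈ U, ∀ s ∈ Set.Icc (0 : ℝ) 1, x + s • z ∈ Ω) :
    ∫⁻ x in U, ∫⁻ z in Z, ‖sobolevFun g x - sobolevFun g (x + z)‖ₑ ^ 2
      ≤ ENNReal.ofReal ((κ * ‖g‖) ^ 2) * volume Z := by
  have hm := measurable_sobolevFun g
  rw [lintegral_lintegral_swap (by
    refine Measurable.aemeasurable ?_
    simp only [Function.uncurry_def]
    fun_prop), ← setLIntegral_const]
  refine setLIntegral_mono' hZ fun z hz => ?_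
  simp only [enorm_sub_rev (sobolevFun g _) (sobolevFun g (_ + z))]
  refine (lintegral_translate_sub_le hΩ g hUo hUb (hU z hz)).trans (ENNReal.ofReal_le_ofReal ?_)
  have := hκ z hz
  gcongr

lemma ball_subset_truncated {U : Set E3} {ρ : ℝ} (hUb : U ⊆ Metric.ball 0 ρ) {d : E3} {r κ : ℝ}
    (hr0 : 0 < r) (hZκ : ∀ z ∈ Metric.ball d (2 * r), ‖z‖ ≤ κ)
    (hZU : ∀ z ∈ Metric.ball d (2 * r), ∀ x ∈ U, ∀ s ∈ Set.Icc (0 : ℝ) 1, x + s • z ∈ Ω) {c : E3}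
    (hc : c ∈ U) : Metric.ball (c + d) r ⊆ truncated Ω (ρ + κ) := by
  intro y hy
  have hz : y - c ∈ Metric.ball d (2 * r) := by
    have := mem_ball_iff_norm.1 hy
    rw [mem_ball_iff_norm, sub_sub]
    linarith
  have h1 := hZU _ hz c hc 1 (by simp)
  rw [one_smul, add_sub_cancel] at h1
  refine ⟨h1, mem_ball_zero_iff.2 ?_⟩
  have h2 := hZκ _ hz
  have h3 := mem_ball_zero_iff.1 (hUb hc)
  linarith [norm_le_norm_add_norm_sub' y c]

/-- The estimate of a function on `U` by its averages over finitely many balls. -/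
lemma finite_average_estimate (hΩ : IsOpen Ω) {U : Set E3} (hUo : IsOpen U) {ρ : ℝ}
    (hUb : U ⊆ Metric.ball 0 ρ) {d : E3} {r κ : ℝ} (hr0 : 0 < r)
    (hZκ : ∀ z ∈ Metric.ball d (2 * r), ‖z‖ ≤ κ)
    (hZU : ∀ z ∈ Metric.ball d (2 * r), ∀ x ∈ U, ∀ s ∈ Set.Icc (0 : ℝ) 1, x + s • z ∈ Ω)
    (g : weightedSobolev Ω) {T : Finset E3} (hTU : ∀ c ∈ T, c ∈ U)
    (hcov : U ⊆ ⋃ c ∈ T, Metric.ball c r) :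
    ∫⁻ x in U, ‖sobolevFun g x‖ₑ ^ 2 ≤ 16 * ENNReal.ofReal ((κ * ‖g‖) ^ 2)
      + 2 * (∑ c ∈ T, ‖⨍ y in Metric.ball (c + d) r, sobolevFun g y‖ₑ ^ 2) * volume U := by
  set Z := Metric.ball d (2 * r) with hZ
  set A := ∑ c ∈ T, ‖⨍ y in Metric.ball (c + d) r, sobolevFun g y‖ₑ ^ 2 with hA
  set b := volume (Metric.ball (0 : E3) r) with hb
  have hvol : ∀ c : E3, volume (Metric.ball c r) = b := fun c => by
    rw [hb, Measure.addHaar_ball _ _ hr0.le, Measure.addHaar_ball _ (0 : E3) hr0.le]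
  have hb0 : b ≠ 0 := (Metric.measure_ball_pos volume _ hr0).ne'
  have hbt : b ≠ ⊤ := measure_ball_lt_top.ne
  have hpt : ∀ x ∈ U, ‖sobolevFun g x‖ₑ ^ 2
      ≤ 2 * (b⁻¹ * ∫⁻ z in Z, ‖sobolevFun g x - sobolevFun g (x + z)‖ₑ ^ 2) + 2 * A := by
    intro x hx
    obtain ⟨c, hcT, hxc⟩ := Set.mem_iUnion₂.1 (hcov hx)
    have hint : IntegrableOn (sobolevFun g) (Metric.ball (c + d) r) :=
      (integrableOn_truncated (memLp_sobolevFun g) (ρ + κ)).mono_set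
        (ball_subset_truncated hUb hr0 hZκ hZU (hTU c hcT))
    have h1 := enorm_sq_le_average (by rw [hvol]; exact hb0) (by rw [hvol]; exact hbt) hint
      (sobolevFun g x)
    rw [hvol] at h1
    refine h1.trans (add_le_add (mul_le_mul_right (mul_le_mul_right ?_ _) _)
      (mul_le_mul_right ?_ _))
    · rw [hZ, ← setLIntegral_ball_comp_add x d (2 * r)
        (fun y => ‖sobolevFun g x - sobolevFun g y‖ₑ ^ 2)]
      refine lintegral_mono_set fun y hy => ?_
      have e1 := mem_ball_iff_norm.1 hy
      have e2 := mem_ball_iff_norm.1 hxc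
      rw [mem_ball_iff_norm]
      -- Since |x - c| < r, the ball of radius r about c + d lies in that of radius 2r about x + d.
      -- Doubling the radius lets finitely many centres serve all x.
      have e3 : y - (x + d) = (y - (c + d)) - (x - c) := by abel
      rw [e3]
      linarith [norm_sub_le (y - (c + d)) (x - c)]
    · exact Finset.single_le_sum
        (f := fun c => ‖⨍ y in Metric.ball (c + d) r, sobolevFun g y‖ₑ ^ 2)
        (fun _ _ => zero_le) hcT
  calc ∫⁻ x in U, ‖sobolevFun g x‖ₑ ^ 2
      ≤ ∫⁻ x in U, (2 * (b⁻¹ * ∫⁻ z in Z, ‖sobolevFun g x - sobolevFun g (x + z)‖ₑ ^ 2)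
        + 2 * A) := setLIntegral_mono' hUo.measurableSet hpt
    _ = 2 * (b⁻¹ * ∫⁻ x in U, ∫⁻ z in Z, ‖sobolevFun g x - sobolevFun g (x + z)‖ₑ ^ 2)
        + 2 * A * volume U := by
        rw [lintegral_add_right _ measurable_const, lintegral_const_mul' _ _ (by norm_num),
          lintegral_const_mul' _ _ (ENNReal.inv_ne_top.2 hb0), setLIntegral_const]
    _ ≤ 2 * (b⁻¹ * (ENNReal.ofReal ((κ * ‖g‖) ^ 2) * volume Z)) + 2 * A * volume U := by
        refine add_le_add_left (mul_le_mul_right (mul_le_mul_right ?_ _) _) _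
        exact lintegral_lintegral_translate_le hΩ g hUo hUb hZκ measurableSet_ball hZU
    _ = 16 * ENNReal.ofReal ((κ * ‖g‖) ^ 2) + 2 * A * volume U := by
        rw [hZ, volume_ball_two_mul _ 0 hr0.le, ← hb]
        congr 1
        -- The constant 16 is the 2 from squaring a sum times the volume ratio 2³ of the balls.
        have : 2 * (b⁻¹ * (ENNReal.ofReal ((κ * ‖g‖) ^ 2) * (8 * b)))
            = 2 * 8 * ENNReal.ofReal ((κ * ‖g‖) ^ 2) * (b⁻¹ * b) := by ring
        rw [this, ENNReal.inv_mul_cancel hb0 hbt, mul_one]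
        norm_num

/-- Compactness for a set which may be translated within `Ω` in the directions of small balls. -/
lemma hasFiniteControl_of_translate (hΩ : IsOpen Ω) {U : Set E3} (hUo : IsOpen U) {ρ : ℝ}
    (hUb : U ⊆ Metric.ball 0 ρ) {d : E3} {r κ ε : ℝ} (hr0 : 0 < r) (hε : 0 ≤ ε)
    (hZκ : ∀ z ∈ Metric.ball d (2 * r), ‖z‖ ≤ κ)
    (hZU : ∀ z ∈ Metric.ball d (2 * r), ∀ x ∈ U, ∀ s ∈ Set.Icc (0 : ℝ) 1, x + s • z ∈ Ω)
    (hκε : 16 * κ ^ 2 ≤ ε) :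
    HasFiniteControl (fun g : weightedSobolev Ω => ∫⁻ x in U, ‖sobolevFun g x‖ₑ ^ 2) ε := by
  classical
  have hUtb : TotallyBounded U :=
    (isCompact_closedBall (0 : E3) ρ).totallyBounded.subset
      (hUb.trans Metric.ball_subset_closedBall)
  obtain ⟨T, hTU, hTf, hcov⟩ := Metric.finite_approx_of_totallyBounded hUtb r hr0
  have hUfin : volume U ≠ ⊤ := ((measure_mono hUb).trans_lt measure_ball_lt_top).ne
  have hex : ∀ c : E3, ∃ l : weightedSobolev Ω →L[ℝ] ℝ,
      c ∈ U → ∀ g, l g = ⨍ y in Metric.ball (c + d) r, sobolevFun g y := by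
    intro c
    by_cases hc : c ∈ U
    · obtain ⟨l, hl⟩ := exists_averageFunctional (measurableSet_ball (x := c + d) (ε := r))
        (ball_subset_truncated hUb hr0 hZκ hZU hc)
      exact ⟨l, fun _ => hl⟩
    · exact ⟨0, fun h => absurd h hc⟩
  choose l hl using hex
  refine hasFiniteControl_of_exists hε hTf.toFinset l hUfin
    (D := fun g => 16 * ENNReal.ofReal ((κ * ‖g‖) ^ 2)) (fun g => ?_) fun g => ?_
  · have h1 := finite_average_estimate hΩ hUo hUb hr0 hZκ hZU g (T := hTf.toFinset)
      (fun c hc => hTU (hTf.mem_toFinset.1 hc)) (by simpa using hcov)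
    have h2 : ∑ c ∈ hTf.toFinset, ‖l c g‖ₑ ^ 2
        = ∑ c ∈ hTf.toFinset, ‖⨍ y in Metric.ball (c + d) r, sobolevFun g y‖ₑ ^ 2 :=
      Finset.sum_congr rfl fun c hc => by rw [hl c (hTU (hTf.mem_toFinset.1 hc))]
    rw [h2]
    exact h1
  · have h3 : (16 : ℝ≥0∞) * ENNReal.ofReal ((κ * ‖g‖) ^ 2)
        = ENNReal.ofReal (16 * κ ^ 2 * ‖g‖ ^ 2) := by
      rw [mul_assoc, ENNReal.ofReal_mul (by norm_num), ENNReal.ofReal_ofNat, mul_pow]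
    rw [h3]
    exact ENNReal.ofReal_le_ofReal (mul_le_mul_of_nonneg_right hκε (sq_nonneg _))

/-- Local compactness near a point satisfying the cone condition. -/
lemma ConeConditionAt.finitelyControlled (hΩ : IsOpen Ω) {p : E3} (hp : ConeConditionAt Ω p) :
    ∃ δ : ℝ, 0 < δ ∧ FinitelyControlled Ω (Ω ∩ Metric.ball p δ) := by
  obtain ⟨v, δ, hδ, hcone⟩ := hp
  refine ⟨δ, hδ, fun ε hε => ?_⟩
  have hUb : Ω ∩ Metric.ball p δ ⊆ Metric.ball 0 (‖p‖ + δ) := fun x hx => by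
    rw [mem_ball_zero_iff]
    have := mem_ball_iff_norm.1 hx.2
    linarith [norm_le_norm_add_norm_sub' x p]
  set κ := ‖v‖ + δ with hκ
  have hκ0 : 0 < κ := by positivity
  -- The ball of radius 2r = tδ about tv is the cone's ball scaled by t, so its vectors have norm at
  -- most tκ. Both t ≤ 1 and 16tκ² ≤ ε give 16(tκ)² ≤ ε, and t < δ keeps the segments within the
  -- cone condition.
  set t := min (min (δ / 2) 1) (ε / (16 * κ ^ 2)) with ht
  have ht0 : 0 < t := by positivity
  have ht1 : t ≤ 1 := (min_le_left _ _).trans (min_le_right _ _)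
  have htδ : t < δ := ((min_le_left _ _).trans (min_le_left _ _)).trans_lt (by linarith)
  have htε : t * (16 * κ ^ 2) ≤ ε := by
    rw [← le_div_iff₀ (by positivity)]
    exact min_le_right _ _
  refine hasFiniteControl_of_translate hΩ (hΩ.inter Metric.isOpen_ball) hUb (d := t • v)
    (r := t * δ / 2) (κ := t * κ) (by positivity) hε.le (fun z hz => ?_)
    (fun z hz x hx s hs => ?_) ?_
  · have h1 := mem_ball_iff_norm.1 hz
    have h2 := norm_le_norm_add_norm_sub' z (t • v)
    rw [norm_smul, Real.norm_of_nonneg ht0.le] at h2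
    have : t * κ = t * ‖v‖ + 2 * (t * δ / 2) := by rw [hκ]; ring
    linarith
  · rcases hs.1.eq_or_lt with h0 | h0
    · rw [← h0, zero_smul, add_zero]
      exact hx.1
    · have h1 : t⁻¹ • z ∈ Metric.ball v δ := by
        have h2 := mem_ball_iff_norm.1 hz
        have h3 : t⁻¹ • z - v = t⁻¹ • (z - t • v) := by
          rw [smul_sub, smul_smul, inv_mul_cancel₀ ht0.ne', one_smul]
        rw [mem_ball_iff_norm, h3, norm_smul, norm_inv, Real.norm_of_nonneg ht0.le,
          inv_mul_lt_iff₀ ht0]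
        exact h2.trans_le (le_of_eq (by ring))
      have h2 := hcone x hx (s * t) ⟨by positivity, by nlinarith [hs.2]⟩ _ h1
      rwa [smul_smul, mul_assoc, mul_inv_cancel₀ ht0.ne', mul_one] at h2
  · calc 16 * (t * κ) ^ 2 = t * (t * (16 * κ ^ 2)) := by ring
      _ ≤ 1 * (t * (16 * κ ^ 2)) := mul_le_mul_of_nonneg_right ht1 (by positivity)
      _ ≤ ε := by rw [one_mul]; exact htε

/-- Finite control passes to subsets and finite unions, so local control near each point of the
closure, boundary included, suffices by compactness. -/
lemma finitelyControlled_truncated (hΩ : IsOpen Ω) (hcone : ∀ p ∈ closure Ω, ConeConditionAt Ω p)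
    (r : ℝ) : FinitelyControlled Ω (truncated Ω r) := by
  have hK : IsCompact (Metric.closedBall (0 : E3) r ∩ closure Ω) :=
    (isCompact_closedBall _ _).inter_right isClosed_closure
  have key : FinitelyControlled Ω (Ω ∩ (Metric.closedBall (0 : E3) r ∩ closure Ω)) := by
    refine hK.induction_on (p := fun s => FinitelyControlled Ω (Ω ∩ s)) ?_ ?_ ?_ ?_
    · rw [Set.inter_empty]
      exact finitelyControlled_empty
    · exact fun s t hst h => h.mono (Set.inter_subset_inter_right _ hst)
    · intro s t hs ht
      rw [Set.inter_union_distrib_left]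
      exact hs.union ht
    · intro p hp
      obtain ⟨δ, hδ, h⟩ := (hcone p hp.2).finitelyControlled hΩ
      exact ⟨Metric.ball p δ, mem_nhdsWithin_of_mem_nhds (Metric.ball_mem_nhds p hδ), h⟩
  exact key.mono fun x hx => ⟨hx.1, Metric.ball_subset_closedBall hx.2, subset_closure hx.1⟩

/-- **Rellich's theorem**: the restriction `𝓗¹(Ω) → L²(Ω ∩ B(0, r))` is compact. -/
theorem isCompactOperator_sobolevToTruncated (hΩ : IsSmoothExteriorDomain Ω) (r : ℝ) :
    IsCompactOperator (sobolevToTruncated Ω r) := by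
  refine isCompactOperator_of_forall_le _ fun ε hε =>
    (finitelyControlled_truncated hΩ.isOpen (fun p hp => hΩ.coneConditionAt hp) r ε hε).mono
      fun g => le_of_eq ?_
  rw [Lp.enorm_def, eLpNorm_congr_ae (coeFn_sobolevToTruncated r g), eLpNorm_two_eq_lintegral,
    ← ENNReal.rpow_natCast, ← ENNReal.rpow_mul]
  norm_num

end Averages

end BDIE

end

theorem mainTheorem9
    (Ω : Set BDIE.E3) (hΩ : BDIE.IsSmoothExteriorDomain Ω)
    (a : BDIE.E3 → ℝ)
    (ha_C1 : ContDiff ℝ 1 a)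
    (ha_C2 : ContDiffOn ℝ 2 a (closure Ω))
    (ha_bounds : ∃ C₁ C₂ : ℝ, 0 < C₁ ∧ ∀ x ∈ Ω, C₁ < a x ∧ a x < C₂)
    (ha_grad : MemLp (fun x => BDIE.weight x • gradient a x) ∞ volume)
    (ha_decay : Tendsto (fun x => BDIE.weight x • gradient a x) (cocompact BDIE.E3) (𝓝 0)) :
    ∃ R : BDIE.weightedSobolev Ω →L[ℝ] BDIE.weightedSobolev Ω,
      BDIE.IsRemainderPotential Ω a R ∧
      (∀ R' : BDIE.weightedSobolev Ω →L[ℝ] BDIE.weightedSobolev Ω,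
        BDIE.IsRemainderPotential Ω a R' → R' = R) ∧
      (∀ ε : ℝ, 0 < ε →
        ∃ Rs Rc : BDIE.weightedSobolev Ω →L[ℝ] BDIE.weightedSobolev Ω,
          R = Rs + Rc ∧ ‖Rs‖ < ε ∧ IsCompactOperator Rc) ∧
      BDIE.IsFredholmOfIndexZero (ContinuousLinearMap.id ℝ (BDIE.weightedSobolev Ω) + R) := by
  obtain ⟨C₁, C₂, hC₁, hC⟩ := ha_bounds
  have ha : BDIE.IsCoefficient Ω a C₁ :=
    ⟨hΩ.isOpen, ha_C1, ha_C2, hC₁, fun x hx => (hC x hx).1⟩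
  -- Completeness is needed for the Neumann series behind the Fredholm property.
  have := BDIE.completeSpace_weightedSobolev hΩ.isOpen.measurableSet
  exact BDIE.existsUnique_fredholm_of_hasDecomposition
    (fun T T' hT hT' => BDIE.IsRemainderPotential.unique hΩ.isOpen hT hT')
    (fun ε hε => ha.exists_decomposition hΩ.isBounded_compl ha_decay
      (BDIE.isCompactOperator_sobolevToTruncated hΩ) hε)
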